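/- Let $M$ be a $(2n+1)$-dimensional strictly pseudoconvex CR manifold with CR structure $T_{1,0}(M)$, let $\theta$ be a contact form on $M$, $H(M)=\ker\theta$ the Levi distribution, $J$ its complex structure, $T$ the vector field with $\theta(T)=1$, $T\rfloor d\theta=0$, and set $JT=0$; the exterior derivative is normalized by $2\,d\theta(X,Y)=X\theta(Y)-Y\theta(X)-\theta([X,Y])$. Assume that $d\theta(X,JX)>0$ for $0\ne X\in H(M)$, let $g_\theta(X,Y)=d\theta(X,JY)+\theta(X)\theta(Y)$ be the Webster metric and $\Omega(X,Y)=g_\theta(X,JY)$. Let $\nabla$ be the Tanaka–Webster connection of $(M,\theta)$, i.e. the unique linear connection such that $H(M)$ is parallel, $\nabla g_\theta=0$, $\nabla J=0$, and whose torsion $T_\nabla$ satisfies $T_\nabla(Z,W)=T_\nabla(\overline Z,\overline W)=0$, $T_\nabla(Z,\overline W)=2\,d\theta(Z,\overline W)\,T$ for $Z,W\in T_{1,0}(M)$ and $\tau\circ J+J\circ\tau=0$, where $\tau(X)=T_\nabla(T,X)$. Assume that $(M,\theta)$ is Sasakian, i.e. $\tau=0$. Let $R(X,Y)=[\nabla_X,\nabla_Y]-\nabla_{[X,Y]}$.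 Let $\gamma:[a,b]\to M$ be a piecewise $C^\infty$ curve of constant speed $|\dot\gamma|=r>0$ which is a lengthy geodesic of $\nabla$, i.e. $\gamma$ is $C^1$, $\dot\gamma\in H(M)$ and $\nabla_{\dot\gamma}\dot\gamma=0$. Let $T_\gamma(\Gamma)$ be the space of piecewise $C^\infty$ vector fields $X$ along $\gamma$ with $X(a)=0$, $X(b)=0$. A variation of $\gamma$ inducing $X$ is a family of curves $\gamma^s:[a,b]\to M$, $|s|<\epsilon$, with $\gamma^0=\gamma$, $\gamma^s(a)=\gamma(a)$, $\gamma^s(b)=\gamma(b)$, such that $(t,s)\mapsto\gamma^s(t)$ is $C^\infty$ on each $[t_j,t_{j+1}]\times(-\epsilon,\epsilon)$ for some partition $a=t_0<\dots<t_k=b$, and such that $\frac{\partial}{\partial s}\gamma^s(t)|_{s=0}=X(t)$ for all $t\in[a,b]$. Let $L$ be the Riemannian length with respect to $g_\theta$. Then for every $X\in T_\gamma(\Gamma)$ there are variations inducing $X$, and for all of them $s\mapsto L(\gamma^s)$ is twice differentiable at $s=0$ with the same second derivative $$I(X,X)=\frac{d^2}{ds^2}\{L(\gamma^s)\}_{s=0}.$$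 If $I(X,Y)=\frac12\{I(X+Y,X+Y)-I(X,X)-I(Y,Y)\}$ is the index form obtained by polarization, then for all $X,Y\in T_\gamma(\Gamma)$ $$I(X,Y)=\frac1r\int_a^b\Big\{g_\theta(\nabla_{\dot\gamma}X^\perp,\nabla_{\dot\gamma}Y^\perp)-g_\theta(R(X^\perp,\dot\gamma)\dot\gamma,Y^\perp)-2\,\Omega(X^\perp,\dot\gamma)\,\theta(\nabla_{\dot\gamma}Y^\perp)-2\,[\theta(\nabla_{\dot\gamma}X^\perp)-2\,\Omega(X^\perp,\dot\gamma)]\,\Omega(Y^\perp,\dot\gamma)\Big\}\,dt,$$ where $X^\perp=X-\frac1{r^2}\,g_\theta(X,\dot\gamma)\,\dot\gamma$. -/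

import Mathlib

open Set Filter Topology MeasureTheory Bundle
open scoped Manifold ContDiff

noncomputable section

namespace CRGeom

variable {E : Type*} [NormedAddCommGroup E] [NormedSpace ℝ E] [FiniteDimensional ℝ E]
  {M : Type*} [TopologicalSpace M] [ChartedSpace E M] [IsManifold 𝓘(ℝ, E) ∞ M]

/-! ### Complexified tangent vectors and bilinear maps -/

variable (E) in
/-- `T_x(M) ⊗ ℂ`: the pair `(X, Y)` stands for the complex tangent vector `X + i Y`. -/
abbrev CTangentSpace (x : M) : Type _ := TangentSpace 𝓘(ℝ, E) x × TangentSpace 𝓘(ℝ, E) x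

/-- Complex conjugation `X + i Y ↦ X - i Y`. -/
def conjVec {x : M} (Z : CTangentSpace E x) : CTangentSpace E x := (Z.1, -Z.2)

/-- `c V` for a complex number `c` and a real tangent vector `V`. -/
def csmulReal {x : M} (c : ℂ) (V : TangentSpace 𝓘(ℝ, E) x) : CTangentSpace E x :=
  (c.re • V, c.im • V)

/-- Complex bilinear extension of a `T_x(M)`-valued real bilinear map. -/
def complexify₂ {x : M}
    (B : TangentSpace 𝓘(ℝ, E) x → TangentSpace 𝓘(ℝ, E) x → TangentSpace 𝓘(ℝ, E) x)
    (Z W : CTangentSpace E x) : CTangentSpace E x :=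
  (B Z.1 W.1 - B Z.2 W.2, B Z.1 W.2 + B Z.2 W.1)

/-- Complex bilinear extension of a real valued real bilinear form. -/
def complexifyForm {x : M}
    (B : TangentSpace 𝓘(ℝ, E) x → TangentSpace 𝓘(ℝ, E) x → ℝ)
    (Z W : CTangentSpace E x) : ℂ :=
  ⟨B Z.1 W.1 - B Z.2 W.2, B Z.1 W.2 + B Z.2 W.1⟩

/-- Lie bracket of complex vector fields (complex bilinear extension of the Lie bracket). -/
def complexBracket (Z W : ∀ x : M, CTangentSpace E x) (x : M) : CTangentSpace E x :=
  (VectorField.mlieBracket 𝓘(ℝ, E) (fun y => (Z y).1) (fun y => (W y).1) x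
      - VectorField.mlieBracket 𝓘(ℝ, E) (fun y => (Z y).2) (fun y => (W y).2) x,
    VectorField.mlieBracket 𝓘(ℝ, E) (fun y => (Z y).1) (fun y => (W y).2) x
      + VectorField.mlieBracket 𝓘(ℝ, E) (fun y => (Z y).2) (fun y => (W y).1) x)

/-! ### Smooth tensor fields, exterior derivative of a 1-form -/

/-- The vector field `X` is `C^∞` near `x`. -/
def SmoothFieldAt (X : ∀ x : M, TangentSpace 𝓘(ℝ, E) x) (x : M) : Prop :=
  ContMDiffAt 𝓘(ℝ, E) 𝓘(ℝ, E).tangent ∞ (fun y => (⟨y, X y⟩ : TangentBundle 𝓘(ℝ, E) M)) x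

/-- The complex vector field `Z` is `C^∞` near `x`. -/
def SmoothComplexFieldAt (Z : ∀ x : M, CTangentSpace E x) (x : M) : Prop :=
  SmoothFieldAt (fun y => (Z y).1) x ∧ SmoothFieldAt (fun y => (Z y).2) x

/-- The exterior derivative of a 1-form, with the convention
`2 (dθ)(U, V) = U(θ(V)) - V(θ(U)) - θ([U, V])`; the tangent vectors `u`, `v` are extended
to vector fields which are smooth near `x` (the value does not depend on the extension). -/
def extDerivOne (θ : ∀ x : M, TangentSpace 𝓘(ℝ, E) x →L[ℝ] ℝ) (x : M)
    (u v : TangentSpace 𝓘(ℝ, E) x) : ℝ :=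
  (1 / 2) *
    (mvfderiv 𝓘(ℝ, E) (fun y => θ y (FiberBundle.extend E v y)) x u
      - mvfderiv 𝓘(ℝ, E) (fun y => θ y (FiberBundle.extend E u y)) x v
      - θ x (VectorField.mlieBracket 𝓘(ℝ, E)
          (FiberBundle.extend E u) (FiberBundle.extend E v) x))

/-! ### Strictly pseudoconvex CR manifolds with a contact form -/

variable (E M) in
/-- A strictly pseudoconvex CR structure (of hypersurface type) on `M` together with a contact form
`θ` whose real Levi form is positive definite. The Levi distribution is `H(M) = Ker θ`, with complex
structure `J` (extended by `J T = 0`), the CR structure is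
`T_{1,0}(M) = {X - i J X : X ∈ H(M)}`, and `T` is the characteristic direction of `dθ`. -/
structure PseudohermitianStructure where
  /-- the contact form -/
  θ : ∀ x : M, TangentSpace 𝓘(ℝ, E) x →L[ℝ] ℝ
  /-- the complex structure of the Levi distribution, extended by `J T = 0` -/
  J : ∀ x : M, TangentSpace 𝓘(ℝ, E) x →L[ℝ] TangentSpace 𝓘(ℝ, E) x
  /-- the characteristic direction -/
  T : ∀ x : M, TangentSpace 𝓘(ℝ, E) x
  smooth_θ : ContMDiff 𝓘(ℝ, E) (𝓘(ℝ, E).prod 𝓘(ℝ, E →L[ℝ] ℝ)) ∞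
    (fun x => (⟨x, θ x⟩ : TotalSpace (E →L[ℝ] ℝ) (fun x : M => TangentSpace 𝓘(ℝ, E) x →L[ℝ] ℝ)))
  smooth_J : ContMDiff 𝓘(ℝ, E) (𝓘(ℝ, E).prod 𝓘(ℝ, E →L[ℝ] E)) ∞
    (fun x => (⟨x, J x⟩ : TotalSpace (E →L[ℝ] E)
      (fun x : M => TangentSpace 𝓘(ℝ, E) x →L[ℝ] TangentSpace 𝓘(ℝ, E) x)))
  smooth_T : ContMDiff 𝓘(ℝ, E) 𝓘(ℝ, E).tangent ∞
    (fun x => (⟨x, T x⟩ : TangentBundle 𝓘(ℝ, E) M))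
  θ_T : ∀ x, θ x (T x) = 1
  dθ_T : ∀ x v, extDerivOne θ x (T x) v = 0
  J_T : ∀ x, J x (T x) = 0
  θ_J : ∀ x v, θ x v = 0 → θ x (J x v) = 0
  J_J : ∀ x v, θ x v = 0 → J x (J x v) = -v
  /-- formal integrability: `Z, W ∈ T_{1,0}(M)` implies `[Z, W] ∈ T_{1,0}(M)` -/
  integrable : ∀ Z W : (∀ x : M, CTangentSpace E x), ∀ x : M,
    SmoothComplexFieldAt Z x → SmoothComplexFieldAt W x →
    (∀ y, ∃ v : TangentSpace 𝓘(ℝ, E) y, θ y v = 0 ∧ Z y = (v, -J y v)) →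
    (∀ y, ∃ v : TangentSpace 𝓘(ℝ, E) y, θ y v = 0 ∧ W y = (v, -J y v)) →
    ∃ v : TangentSpace 𝓘(ℝ, E) x, θ x v = 0 ∧ complexBracket Z W x = (v, -J x v)
  /-- strict pseudoconvexity: `G_θ(v, v) = (dθ)(v, J v) > 0` on `H(M)` -/
  levi_pos : ∀ x v, θ x v = 0 → v ≠ 0 → 0 < extDerivOne θ x v (J x v)

namespace PseudohermitianStructure

variable (P : PseudohermitianStructure E M)

/-- The form `dθ`. -/
def dθ (x : M) (u v : TangentSpace 𝓘(ℝ, E) x) : ℝ := extDerivOne P.θ x u v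

/-- The CR structure `T_{1,0}(M)_x`. -/
def T10 (x : M) : Set (CTangentSpace E x) :=
  {Z | ∃ v : TangentSpace 𝓘(ℝ, E) x, P.θ x v = 0 ∧ Z = (v, -P.J x v)}

/-- The complex Levi form `L_θ(Z, W̄) = -i (dθ)(Z, W̄)` (the second argument is `W̄`). -/
def levi (x : M) (Z Wbar : CTangentSpace E x) : ℂ :=
  -Complex.I * complexifyForm (P.dθ x) Z Wbar

/-- The Webster metric: `g_θ = G_θ` on `H(M)`, `g_θ(X, T) = 0` for `X ∈ H(M)`, `g_θ(T, T) = 1`,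
where `G_θ(X, Y) = (dθ)(X, J Y)`. -/
def g (x : M) (u v : TangentSpace 𝓘(ℝ, E) x) : ℝ :=
  P.dθ x u (P.J x v) + P.θ x u * P.θ x v

/-- `Ω(X, Y) = g_θ(X, J Y)`. -/
def Ω (x : M) (u v : TangentSpace 𝓘(ℝ, E) x) : ℝ := P.g x u (P.J x v)

/-- The Tanaka-Webster connection of `(M, θ)`: the (unique) `C^∞` linear connection for which `H(M)`
is parallel, `∇ g_θ = 0`, `∇ J = 0`, and whose torsion is pure. In Mathlib's convention `D Y x v` is
`(∇_v Y)_x`, and `D.torsion x u v` is `T_∇(u, v)`. -/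
structure IsTanakaWebster
    (D : CovariantDerivative 𝓘(ℝ, E) E (TangentSpace 𝓘(ℝ, E) : M → Type _)) : Prop where
  smooth : D.ContMDiffCovariantDerivative ∞
  parallel_H : ∀ (x : M) (Y : ∀ y : M, TangentSpace 𝓘(ℝ, E) y) (v : TangentSpace 𝓘(ℝ, E) x),
    SmoothFieldAt Y x → (∀ y, P.θ y (Y y) = 0) → P.θ x (D Y x v) = 0
  parallel_g : ∀ (x : M) (Y Z : ∀ y : M, TangentSpace 𝓘(ℝ, E) y) (v : TangentSpace 𝓘(ℝ, E) x),
    SmoothFieldAt Y x → SmoothFieldAt Z x →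
    mvfderiv 𝓘(ℝ, E) (fun y => P.g y (Y y) (Z y)) x v
      = P.g x (D Y x v) (Z x) + P.g x (Y x) (D Z x v)
  parallel_J : ∀ (x : M) (Y : ∀ y : M, TangentSpace 𝓘(ℝ, E) y) (v : TangentSpace 𝓘(ℝ, E) x),
    SmoothFieldAt Y x → D (fun y => P.J y (Y y)) x v = P.J x (D Y x v)
  torsion_hol : ∀ x, ∀ Z ∈ P.T10 x, ∀ W ∈ P.T10 x,
    complexify₂ (fun u v => D.torsion x u v) Z W = 0
  torsion_antihol : ∀ x, ∀ Z ∈ P.T10 x, ∀ W ∈ P.T10 x,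
    complexify₂ (fun u v => D.torsion x u v) (conjVec Z) (conjVec W) = 0
  torsion_mixed : ∀ x, ∀ Z ∈ P.T10 x, ∀ W ∈ P.T10 x,
    complexify₂ (fun u v => D.torsion x u v) Z (conjVec W)
      = csmulReal (2 * Complex.I * P.levi x Z (conjVec W)) (P.T x)
  /-- `τ ∘ J + J ∘ τ = 0`, where `τ(X) = T_∇(T, X)` -/
  tau_J : ∀ x v, D.torsion x (P.T x) (P.J x v) + P.J x (D.torsion x (P.T x) v) = 0

/-- `(M, θ)`, with Tanaka-Webster connection `D`, is a Sasakian manifold: the pseudohermitian torsion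
`τ(X) = T_∇(T, X)` vanishes. -/
def IsSasakian (D : CovariantDerivative 𝓘(ℝ, E) E (TangentSpace 𝓘(ℝ, E) : M → Type _)) : Prop :=
  ∀ x v, D.torsion x (P.T x) v = 0

end PseudohermitianStructure

/-! ### Curvature and covariant differentiation along curves -/

/-- The curvature `R(u, v) w = ∇_U ∇_V W - ∇_V ∇_U W - ∇_{[U, V]} W`, where `U, V, W` are vector
fields extending `u, v, w` which are smooth near `x` (the value does not depend on them). -/
def curvature (D : CovariantDerivative 𝓘(ℝ, E) E (TangentSpace 𝓘(ℝ, E) : M → Type _)) (x : M)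
    (u v w : TangentSpace 𝓘(ℝ, E) x) : TangentSpace 𝓘(ℝ, E) x :=
  D (fun y => D (FiberBundle.extend E w) y (FiberBundle.extend E v y)) x u
    - D (fun y => D (FiberBundle.extend E w) y (FiberBundle.extend E u y)) x v
    - D (FiberBundle.extend E w) x
        (VectorField.mlieBracket 𝓘(ℝ, E) (FiberBundle.extend E u) (FiberBundle.extend E v) x)

/-- The tangent vector `γ̇(t)` (at interior points of the parameter interval). -/
def velocity (γ : ℝ → M) (t : ℝ) : TangentSpace 𝓘(ℝ, E) (γ t) :=
  mfderiv 𝓘(ℝ, ℝ) 𝓘(ℝ, E) γ t (1 : ℝ)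

/-- The components, near `t`, of a vector field `X` along `γ` in the coordinate frame around
`γ t`. -/
def frameCoord (γ : ℝ → M) (X : ∀ s, TangentSpace 𝓘(ℝ, E) (γ s)) (t s : ℝ) : E :=
  (trivializationAt E (TangentSpace 𝓘(ℝ, E) : M → Type _) (γ t) ⟨γ s, X s⟩).2

/-- The covariant derivative `∇_γ̇ X` of a vector field `X` along `γ`. If `X = X^i e_i` where
`e_i` is the coordinate frame around `γ t`, this is `(dX^i/dt) e_i + X^i(t) ∇_{γ̇(t)} e_i`; note that
`FiberBundle.extend E (X t)` is the vector field `X^i(t) e_i` near `γ t`. -/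
def covDerivAlong (D : CovariantDerivative 𝓘(ℝ, E) E (TangentSpace 𝓘(ℝ, E) : M → Type _))
    (γ : ℝ → M) (X : ∀ s, TangentSpace 𝓘(ℝ, E) (γ s)) (t : ℝ) : TangentSpace 𝓘(ℝ, E) (γ t) :=
  (trivializationAt E (TangentSpace 𝓘(ℝ, E) : M → Type _) (γ t)).symm (γ t)
      (deriv (frameCoord γ X t) t)
    + D (FiberBundle.extend E (X t)) (γ t) (velocity γ t)

variable (E) in
/-- `γ : [a, b] → M` is a geodesic of `D`: a `C^1` curve whose velocity field is differentiable with
`∇_γ̇ γ̇ = 0`. -/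
structure IsGeodesic (D : CovariantDerivative 𝓘(ℝ, E) E (TangentSpace 𝓘(ℝ, E) : M → Type _))
    (a b : ℝ) (γ : ℝ → M) : Prop where
  contMDiffOn : ContMDiffOn 𝓘(ℝ, ℝ) 𝓘(ℝ, E) 1 γ (Icc a b)
  differentiableAt : ∀ t ∈ Ioo a b,
    DifferentiableAt ℝ (frameCoord (E := E) γ (velocity γ) t) t
  eq_zero : ∀ t ∈ Ioo a b, covDerivAlong D γ (velocity γ) t = 0

/-! ### Curves, vector fields along curves and variations -/

/-- `p c d` holds on every closed subinterval `[c, d]` of `[a, b]` having no point of a suitable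
finite set of break points in its interior. For a property inherited by subintervals: `p` holds on
each interval `[t_j, t_{j+1}]` of a partition of `[a, b]`. -/
def Piecewise (a b : ℝ) (p : ℝ → ℝ → Prop) : Prop :=
  ∃ S : Finset ℝ, ∀ c d, a ≤ c → c < d → d ≤ b → (∀ x ∈ S, x ∉ Ioo c d) → p c d

/-- The space `T_γ(Γ)` of piecewise differentiable (i.e. `C^∞` on each closed interval of a
partition) vector fields along `γ : [a, b] → M` which vanish at the end points. -/
structure MemTangentSpace (a b : ℝ) (γ : ℝ → M) (X : ∀ t, TangentSpace 𝓘(ℝ, E) (γ t)) : Prop where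
  piecewise : Piecewise a b fun c d =>
    ContMDiffOn 𝓘(ℝ, ℝ) 𝓘(ℝ, E).tangent ∞
      (fun t => (⟨γ t, X t⟩ : TangentBundle 𝓘(ℝ, E) M)) (Icc c d)
  left : X a = 0
  right : X b = 0

/-- `f s t = γ^s(t)`, `|s| < ε`, is a variation of `γ : [a, b] → M` with fixed end points which
induces the vector field `X` along `γ`. -/
structure IsVariation (a b : ℝ) (γ : ℝ → M) (X : ∀ t, TangentSpace 𝓘(ℝ, E) (γ t))
    (ε : ℝ) (f : ℝ → ℝ → M) : Prop where
  ε_pos : 0 < ε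
  left : ∀ s ∈ Ioo (-ε) ε, f s a = γ a
  right : ∀ s ∈ Ioo (-ε) ε, f s b = γ b
  base : ∀ t ∈ Icc a b, f 0 t = γ t
  piecewise : Piecewise a b fun c d =>
    ContMDiffOn 𝓘(ℝ, ℝ × ℝ) 𝓘(ℝ, E) ∞ (fun q : ℝ × ℝ => f q.2 q.1) (Icc c d ×ˢ Ioo (-ε) ε)
  /-- the tangent vector at `s = 0` to `σ_t(s) = γ^s(t)` is `X t` -/
  field : ∀ t ∈ Icc a b,
    tangentMap 𝓘(ℝ, ℝ) 𝓘(ℝ, E) (fun s => f s t) ⟨0, (1 : ℝ)⟩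
      = (⟨γ t, X t⟩ : TangentBundle 𝓘(ℝ, E) M)

namespace PseudohermitianStructure

variable (P : PseudohermitianStructure E M)

/-- The Riemannian length of `c : [a, b] → M` with respect to the Webster metric. -/
def length (a b : ℝ) (c : ℝ → M) : ℝ :=
  ∫ t in a..b, Real.sqrt (P.g (c t) (velocity c t) (velocity c t))

/-- The set `Γ` of piecewise differentiable curves `γ : [a, b] → M` from `y` to `z`, parametrized
proportionally to arc length; `r` is the constant length of `γ̇`. -/
structure MemPaths (a b : ℝ) (y z : M) (r : ℝ) (γ : ℝ → M) : Prop where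
  left : γ a = y
  right : γ b = z
  piecewise : Piecewise a b fun c d => ContMDiffOn 𝓘(ℝ, ℝ) 𝓘(ℝ, E) ∞ γ (Icc c d)
  speed : ∀ t ∈ Ioo a b, MDifferentiableAt 𝓘(ℝ, ℝ) 𝓘(ℝ, E) γ t →
    Real.sqrt (P.g (γ t) (velocity γ t) (velocity γ t)) = r

/-- `γ : [a, b] → M` is lengthy: `γ̇(t) ∈ H(M)` wherever `γ̇(t)` is defined. -/
def IsLengthy (a b : ℝ) (γ : ℝ → M) : Prop :=
  ∀ t ∈ Ioo a b, MDifferentiableAt 𝓘(ℝ, ℝ) 𝓘(ℝ, E) γ t → P.θ (γ t) (velocity γ t) = 0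

/-- The second variation of the length at `γ` in the direction `X` is well defined and equals `h`:
there are variations of `γ` inducing `X`, and for each of them `s ↦ L(γ^s)` is twice differentiable
at `s = 0` with second derivative `h`. -/
def HasSecondVariation (a b : ℝ) (γ : ℝ → M) (X : ∀ t, TangentSpace 𝓘(ℝ, E) (γ t))
    (h : ℝ) : Prop :=
  (∃ ε f, IsVariation a b γ X ε f) ∧
  ∀ ε f, IsVariation a b γ X ε f →
    ∃ L' : ℝ → ℝ, (∀ᶠ s in 𝓝 0, HasDerivAt (fun s => P.length a b (f s)) (L' s) s) ∧
      HasDerivAt L' h 0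

/-- `I(X, X) = d²/ds² L(γ^s)` at `s = 0` (meaningful when the second variation is well defined). -/
def secondVariation (a b : ℝ) (γ : ℝ → M) (X : ∀ t, TangentSpace 𝓘(ℝ, E) (γ t)) : ℝ :=
  Classical.epsilon (P.HasSecondVariation a b γ X)

/-- The index form `I(X, Y)`, obtained from `I(X, X)` by polarization. -/
def indexForm (a b : ℝ) (γ : ℝ → M) (X Y : ∀ t, TangentSpace 𝓘(ℝ, E) (γ t)) : ℝ :=
  (1 / 2) * (P.secondVariation a b γ (fun t => X t + Y t)
    - P.secondVariation a b γ X - P.secondVariation a b γ Y)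

/-- `X^⊥ = X - (1/r²) g_θ(X, γ̇) γ̇`. -/
def perp (r : ℝ) (γ : ℝ → M) (X : ∀ t, TangentSpace 𝓘(ℝ, E) (γ t)) (t : ℝ) :
    TangentSpace 𝓘(ℝ, E) (γ t) :=
  X t - (1 / r ^ 2 * P.g (γ t) (X t) (velocity γ t)) • velocity γ t

/-- The expression
`g_θ(∇_γ̇ V, ∇_γ̇ W) - g_θ(R(V, γ̇)γ̇, W) - 2 Ω(V, γ̇) θ(∇_γ̇ W) - 2 [θ(∇_γ̇ V) - 2 Ω(V, γ̇)] Ω(W, γ̇)`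
for vector fields `V`, `W` along `γ`. -/
def indexIntegrand (D : CovariantDerivative 𝓘(ℝ, E) E (TangentSpace 𝓘(ℝ, E) : M → Type _))
    (γ : ℝ → M) (V W : ∀ t, TangentSpace 𝓘(ℝ, E) (γ t)) (t : ℝ) : ℝ :=
  P.g (γ t) (covDerivAlong D γ V t) (covDerivAlong D γ W t)
    - P.g (γ t) (curvature D (γ t) (V t) (velocity γ t) (velocity γ t)) (W t)
    - 2 * P.Ω (γ t) (V t) (velocity γ t) * P.θ (γ t) (covDerivAlong D γ W t)
    - 2 * (P.θ (γ t) (covDerivAlong D γ V t) - 2 * P.Ω (γ t) (V t) (velocity γ t))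
        * P.Ω (γ t) (W t) (velocity γ t)

end PseudohermitianStructure

end CRGeom

end

noncomputable section

namespace CRGeom

variable {E : Type*} [NormedAddCommGroup E] [NormedSpace ℝ E] [FiniteDimensional ℝ E]
  {M : Type*} [TopologicalSpace M] [ChartedSpace E M] [IsManifold 𝓘(ℝ, E) ∞ M]

set_option linter.unusedSectionVars false

/-! ### Coordinates on the tangent bundle -/

/-! All local work is done in a chart. There the Tanaka–Webster connection of a Sasakian manifold
becomes a field of Christoffel symbols for which the metric `G`, the form `B = dθ` and the field `T`
are parallel, and whose torsion is `2 B ⊗ T`. Besides `G(T, T) = 1`, nothing else about the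
connection enters the variational computation; `IsLocalModel` records these facts and
`IsTanakaWebster.isLocalModel` derives them.

Let `F(t, s)` be a variation in a chart, `V = ∂_t F`, `X = ∂_s F`. The torsion gives `∇_s V = ∇_t X
+ 2 B(X, V) T =: A`. On the geodesic `G(T, V) = 0`, `∇_t V = 0` and `G(V, V) = r²`. So half of `∂_s
G(V, V)` is `G(∇_t X, V)`, and half of `∂_s² G(V, V)` is `G(A, A) + G(R(X, V)X, V) + ∂_t G(∇_s X,
V)`: differentiating the torsion term once more only produces a multiple of the parallel field `T`,
which is orthogonal to `V`. Passing to the square root subtracts `G(∇_t X, V)²/r²`, which is the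
effect of replacing `X` by `X^⊥`, while expanding `G(A, A)` produces the terms in `Ω` and `θ`. This
is `fderiv_fderiv_sqrt_speed` combined with `indexDensity_perp`.

Integration over a short piece leaves the boundary values of `G(∇_s X, V)`. Since `γ` is `C^1`, `V`
does not jump, and `∇_s X` at a given `t` depends only on the curve `s ↦ γ^s(t)`. The boundary value
is therefore a function of `t` alone (`endTerm`): it cancels between adjacent pieces
(`HasLengthExpansion.trans`) and vanishes at the fixed end points (`endTerm_eq_zero`).

Variations exist: on pieces lying in a chart one moves along straight lines, corrected so that the
ends of the piece follow curves prescribed by the vector field alone; such pieces glue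
(`exists_isVariation`).

Polarization needs the integrand to be symmetric, hence `G(R(X, V)V, Y) = G(R(Y, V)V, X)`. This
follows from the pair symmetry of `R`, whose only delicate ingredient is the first Bianchi identity:
its torsion corrections cancel because `B` and `T` are parallel and `B(T, ·) = 0` (`curv_bianchi`).
-/

/-- The components of tangent vectors at `y` in the coordinate frame around `x₀`. -/
def coordL (x₀ y : M) : TangentSpace 𝓘(ℝ, E) y →L[ℝ] E :=
  (trivializationAt E (TangentSpace 𝓘(ℝ, E) : M → Type _) x₀).continuousLinearMapAt ℝ y

/-- The tangent vector at `y` with given components in the coordinate frame around `x₀`. -/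
def frameL (x₀ y : M) : E →L[ℝ] TangentSpace 𝓘(ℝ, E) y :=
  (trivializationAt E (TangentSpace 𝓘(ℝ, E) : M → Type _) x₀).symmL ℝ y

/-- The component function of a vector field in the chart around `x₀`. -/
def rep (x₀ : M) (Y : ∀ y : M, TangentSpace 𝓘(ℝ, E) y) (z : E) : E :=
  coordL x₀ ((extChartAt 𝓘(ℝ, E) x₀).symm z) (Y ((extChartAt 𝓘(ℝ, E) x₀).symm z))

section Coordinates

variable {x₀ y : M}

lemma mem_baseSet_iff : y ∈ (trivializationAt E (TangentSpace 𝓘(ℝ, E) : M → Type _) x₀).baseSet ↔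
    y ∈ (chartAt E x₀).source := by
  rw [TangentBundle.trivializationAt_baseSet]

lemma coordL_frameL (hy : y ∈ (chartAt E x₀).source) (w : E) :
    coordL x₀ y (frameL x₀ y w) = w :=
  (trivializationAt E (TangentSpace 𝓘(ℝ, E) : M → Type _) x₀).continuousLinearMapAt_symmL
    (mem_baseSet_iff.2 hy) w

lemma frameL_coordL (hy : y ∈ (chartAt E x₀).source) (v : TangentSpace 𝓘(ℝ, E) y) :
    frameL x₀ y (coordL x₀ y v) = v :=
  (trivializationAt E (TangentSpace 𝓘(ℝ, E) : M → Type _) x₀).symmL_continuousLinearMapAt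
    (mem_baseSet_iff.2 hy) v

lemma frameL_of_notMem (hy : y ∉ (chartAt E x₀).source) (w : E) : frameL x₀ y w = 0 :=
  (trivializationAt E (TangentSpace 𝓘(ℝ, E) : M → Type _) x₀).symmL_apply_of_notMem
    (fun h => hy (mem_baseSet_iff.1 h)) w

lemma coordL_injective (hy : y ∈ (chartAt E x₀).source) :
    Function.Injective (coordL (E := E) x₀ y) :=
  Function.LeftInverse.injective (frameL_coordL hy)

lemma coordL_eq_mfderiv (hy : y ∈ (chartAt E x₀).source) :
    coordL x₀ y = mfderiv 𝓘(ℝ, E) 𝓘(ℝ, E) (extChartAt 𝓘(ℝ, E) x₀) y :=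
  TangentBundle.continuousLinearMapAt_trivializationAt hy

lemma frameL_eq_mfderiv (hy : y ∈ (chartAt E x₀).source) (w : E) :
    (mfderiv 𝓘(ℝ, E) 𝓘(ℝ, E) (extChartAt 𝓘(ℝ, E) x₀).symm
      (extChartAt 𝓘(ℝ, E) x₀ y) : E → E) w = frameL x₀ y w := by
  have h := TangentBundle.symmL_trivializationAt (I := 𝓘(ℝ, E)) hy
  have h2 : range (𝓘(ℝ, E) : ModelWithCorners ℝ E E) = univ := by simp
  rw [h2, mfderivWithin_univ] at h
  exact (DFunLike.congr_fun h w).symm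

lemma coordL_apply (hy : y ∈ (chartAt E x₀).source) (v : TangentSpace 𝓘(ℝ, E) y) :
    (trivializationAt E (TangentSpace 𝓘(ℝ, E) : M → Type _) x₀ ⟨y, v⟩).2 = coordL x₀ y v := by
  rw [coordL, Trivialization.continuousLinearMapAt_apply_of_mem ℝ _ (mem_baseSet_iff.2 hy)]

lemma extend_eq (v : TangentSpace 𝓘(ℝ, E) x₀) (hy : y ∈ (chartAt E x₀).source) :
    FiberBundle.extend E v y = frameL x₀ y (coordL x₀ x₀ v) := by
  have h : (trivializationAt E (TangentSpace 𝓘(ℝ, E) : M → Type _) x₀ ⟨x₀, v⟩).2 =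
    coordL x₀ x₀ v := coordL_apply (mem_chart_source E x₀) v
  unfold FiberBundle.extend
  rw [h]
  exact ((trivializationAt E (TangentSpace 𝓘(ℝ, E) : M → Type _) x₀).symmL_apply
      (mem_baseSet_iff.2 hy) _).symm

lemma symm_mem_source {z : E} (hz : z ∈ (extChartAt 𝓘(ℝ, E) x₀).target) :
    (extChartAt 𝓘(ℝ, E) x₀).symm z ∈ (chartAt E x₀).source := by
  have := (extChartAt 𝓘(ℝ, E) x₀).map_target hz
  rwa [extChartAt_source] at this

lemma chart_mem_target (hy : y ∈ (chartAt E x₀).source) :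
    extChartAt 𝓘(ℝ, E) x₀ y ∈ (extChartAt 𝓘(ℝ, E) x₀).target :=
  (extChartAt 𝓘(ℝ, E) x₀).map_source (by rwa [extChartAt_source])

lemma chart_symm_chart (hy : y ∈ (chartAt E x₀).source) :
    (extChartAt 𝓘(ℝ, E) x₀).symm (extChartAt 𝓘(ℝ, E) x₀ y) = y :=
  (extChartAt 𝓘(ℝ, E) x₀).left_inv (by rwa [extChartAt_source])

lemma contMDiffAt_chart (hy : y ∈ (chartAt E x₀).source) :
    ContMDiffAt 𝓘(ℝ, E) 𝓘(ℝ, E) ∞ (extChartAt 𝓘(ℝ, E) x₀) y :=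
  contMDiffAt_extChartAt' hy

lemma contMDiffAt_chart_symm {z : E} (hz : z ∈ (extChartAt 𝓘(ℝ, E) x₀).target) :
    ContMDiffAt 𝓘(ℝ, E) 𝓘(ℝ, E) ∞ (extChartAt 𝓘(ℝ, E) x₀).symm z :=
  (contMDiffOn_extChartAt_symm x₀).contMDiffAt
    ((isOpen_extChartAt_target x₀).mem_nhds hz)

lemma isOpen_target : IsOpen (extChartAt 𝓘(ℝ, E) x₀).target := isOpen_extChartAt_target x₀

lemma eventually_symm_chart (hy : y ∈ (chartAt E x₀).source) :
    ∀ᶠ y' in 𝓝 y, (extChartAt 𝓘(ℝ, E) x₀).symm (extChartAt 𝓘(ℝ, E) x₀ y') = y' := by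
  filter_upwards [(chartAt E x₀).open_source.mem_nhds hy] with y' hy' using chart_symm_chart hy'

variable {F : Type*} [NormedAddCommGroup F] [NormedSpace ℝ F]

lemma contMDiffAt_iff_chart {f : M → F} {k : ℕ∞} (hy : y ∈ (chartAt E x₀).source) :
    ContMDiffAt 𝓘(ℝ, E) 𝓘(ℝ, F) k f y ↔
      ContDiffAt ℝ k (f ∘ (extChartAt 𝓘(ℝ, E) x₀).symm) (extChartAt 𝓘(ℝ, E) x₀ y) := by
  rw [← contMDiffAt_iff_contDiffAt]
  have hk : (k : WithTop ℕ∞) ≤ ∞ := by exact_mod_cast le_top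
  constructor
  · intro h
    refine ContMDiffAt.comp _ ?_ ((contMDiffAt_chart_symm (chart_mem_target hy)).of_le hk)
    rwa [chart_symm_chart hy]
  · intro h
    refine (h.comp y ((contMDiffAt_chart hy).of_le hk)).congr_of_eventuallyEq ?_
    filter_upwards [eventually_symm_chart hy] with y' hy'
    exact (congrArg f hy').symm

lemma mdifferentiableAt_iff_chart {f : M → F} (hy : y ∈ (chartAt E x₀).source) :
    MDifferentiableAt 𝓘(ℝ, E) 𝓘(ℝ, F) f y ↔
      DifferentiableAt ℝ (f ∘ (extChartAt 𝓘(ℝ, E) x₀).symm) (extChartAt 𝓘(ℝ, E) x₀ y) := by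
  rw [← mdifferentiableAt_iff_differentiableAt]
  constructor
  · intro h
    refine MDifferentiableAt.comp _ ?_
      ((contMDiffAt_chart_symm (chart_mem_target hy)).mdifferentiableAt (by simp))
    rwa [chart_symm_chart hy]
  · intro h
    refine (h.comp y ((contMDiffAt_chart hy).mdifferentiableAt (by simp))).congr_of_eventuallyEq ?_
    filter_upwards [eventually_symm_chart hy] with y' hy'
    exact (congrArg f hy').symm

lemma mvfderiv_eq_chart {f : M → F} (hy : y ∈ (chartAt E x₀).source)
    (hf : MDifferentiableAt 𝓘(ℝ, E) 𝓘(ℝ, F) f y) (v : TangentSpace 𝓘(ℝ, E) y) :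
    mvfderiv 𝓘(ℝ, E) f y v =
      fderiv ℝ (f ∘ (extChartAt 𝓘(ℝ, E) x₀).symm) (extChartAt 𝓘(ℝ, E) x₀ y) (coordL x₀ y v) := by
  have h1 : f =ᶠ[𝓝 y] (f ∘ (extChartAt 𝓘(ℝ, E) x₀).symm) ∘ (extChartAt 𝓘(ℝ, E) x₀) := by
    filter_upwards [eventually_symm_chart hy] with y' hy'
    exact (congrArg f hy').symm
  have h2 := (mdifferentiableAt_iff_chart hy).1 hf
  have h3 : mfderiv 𝓘(ℝ, E) 𝓘(ℝ, F) f y = mfderiv 𝓘(ℝ, E) 𝓘(ℝ, F)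
      ((f ∘ (extChartAt 𝓘(ℝ, E) x₀).symm) ∘ (extChartAt 𝓘(ℝ, E) x₀)) y :=
    h1.mfderiv_eq
  have h4 := mfderiv_comp y (mdifferentiableAt_iff_differentiableAt.2 h2)
    ((contMDiffAt_chart hy).mdifferentiableAt (by simp))
  rw [mfderiv_eq_fderiv] at h4
  rw [coordL_eq_mfderiv hy]
  change mfderiv 𝓘(ℝ, E) 𝓘(ℝ, F) f y v = _
  rw [h3, h4]
  rfl

lemma contMDiffAt_field_iff {Y : ∀ y : M, TangentSpace 𝓘(ℝ, E) y} {k : ℕ∞}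
    (hy : y ∈ (chartAt E x₀).source) :
    ContMDiffAt 𝓘(ℝ, E) 𝓘(ℝ, E).tangent k (fun y => (⟨y, Y y⟩ : TangentBundle 𝓘(ℝ, E) M)) y ↔
      ContDiffAt ℝ k (rep x₀ Y) (extChartAt 𝓘(ℝ, E) x₀ y) := by
  have hk : (k : WithTop ℕ∞) ≤ ∞ := by exact_mod_cast le_top
  have : ContMDiffVectorBundle (k : WithTop ℕ∞) E (TangentSpace 𝓘(ℝ, E) : M → Type _) 𝓘(ℝ, E) :=
    ContMDiffVectorBundle.of_le hk
  rw [(trivializationAt E (TangentSpace 𝓘(ℝ, E) : M → Type _) x₀).contMDiffAt_section_iff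
    (mem_baseSet_iff.2 hy), contMDiffAt_iff_chart hy]
  have h : rep x₀ Y =ᶠ[𝓝 (extChartAt 𝓘(ℝ, E) x₀ y)] (fun y =>
      (trivializationAt E (TangentSpace 𝓘(ℝ, E) : M → Type _) x₀ ⟨y, Y y⟩).2) ∘
        (extChartAt 𝓘(ℝ, E) x₀).symm := by
    filter_upwards [isOpen_target.mem_nhds (chart_mem_target hy)] with z hz
    exact (coordL_apply (symm_mem_source hz) _).symm
  exact ⟨fun hc => hc.congr_of_eventuallyEq h, fun hc => hc.congr_of_eventuallyEq h.symm⟩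

lemma smoothFieldAt_iff {Y : ∀ y : M, TangentSpace 𝓘(ℝ, E) y}
    (hy : y ∈ (chartAt E x₀).source) :
    SmoothFieldAt Y y ↔ ContDiffAt ℝ ∞ (rep x₀ Y) (extChartAt 𝓘(ℝ, E) x₀ y) :=
  contMDiffAt_field_iff hy

lemma mdifferentiableAt_field_iff {Y : ∀ y : M, TangentSpace 𝓘(ℝ, E) y}
    (hy : y ∈ (chartAt E x₀).source) :
    MDifferentiableAt 𝓘(ℝ, E) 𝓘(ℝ, E).tangent
      (fun y => (⟨y, Y y⟩ : TangentBundle 𝓘(ℝ, E) M)) y ↔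
      DifferentiableAt ℝ (rep x₀ Y) (extChartAt 𝓘(ℝ, E) x₀ y) := by
  rw [(trivializationAt E (TangentSpace 𝓘(ℝ, E) : M → Type _) x₀).mdifferentiableAt_section_iff
    _ _ (mem_baseSet_iff.2 hy), mdifferentiableAt_iff_chart hy]
  refine Filter.EventuallyEq.differentiableAt_iff ?_
  filter_upwards [isOpen_target.mem_nhds (chart_mem_target hy)] with z hz
  exact coordL_apply (symm_mem_source hz) _

lemma rep_chart (hy : y ∈ (chartAt E x₀).source) (Y : ∀ y : M, TangentSpace 𝓘(ℝ, E) y) :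
    rep x₀ Y (extChartAt 𝓘(ℝ, E) x₀ y) = coordL x₀ y (Y y) := by
  rw [rep, chart_symm_chart hy]

lemma rep_frameL {z : E} (hz : z ∈ (extChartAt 𝓘(ℝ, E) x₀).target) (w : E) :
    rep x₀ (fun y => frameL x₀ y w) z = w :=
  coordL_frameL (symm_mem_source hz) w

lemma rep_frameL_eventuallyEq (hy : y ∈ (chartAt E x₀).source) (w : E) :
    rep x₀ (fun y => frameL x₀ y w) =ᶠ[𝓝 (extChartAt 𝓘(ℝ, E) x₀ y)] fun _ => w := by
  filter_upwards [isOpen_target.mem_nhds (chart_mem_target hy)] with z hz using rep_frameL hz w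

lemma smoothFieldAt_frameL (hy : y ∈ (chartAt E x₀).source) (w : E) :
    SmoothFieldAt (fun y => frameL x₀ y w) y :=
  (smoothFieldAt_iff hy).2 (contDiffAt_const.congr_of_eventuallyEq (rep_frameL_eventuallyEq hy w))

lemma SmoothFieldAt.mdifferentiableAt {Y : ∀ y : M, TangentSpace 𝓘(ℝ, E) y}
    (h : SmoothFieldAt Y y) : MDifferentiableAt 𝓘(ℝ, E) 𝓘(ℝ, E).tangent
      (fun y => (⟨y, Y y⟩ : TangentBundle 𝓘(ℝ, E) M)) y :=
  ContMDiffAt.mdifferentiableAt h (by simp)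

lemma rep_extend_eventuallyEq (v : TangentSpace 𝓘(ℝ, E) x₀) :
    rep x₀ (FiberBundle.extend E v) =ᶠ[𝓝 (extChartAt 𝓘(ℝ, E) x₀ x₀)]
      fun _ => coordL x₀ x₀ v := by
  filter_upwards [isOpen_target.mem_nhds (chart_mem_target (mem_chart_source E x₀))] with z hz
  rw [rep, extend_eq v (symm_mem_source hz), coordL_frameL (symm_mem_source hz)]

lemma smoothFieldAt_extend (v : TangentSpace 𝓘(ℝ, E) x₀) :
    SmoothFieldAt (FiberBundle.extend E v) x₀ :=
  (smoothFieldAt_iff (mem_chart_source E x₀)).2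
    (contDiffAt_const.congr_of_eventuallyEq (rep_extend_eventuallyEq v))

/-- The bracket is natural under pullback by the inverse chart, and the pullback of a field is its
component function `rep`. -/
lemma coordL_mlieBracket {V W : ∀ y : M, TangentSpace 𝓘(ℝ, E) y}
    (hy : y ∈ (chartAt E x₀).source)
    (hV : MDifferentiableAt 𝓘(ℝ, E) 𝓘(ℝ, E).tangent
      (fun y => (⟨y, V y⟩ : TangentBundle 𝓘(ℝ, E) M)) y)
    (hW : MDifferentiableAt 𝓘(ℝ, E) 𝓘(ℝ, E).tangent
      (fun y => (⟨y, W y⟩ : TangentBundle 𝓘(ℝ, E) M)) y) :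
    coordL x₀ y (VectorField.mlieBracket 𝓘(ℝ, E) V W y) =
      fderiv ℝ (rep x₀ W) (extChartAt 𝓘(ℝ, E) x₀ y) (coordL x₀ y (V y))
        - fderiv ℝ (rep x₀ V) (extChartAt 𝓘(ℝ, E) x₀ y) (coordL x₀ y (W y)) := by
  have hz := chart_mem_target hy
  have hpull : ∀ (Y : ∀ y : M, TangentSpace 𝓘(ℝ, E) y),
      ∀ z ∈ (extChartAt 𝓘(ℝ, E) x₀).target,
      VectorField.mpullback 𝓘(ℝ, E) 𝓘(ℝ, E) (extChartAt 𝓘(ℝ, E) x₀).symm Y z = rep x₀ Y z := by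
    intro Y z hz
    have hs := symm_mem_source hz
    have h1 := frameL_eq_mfderiv hs
    rw [(extChartAt 𝓘(ℝ, E) x₀).right_inv hz] at h1
    have h2 : mfderiv 𝓘(ℝ, E) 𝓘(ℝ, E) (extChartAt 𝓘(ℝ, E) x₀).symm z =
      ((ContinuousLinearEquiv.equivOfInverse (frameL x₀ ((extChartAt 𝓘(ℝ, E) x₀).symm z))
        (coordL x₀ ((extChartAt 𝓘(ℝ, E) x₀).symm z)) (coordL_frameL hs) (frameL_coordL hs) :
        E ≃L[ℝ] _) : E →L[ℝ] _) := ContinuousLinearMap.ext h1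
    rw [VectorField.mpullback_apply, h2]
    exact DFunLike.congr_fun (ContinuousLinearMap.inverse_equiv _) _
  have hms : minSmoothness ℝ 2 = 2 := minSmoothness_of_isRCLikeNormedField
  have : IsManifold 𝓘(ℝ, E) (minSmoothness ℝ 2) M := by
    rw [hms]
    exact IsManifold.of_le (n := ∞) (by exact WithTop.coe_le_coe.2 (le_top : (2 : ℕ∞) ≤ ⊤))
  have key := VectorField.mpullback_mlieBracket (I := 𝓘(ℝ, E)) (I' := 𝓘(ℝ, E)) (n := ∞)
    (f := (extChartAt 𝓘(ℝ, E) x₀).symm) (x₀ := extChartAt 𝓘(ℝ, E) x₀ y) (V := V) (W := W)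
    (by rwa [chart_symm_chart hy]) (by rwa [chart_symm_chart hy])
    (contMDiffAt_chart_symm hz) (by rw [hms]; exact WithTop.coe_le_coe.2 (le_top : (2 : ℕ∞) ≤ ⊤))
  rw [hpull _ _ hz, rep_chart hy] at key
  have e1 : ∀ Y : (∀ y : M, TangentSpace 𝓘(ℝ, E) y),
      VectorField.mpullback 𝓘(ℝ, E) 𝓘(ℝ, E) (extChartAt 𝓘(ℝ, E) x₀).symm Y
        =ᶠ[𝓝 (extChartAt 𝓘(ℝ, E) x₀ y)] rep x₀ Y := by
    intro Y
    filter_upwards [isOpen_target.mem_nhds hz] with z hz using hpull Y z hz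
  have h5 := (e1 V).mlieBracket_vectorField_eq (e1 W)
  have h6 : VectorField.mlieBracket 𝓘(ℝ, E) (M := E) (rep x₀ V) (rep x₀ W) =
      VectorField.lieBracket ℝ (rep x₀ V) (rep x₀ W) := by
    have h7 := VectorField.mlieBracketWithin_eq_lieBracketWithin (𝕜 := ℝ) (E := E)
      (V := rep x₀ V) (W := rep x₀ W) (s := univ)
    exact VectorField.mlieBracketWithin_univ.symm.trans
      (h7.trans VectorField.lieBracketWithin_univ)
  refine key.trans (h5.trans ((congrFun h6 _).trans ?_))
  rw [VectorField.lieBracket, rep_chart hy, rep_chart hy]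

end Coordinates

/-! ### Christoffel symbols -/

section Christoffel

variable (D : CovariantDerivative 𝓘(ℝ, E) E (TangentSpace 𝓘(ℝ, E) : M → Type _)) (x₀ : M)

/-- `∇_u e_w` in the coordinate frame `e` around `x₀`, as a function of the point in the chart. -/
def christoffelFun (z u w : E) : E :=
  rep x₀ (fun y => D (fun y => frameL x₀ y w) y (frameL x₀ y u)) z

variable {D x₀}

lemma christoffelFun_add_left (z u u' w : E) :
    christoffelFun D x₀ z (u + u') w = christoffelFun D x₀ z u w + christoffelFun D x₀ z u' w := by
  simp only [christoffelFun, rep, map_add]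

lemma christoffelFun_smul_left (c : ℝ) (z u w : E) :
    christoffelFun D x₀ z (c • u) w = c • christoffelFun D x₀ z u w := by
  simp only [christoffelFun, rep, map_smul]

lemma christoffelFun_add_right (z u w w' : E) :
    christoffelFun D x₀ z u (w + w') = christoffelFun D x₀ z u w + christoffelFun D x₀ z u w' := by
  simp only [christoffelFun, rep]
  set y := (extChartAt 𝓘(ℝ, E) x₀).symm z
  -- When `z` is off the target, `y` may lie outside the chart domain; there `frameL` is zero, so
  -- the direction of differentiation vanishes and both sides are zero.
  by_cases hy : y ∈ (chartAt E x₀).source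
  · have h := D.isCovariantDerivativeOnUniv.add (smoothFieldAt_frameL hy w).mdifferentiableAt
      (smoothFieldAt_frameL hy w').mdifferentiableAt
    have e : (fun y : M => frameL x₀ y (w + w')) =
        (fun y => frameL x₀ y w) + fun y => frameL x₀ y w' := by
      funext y; simp
    rw [e, h]
    simp
  · simp [frameL_of_notMem hy]

lemma christoffelFun_smul_right (c : ℝ) (z u w : E) :
    christoffelFun D x₀ z u (c • w) = c • christoffelFun D x₀ z u w := by
  simp only [christoffelFun, rep]
  set y := (extChartAt 𝓘(ℝ, E) x₀).symm z
  by_cases hy : y ∈ (chartAt E x₀).source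
  · have h := D.isCovariantDerivativeOnUniv.smul_const c
      (smoothFieldAt_frameL hy w).mdifferentiableAt
    have e : (fun y : M => frameL x₀ y (c • w)) = c • fun y => frameL x₀ y w := by
      funext y; simp
    rw [e, h]
    simp
  · simp [frameL_of_notMem hy]

variable (D x₀)

/-- The Christoffel symbols: `christoffel D x₀ z u w` is `∇_u e_w`. -/
def christoffel (z : E) : E →L[ℝ] E →L[ℝ] E :=
  LinearMap.toContinuousLinearMap
    { toFun := fun u => LinearMap.toContinuousLinearMap
        { toFun := fun w => christoffelFun D x₀ z u w
          map_add' := christoffelFun_add_right z u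
          map_smul' := fun c w => christoffelFun_smul_right c z u w }
      map_add' := fun u u' => by ext w; exact christoffelFun_add_left z u u' w
      map_smul' := fun c u => by ext w; exact christoffelFun_smul_left c z u w }

variable {D x₀}

lemma christoffel_apply (z u w : E) : christoffel D x₀ z u w = christoffelFun D x₀ z u w := rfl

variable {y : M}

lemma christoffel_chart (hy : y ∈ (chartAt E x₀).source) (u w : E) :
    christoffel D x₀ (extChartAt 𝓘(ℝ, E) x₀ y) u w =
      coordL x₀ y (D (fun y => frameL x₀ y w) y (frameL x₀ y u)) := by
  rw [christoffel_apply, christoffelFun, rep_chart hy]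

lemma rep_add (Y Y' : ∀ y : M, TangentSpace 𝓘(ℝ, E) y) :
    rep x₀ (Y + Y') = rep x₀ Y + rep x₀ Y' := by
  funext z; simp only [rep, Pi.add_apply, map_add]

lemma rep_smul (f : M → ℝ) (Y : ∀ y : M, TangentSpace 𝓘(ℝ, E) y) :
    rep x₀ (f • Y) = (f ∘ (extChartAt 𝓘(ℝ, E) x₀).symm) • rep x₀ Y := by
  funext z; simp only [rep, Pi.smul_apply', Function.comp_apply, map_smul]

/-- The difference between `∇` and the flat derivative of the components is tensorial in `Y`. Hence
`Y` may be replaced by the constant-coefficient frame field with the same value at `y`, whose flat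
derivative is zero. -/
lemma coordL_covariantDerivative (hy : y ∈ (chartAt E x₀).source)
    {Y : ∀ y : M, TangentSpace 𝓘(ℝ, E) y}
    (hY : MDifferentiableAt 𝓘(ℝ, E) 𝓘(ℝ, E).tangent
      (fun y => (⟨y, Y y⟩ : TangentBundle 𝓘(ℝ, E) M)) y) (v : TangentSpace 𝓘(ℝ, E) y) :
    coordL x₀ y (D Y y v) =
      fderiv ℝ (rep x₀ Y) (extChartAt 𝓘(ℝ, E) x₀ y) (coordL x₀ y v)
        + christoffel D x₀ (extChartAt 𝓘(ℝ, E) x₀ y) (coordL x₀ y v) (coordL x₀ y (Y y)) := by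
  have hT : TensorialAt 𝓘(ℝ, E) E (fun Y : (∀ y : M, TangentSpace 𝓘(ℝ, E) y) =>
      coordL x₀ y (D Y y v) -
        fderiv ℝ (rep x₀ Y) (extChartAt 𝓘(ℝ, E) x₀ y) (coordL x₀ y v)) y := by
    constructor
    · intro f σ hf hσ
      have h1 := D.isCovariantDerivativeOnUniv.leibniz hσ hf
      have h2 := (mdifferentiableAt_field_iff hy).1 hσ
      have h3 := (mdifferentiableAt_iff_chart hy).1 hf
      rw [h1, rep_smul, fderiv_smul h3 h2]
      simp only [add_apply, smul_apply,
        ContinuousLinearMap.smulRight_apply, map_add, map_smul, mvfderiv_eq_chart hy hf,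
        rep_chart hy, Function.comp_apply, chart_symm_chart hy, smul_sub]
      abel
    · intro σ σ' hσ hσ'
      have h1 := D.isCovariantDerivativeOnUniv.add hσ hσ'
      have h2 := (mdifferentiableAt_field_iff hy).1 hσ
      have h3 := (mdifferentiableAt_field_iff hy).1 hσ'
      rw [h1, rep_add, fderiv_add h2 h3]
      simp only [add_apply, map_add]
      abel
  have h := hT.pointwise hY (smoothFieldAt_frameL hy (coordL x₀ y (Y y))).mdifferentiableAt
    (frameL_coordL hy (Y y)).symm
  rw [(rep_frameL_eventuallyEq hy (coordL x₀ y (Y y))).fderiv_eq] at h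
  rw [christoffel_chart hy, frameL_coordL hy]
  simp only [fderiv_fun_const, Pi.zero_apply, zero_apply, sub_zero] at h
  rw [← h]
  abel

/-- Smoothness of the connection is applied to a globally smooth section, whereas frame fields are
smooth only over the chart. A bump function supported in the chart domain makes them global, and
locality of `D` removes it again near the point. -/
lemma contDiffOn_christoffel [T2Space M] (hD : D.ContMDiffCovariantDerivative ∞) :
    ContDiffOn ℝ ∞ (christoffel D x₀) (extChartAt 𝓘(ℝ, E) x₀).target := by
  rw [contDiffOn_clm_apply]
  intro u
  rw [contDiffOn_clm_apply]
  intro w z hz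
  refine ContDiffAt.contDiffWithinAt ?_
  set y := (extChartAt 𝓘(ℝ, E) x₀).symm z with hy_def
  have hy : y ∈ (chartAt E x₀).source := symm_mem_source hz
  have hzy : extChartAt 𝓘(ℝ, E) x₀ y = z := (extChartAt 𝓘(ℝ, E) x₀).right_inv hz
  obtain ⟨f, -, hfs⟩ := (SmoothBumpFunction.nhds_basis_tsupport (I := 𝓘(ℝ, E)) y).mem_iff.1
    ((chartAt E x₀).open_source.mem_nhds hy)
  set σ : ∀ y : M, TangentSpace 𝓘(ℝ, E) y := fun y => f y • frameL x₀ y w with hσ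
  have hσs : ContMDiff 𝓘(ℝ, E) 𝓘(ℝ, E).tangent (∞ + 1)
      (fun y => (⟨y, σ y⟩ : TangentBundle 𝓘(ℝ, E) M)) := by
    intro y'
    change SmoothFieldAt σ y'
    by_cases hy' : y' ∈ (chartAt E x₀).source
    · exact ContMDiffAt.smul_section f.contMDiffAt (smoothFieldAt_frameL hy' w)
    · have h0 : σ =ᶠ[𝓝 y'] (0 : ∀ y : M, TangentSpace 𝓘(ℝ, E) y) := by
        have : y' ∈ (tsupport f)ᶜ := fun h => hy' (hfs h)
        filter_upwards [(isClosed_tsupport f).isOpen_compl.mem_nhds this] with y'' hy''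
        rw [hσ]
        simp only [image_eq_zero_of_notMem_tsupport hy'', zero_smul]
        rfl
      have hm := mem_chart_source E y'
      rw [smoothFieldAt_iff hm]
      refine (contDiffAt_const (c := (0 : E))).congr_of_eventuallyEq ?_
      have h1 := (contMDiffAt_chart_symm (chart_mem_target hm)).continuousAt.eventually
        (by rwa [chart_symm_chart hm])
      filter_upwards [h1] with z hz
      rw [rep, hz]
      exact map_zero _
  have h1 := (hD.contMDiff.contMDiff hσs.contMDiffOn).contMDiffAt (x := y) univ_mem
  have h2 : SmoothFieldAt (fun y => D σ y (frameL x₀ y u)) y :=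
    ContMDiffAt.clm_bundle_apply h1 (smoothFieldAt_frameL hy u)
  rw [smoothFieldAt_iff hy, hzy] at h2
  refine h2.congr_of_eventuallyEq ?_
  have hev : ∀ᶠ y' in 𝓝 y, ∀ᶠ y'' in 𝓝 y', f y'' = 1 :=
    eventually_eventually_nhds.2 f.eventuallyEq_one
  have hev2 := (contMDiffAt_chart_symm hz).continuousAt.eventually hev
  filter_upwards [hev2, isOpen_target.mem_nhds hz] with z' hz' hz't
  have hy' := symm_mem_source hz't
  rw [christoffel_apply, christoffelFun, rep, rep]
  congr 2
  refine D.isCovariantDerivativeOnUniv.congr_of_eventuallyEq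
    (smoothFieldAt_frameL hy' w).mdifferentiableAt (hσs.contMDiffAt.mdifferentiableAt (by simp))
    univ_mem ?_
  filter_upwards [hz'] with y'' hy''
  rw [hσ]
  simp only [hy'', one_smul]

end Christoffel

/-! ### Torsion, curvature and covariant differentiation along curves in a chart -/

/-- The curvature of a connection on a vector space, in terms of its Christoffel symbols. -/
def christoffelCurv (Γ : E → E →L[ℝ] E →L[ℝ] E) (z u v w : E) : E :=
  fderiv ℝ Γ z u v w - fderiv ℝ Γ z v u w + Γ z u (Γ z v w) - Γ z v (Γ z u w)

lemma hasDerivAt_clm_comp_apply {V F G : Type*} [NormedAddCommGroup V] [NormedSpace ℝ V]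
    [NormedAddCommGroup F] [NormedSpace ℝ F] [NormedAddCommGroup G] [NormedSpace ℝ G]
    {A : V → F →L[ℝ] G} {A' : V →L[ℝ] F →L[ℝ] G} {c : ℝ → V} {c' : V} {X : ℝ → F} {X' : F} {t : ℝ}
    (hA : HasFDerivAt A A' (c t)) (hc : HasDerivAt c c' t) (hX : HasDerivAt X X' t) :
    HasDerivAt (fun s => A (c s) (X s)) (A' c' (X t) + A (c t) X') t :=
  (hA.comp_hasDerivAt t hc).clm_apply hX

section ChartFormulas

variable {D : CovariantDerivative 𝓘(ℝ, E) E (TangentSpace 𝓘(ℝ, E) : M → Type _)} {x₀ y : M}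

lemma coordL_torsion (hy : y ∈ (chartAt E x₀).source) (u v : TangentSpace 𝓘(ℝ, E) y) :
    coordL x₀ y (D.torsion y u v) =
      christoffel D x₀ (extChartAt 𝓘(ℝ, E) x₀ y) (coordL x₀ y u) (coordL x₀ y v)
        - christoffel D x₀ (extChartAt 𝓘(ℝ, E) x₀ y) (coordL x₀ y v) (coordL x₀ y u) := by
  have hU := (smoothFieldAt_frameL hy (coordL x₀ y u)).mdifferentiableAt
  have hV := (smoothFieldAt_frameL hy (coordL x₀ y v)).mdifferentiableAt
  have h := D.torsion_apply hU hV
  simp only [frameL_coordL hy] at h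
  rw [h, map_sub, map_sub, coordL_covariantDerivative hy hU, coordL_covariantDerivative hy hV,
    coordL_mlieBracket hy hU hV, (rep_frameL_eventuallyEq hy _).fderiv_eq,
    (rep_frameL_eventuallyEq hy _).fderiv_eq]
  simp [frameL_coordL hy]

/-- In coordinates the second derivatives of `W` cancel by symmetry and the first derivatives of `U`
and `V` cancel against the bracket; what remains depends only on the three values at `y`. -/
lemma coordL_curvature_fields (hΓ : ContDiffOn ℝ ∞ (christoffel D x₀)
      (extChartAt 𝓘(ℝ, E) x₀).target) (hy : y ∈ (chartAt E x₀).source)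
    {U V W : ∀ y : M, TangentSpace 𝓘(ℝ, E) y}
    (hU : SmoothFieldAt U y) (hV : SmoothFieldAt V y) (hW : SmoothFieldAt W y) :
    coordL x₀ y (D (fun y => D W y (V y)) y (U y) - D (fun y => D W y (U y)) y (V y)
        - D W y (VectorField.mlieBracket 𝓘(ℝ, E) U V y)) =
      christoffelCurv (christoffel D x₀) (extChartAt 𝓘(ℝ, E) x₀ y) (coordL x₀ y (U y))
        (coordL x₀ y (V y)) (coordL x₀ y (W y)) := by
  set z₀ := extChartAt 𝓘(ℝ, E) x₀ y with hz₀
  have hz₀t : z₀ ∈ (extChartAt 𝓘(ℝ, E) x₀).target := chart_mem_target hy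
  have hΓ' : ContDiffAt ℝ ∞ (christoffel D x₀) z₀ :=
    hΓ.contDiffAt (isOpen_target.mem_nhds hz₀t)
  have hΓd : HasFDerivAt (christoffel D x₀) (fderiv ℝ (christoffel D x₀) z₀) z₀ :=
    (hΓ'.differentiableAt (by simp)).hasFDerivAt
  have hWs : ContDiffAt ℝ ∞ (rep x₀ W) z₀ := (smoothFieldAt_iff hy).1 hW
  have hWd : HasFDerivAt (rep x₀ W) (fderiv ℝ (rep x₀ W) z₀) z₀ :=
    (hWs.differentiableAt (by simp)).hasFDerivAt
  have hWdd : HasFDerivAt (fderiv ℝ (rep x₀ W)) (fderiv ℝ (fderiv ℝ (rep x₀ W)) z₀) z₀ :=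
    ((hWs.fderiv_right (m := 1) (by exact WithTop.coe_le_coe.2 le_top)).differentiableAt
      (by simp)).hasFDerivAt
  have hsymm : ∀ a b, fderiv ℝ (fderiv ℝ (rep x₀ W)) z₀ a b =
      fderiv ℝ (fderiv ℝ (rep x₀ W)) z₀ b a := fun a b =>
    (hWs.isSymmSndFDerivAt (by simp only [minSmoothness_of_isRCLikeNormedField]; exact WithTop.coe_le_coe.2 le_top)).eq a b
  have key : ∀ A : (∀ y : M, TangentSpace 𝓘(ℝ, E) y), SmoothFieldAt A y →
      ∀ v : TangentSpace 𝓘(ℝ, E) y, coordL x₀ y (D (fun y => D W y (A y)) y v) =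
        fderiv ℝ (fderiv ℝ (rep x₀ W)) z₀ (coordL x₀ y v) (coordL x₀ y (A y))
        + fderiv ℝ (rep x₀ W) z₀ (fderiv ℝ (rep x₀ A) z₀ (coordL x₀ y v))
        + fderiv ℝ (christoffel D x₀) z₀ (coordL x₀ y v) (coordL x₀ y (A y)) (coordL x₀ y (W y))
        + christoffel D x₀ z₀ (fderiv ℝ (rep x₀ A) z₀ (coordL x₀ y v)) (coordL x₀ y (W y))
        + christoffel D x₀ z₀ (coordL x₀ y (A y)) (fderiv ℝ (rep x₀ W) z₀ (coordL x₀ y v))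
        + christoffel D x₀ z₀ (coordL x₀ y v) (fderiv ℝ (rep x₀ W) z₀ (coordL x₀ y (A y))
          + christoffel D x₀ z₀ (coordL x₀ y (A y)) (coordL x₀ y (W y))) := by
    intro A hA v
    have hAs : ContDiffAt ℝ ∞ (rep x₀ A) z₀ := (smoothFieldAt_iff hy).1 hA
    have hAd : HasFDerivAt (rep x₀ A) (fderiv ℝ (rep x₀ A) z₀) z₀ :=
      (hAs.differentiableAt (by simp)).hasFDerivAt
    have hrep : rep x₀ (fun y => D W y (A y)) =ᶠ[𝓝 z₀] fun z =>
        fderiv ℝ (rep x₀ W) z (rep x₀ A z) + christoffel D x₀ z (rep x₀ A z) (rep x₀ W z) := by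
      have h1 : ∀ᶠ z in 𝓝 z₀, ContDiffAt ℝ 1 (rep x₀ W) z :=
        (hWs.of_le (by exact WithTop.coe_le_coe.2 le_top)).eventually (by simp)
      filter_upwards [h1, isOpen_target.mem_nhds hz₀t] with z hz hzt
      have hs := symm_mem_source hzt
      have hzz : extChartAt 𝓘(ℝ, E) x₀ ((extChartAt 𝓘(ℝ, E) x₀).symm z) = z :=
        (extChartAt 𝓘(ℝ, E) x₀).right_inv hzt
      have h2 := coordL_covariantDerivative (D := D) (Y := W) hs
        ((mdifferentiableAt_field_iff hs).2 (by rw [hzz]; exact hz.differentiableAt (by simp)))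
        (A ((extChartAt 𝓘(ℝ, E) x₀).symm z))
      rw [hzz] at h2
      exact h2
    have hd := (hWdd.clm_apply hAd).add ((hΓd.clm_apply hAd).clm_apply hWd)
    have hd' := hd.congr_of_eventuallyEq hrep
    have h3 := coordL_covariantDerivative (D := D) (Y := fun y => D W y (A y)) hy
      ((mdifferentiableAt_field_iff hy).2 hd'.differentiableAt) v
    rw [h3, ← hz₀, hd'.fderiv, coordL_covariantDerivative hy hW.mdifferentiableAt]
    simp only [add_apply, ContinuousLinearMap.comp_apply, ContinuousLinearMap.flip_apply, hz₀,
      rep_chart hy]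
    abel
  have hUV := coordL_mlieBracket hy hU.mdifferentiableAt hV.mdifferentiableAt
  rw [← hz₀] at hUV
  rw [map_sub, map_sub, key V hV, key U hU, coordL_covariantDerivative hy hW.mdifferentiableAt, hUV,
    christoffelCurv, hsymm (coordL x₀ y (V y)), ← hz₀]
  simp only [map_sub, map_add, sub_apply]
  abel

lemma coordL_curvature (hΓ : ContDiffOn ℝ ∞ (christoffel D x₀)
      (extChartAt 𝓘(ℝ, E) x₀).target) (hy : y ∈ (chartAt E x₀).source)
    (u v w : TangentSpace 𝓘(ℝ, E) y) :
    coordL x₀ y (curvature D y u v w) =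
      christoffelCurv (christoffel D x₀) (extChartAt 𝓘(ℝ, E) x₀ y) (coordL x₀ y u)
        (coordL x₀ y v) (coordL x₀ y w) := by
  have h := coordL_curvature_fields hΓ hy (smoothFieldAt_extend u) (smoothFieldAt_extend v)
    (smoothFieldAt_extend w)
  simp only [FiberBundle.extend_apply_self] at h
  exact h

/-- The change of coordinates on the tangent bundle from the chart around `x₀` to that around `x₁`. -/
def coordChange (x₀ x₁ : M) (z : E) : E →L[ℝ] E :=
  (coordL x₁ ((extChartAt 𝓘(ℝ, E) x₀).symm z)).comp
    (frameL x₀ ((extChartAt 𝓘(ℝ, E) x₀).symm z))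

lemma coordChange_differentiableAt {x₁ : M} (hy : y ∈ (chartAt E x₀).source)
    (hy₁ : y ∈ (chartAt E x₁).source) :
    DifferentiableAt ℝ (coordChange (E := E) x₀ x₁) (extChartAt 𝓘(ℝ, E) x₀ y) := by
  set s : Set E := (extChartAt 𝓘(ℝ, E) x₀).target ∩
    (extChartAt 𝓘(ℝ, E) x₀).symm ⁻¹' (chartAt E x₁).source with hs
  have hopen : IsOpen s :=
    (continuousOn_extChartAt_symm x₀).isOpen_inter_preimage isOpen_target (chartAt E x₁).open_source
  have hmem : extChartAt 𝓘(ℝ, E) x₀ y ∈ s :=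
    ⟨chart_mem_target hy, by rwa [mem_preimage, chart_symm_chart hy]⟩
  have h : ContDiffOn ℝ 1 (coordChange (E := E) x₀ x₁) s := by
    rw [contDiffOn_clm_apply]
    intro w z hz
    have h0 := symm_mem_source hz.1
    have h1 := (smoothFieldAt_iff (x₀ := x₁) hz.2).1 (smoothFieldAt_frameL h0 w)
    have h2 : ContDiffAt ℝ ∞ (fun z => extChartAt 𝓘(ℝ, E) x₁ ((extChartAt 𝓘(ℝ, E) x₀).symm z)) z :=
      contMDiffAt_iff_contDiffAt.1
        ((contMDiffAt_chart hz.2).comp z (contMDiffAt_chart_symm hz.1))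
    have h3 := (h1.comp z h2).of_le (m := 1) (by exact WithTop.coe_le_coe.2 le_top)
    refine (h3.congr_of_eventuallyEq ?_).contDiffWithinAt
    filter_upwards [hopen.mem_nhds hz] with z' hz'
    simp only [Function.comp_apply, rep_chart hz'.2, coordChange, ContinuousLinearMap.comp_apply]
  exact (h.contDiffAt (hopen.mem_nhds hmem)).differentiableAt (by simp)

variable {γ : ℝ → M} {t : ℝ} {c : E}

lemma mdifferentiableAt_of_chart (hy : γ t ∈ (chartAt E x₀).source) (hcont : ContinuousAt γ t)
    (hγ : HasDerivAt (fun s => extChartAt 𝓘(ℝ, E) x₀ (γ s)) c t) :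
    MDifferentiableAt 𝓘(ℝ, ℝ) 𝓘(ℝ, E) γ t := by
  have h1 : MDifferentiableAt 𝓘(ℝ, ℝ) 𝓘(ℝ, E)
      ((extChartAt 𝓘(ℝ, E) x₀).symm ∘ fun s => extChartAt 𝓘(ℝ, E) x₀ (γ s)) t :=
    ((contMDiffAt_chart_symm (chart_mem_target hy)).mdifferentiableAt (by simp)).comp t
      hγ.differentiableAt.mdifferentiableAt
  refine h1.congr_of_eventuallyEq ?_
  filter_upwards [hcont.eventually (eventually_symm_chart hy)] with s hs using hs.symm

lemma hasDerivAt_chart_comp (hy : γ t ∈ (chartAt E x₀).source)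
    (hγ : MDifferentiableAt 𝓘(ℝ, ℝ) 𝓘(ℝ, E) γ t) :
    HasDerivAt (fun s => extChartAt 𝓘(ℝ, E) x₀ (γ s)) (coordL x₀ (γ t) (velocity γ t)) t := by
  have h1 := ((contMDiffAt_chart hy).mdifferentiableAt (by simp)).comp t hγ
  have h2 := mfderiv_comp t ((contMDiffAt_chart hy).mdifferentiableAt (by simp)) hγ
  have h3 := (mdifferentiableAt_iff_differentiableAt.1 h1).hasFDerivAt.hasDerivAt
  rw [mfderiv_eq_fderiv] at h2
  have h4 : fderiv ℝ (extChartAt 𝓘(ℝ, E) x₀ ∘ γ) t 1 = coordL x₀ (γ t) (velocity γ t) := by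
    rw [coordL_eq_mfderiv hy]
    exact DFunLike.congr_fun h2 (1 : ℝ)
  rw [h4] at h3
  exact h3

lemma coordL_velocity (hy : γ t ∈ (chartAt E x₀).source) (hcont : ContinuousAt γ t)
    (hγ : HasDerivAt (fun s => extChartAt 𝓘(ℝ, E) x₀ (γ s)) c t) :
    coordL x₀ (γ t) (velocity γ t) = c :=
  (hasDerivAt_chart_comp hy (mdifferentiableAt_of_chart hy hcont hγ)).unique hγ

lemma frameCoord_eventuallyEq (x₁ : M) {X : ∀ s, TangentSpace 𝓘(ℝ, E) (γ s)}
    (hy : γ t ∈ (chartAt E x₁).source) (hcont : ContinuousAt γ t) :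
    (fun s => (trivializationAt E (TangentSpace 𝓘(ℝ, E) : M → Type _) x₁ ⟨γ s, X s⟩).2)
      =ᶠ[𝓝 t] fun s => coordL x₁ (γ s) (X s) := by
  filter_upwards [hcont.eventually ((chartAt E x₁).open_source.mem_nhds hy)] with s hs
  exact coordL_apply hs _

/-- `covDerivAlong` is defined in the preferred chart at `γ t`, while a whole piece of the curve has
to be handled in one chart `x₀`. The derivative of the transition matrix `A`, which enters through
the components of `X`, cancels against the derivative of the components of `extend` in the chart
`x₀`. -/
lemma coordL_covDerivAlong (hy : γ t ∈ (chartAt E x₀).source) (hcont : ContinuousAt γ t)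
    (hγ : HasDerivAt (fun s => extChartAt 𝓘(ℝ, E) x₀ (γ s)) c t)
    {X : ∀ s, TangentSpace 𝓘(ℝ, E) (γ s)} {X' : E}
    (hX : HasDerivAt (fun s => coordL x₀ (γ s) (X s)) X' t) :
    coordL x₀ (γ t) (covDerivAlong D γ X t) =
      X' + christoffel D x₀ (extChartAt 𝓘(ℝ, E) x₀ (γ t)) c (coordL x₀ (γ t) (X t)) := by
  have hm := mem_chart_source E (γ t)
  set A : E → E →L[ℝ] E := coordChange x₀ (γ t) with hA
  set z₀ := extChartAt 𝓘(ℝ, E) x₀ (γ t) with hz₀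
  have hAd : HasFDerivAt A (fderiv ℝ A z₀) z₀ :=
    (coordChange_differentiableAt hy hm).hasFDerivAt
  have hAγ : ∀ s, γ s ∈ (chartAt E x₀).source → ∀ v : TangentSpace 𝓘(ℝ, E) (γ s),
      A (extChartAt 𝓘(ℝ, E) x₀ (γ s)) (coordL x₀ (γ s) v) = coordL (γ t) (γ s) v := by
    intro s hs v
    simp only [hA, coordChange]
    rw [chart_symm_chart hs, ContinuousLinearMap.comp_apply, frameL_coordL hs]
  have hframe : frameCoord γ X t =ᶠ[𝓝 t] fun s =>
      A (extChartAt 𝓘(ℝ, E) x₀ (γ s)) (coordL x₀ (γ s) (X s)) := by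
    filter_upwards [frameCoord_eventuallyEq (γ t) (X := X) hm hcont,
      hcont.eventually ((chartAt E x₀).open_source.mem_nhds hy)] with s hs hs'
    rw [hAγ s hs']
    exact hs
  have hder := (hasDerivAt_clm_comp_apply hAd hγ hX).congr_of_eventuallyEq hframe
  have hYs := smoothFieldAt_extend (X t)
  have hYd : HasFDerivAt (rep x₀ (FiberBundle.extend E (X t)))
      (fderiv ℝ (rep x₀ (FiberBundle.extend E (X t))) z₀) z₀ :=
    (((smoothFieldAt_iff hy).1 hYs).differentiableAt (by simp)).hasFDerivAt
  -- The extension has constant components in the chart at `γ t`; differentiating this constancy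
  -- gives the relation between the derivative of `A` and that of `rep`.
  have hconst : (fun z => A z (rep x₀ (FiberBundle.extend E (X t)) z)) =ᶠ[𝓝 z₀]
      fun _ => coordL (γ t) (γ t) (X t) := by
    have h1 := (contMDiffAt_chart_symm (chart_mem_target hy)).continuousAt.eventually
      (by rw [chart_symm_chart hy]; exact (chartAt E (γ t)).open_source.mem_nhds hm)
    filter_upwards [h1, isOpen_target.mem_nhds (chart_mem_target hy)] with z hz1 hz2
    simp only [hA, coordChange, rep]
    rw [ContinuousLinearMap.comp_apply, frameL_coordL (symm_mem_source hz2), extend_eq _ hz1,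
      coordL_frameL hz1]
  have h5 : HasFDerivAt (fun z => A z (rep x₀ (FiberBundle.extend E (X t)) z)) (0 : E →L[ℝ] E) z₀ :=
    (hasFDerivAt_const _ _).congr_of_eventuallyEq hconst
  have h6 := DFunLike.congr_fun ((hAd.clm_apply hYd).unique h5) c
  simp only [add_apply, ContinuousLinearMap.comp_apply, ContinuousLinearMap.flip_apply,
    zero_apply, hz₀, rep_chart hy, FiberBundle.extend_apply_self] at h6
  rw [← hz₀] at h6
  have hBA : ∀ w : E, coordL x₀ (γ t) (frameL (E := E) (γ t) (γ t) (A z₀ w)) = w := by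
    intro w
    simp only [hA, coordChange, hz₀]
    rw [chart_symm_chart hy, ContinuousLinearMap.comp_apply, frameL_coordL hm, coordL_frameL hy]
  have hsymm : (trivializationAt E (TangentSpace 𝓘(ℝ, E) : M → Type _) (γ t)).symm (γ t)
      (deriv (frameCoord γ X t) t) = frameL (γ t) (γ t) (deriv (frameCoord γ X t) t) :=
    ((trivializationAt E (TangentSpace 𝓘(ℝ, E) : M → Type _) (γ t)).symmL_apply
      (mem_baseSet_iff.2 hm) _).symm
  rw [covDerivAlong, map_add, hsymm, hder.deriv,
    coordL_covariantDerivative hy hYs.mdifferentiableAt, coordL_velocity hy hcont hγ,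
    FiberBundle.extend_apply_self, map_add, map_add, hBA, ← hz₀]
  have h7 := congrArg (fun w => coordL x₀ (γ t) (frameL (γ t) (γ t) w)) h6
  simp only [map_add, map_zero, hBA] at h7
  have h8 : coordL x₀ (γ t) (frameL (γ t) (γ t) (fderiv ℝ A z₀ c (coordL x₀ (γ t) (X t)))) +
      fderiv ℝ (rep x₀ (FiberBundle.extend E (X t))) z₀ c = 0 := by
    rw [add_comm]; exact h7
  rw [← sub_eq_zero, ← h8]
  abel

end ChartFormulas

/-! ### The pseudohermitian structure in a chart -/

namespace PseudohermitianStructure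

variable (P : PseudohermitianStructure E M) (x₀ : M)

/-- The contact form in the chart around `x₀`. -/
def thetaC (z : E) : E →L[ℝ] ℝ :=
  (P.θ ((extChartAt 𝓘(ℝ, E) x₀).symm z)).comp (frameL x₀ ((extChartAt 𝓘(ℝ, E) x₀).symm z))

/-- The complex structure of the Levi distribution in the chart around `x₀`. -/
def JC (z : E) : E →L[ℝ] E :=
  (coordL x₀ ((extChartAt 𝓘(ℝ, E) x₀).symm z)).comp
    ((P.J ((extChartAt 𝓘(ℝ, E) x₀).symm z)).comp (frameL x₀ ((extChartAt 𝓘(ℝ, E) x₀).symm z)))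

/-- The form `dθ` in the chart around `x₀`. -/
def omegaC (z : E) : E →L[ℝ] E →L[ℝ] ℝ :=
  (1 / 2 : ℝ) • (fderiv ℝ (P.thetaC x₀) z - (fderiv ℝ (P.thetaC x₀) z).flip)

/-- The Webster metric in the chart around `x₀`. -/
def gC (z : E) : E →L[ℝ] E →L[ℝ] ℝ :=
  ((P.omegaC x₀ z).flip.comp (P.JC x₀ z)).flip + (P.thetaC x₀ z).smulRight (P.thetaC x₀ z)

/-- The characteristic direction in the chart around `x₀`. -/
def TC : E → E := rep x₀ P.T

variable {P x₀} {y : M}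

lemma omegaC_apply (z u v : E) : P.omegaC x₀ z u v =
    (1 / 2) * (fderiv ℝ (P.thetaC x₀) z u v - fderiv ℝ (P.thetaC x₀) z v u) := rfl

lemma gC_apply (z u v : E) : P.gC x₀ z u v =
    P.omegaC x₀ z u (P.JC x₀ z v) + P.thetaC x₀ z u * P.thetaC x₀ z v := rfl

lemma thetaC_chart (hy : y ∈ (chartAt E x₀).source) (v : TangentSpace 𝓘(ℝ, E) y) :
    P.thetaC x₀ (extChartAt 𝓘(ℝ, E) x₀ y) (coordL x₀ y v) = P.θ y v := by
  rw [thetaC, chart_symm_chart hy, ContinuousLinearMap.comp_apply, frameL_coordL hy]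

lemma JC_chart (hy : y ∈ (chartAt E x₀).source) (v : TangentSpace 𝓘(ℝ, E) y) :
    P.JC x₀ (extChartAt 𝓘(ℝ, E) x₀ y) (coordL x₀ y v) = coordL x₀ y (P.J y v) := by
  rw [JC, chart_symm_chart hy, ContinuousLinearMap.comp_apply, ContinuousLinearMap.comp_apply,
    frameL_coordL hy]

lemma TC_chart (hy : y ∈ (chartAt E x₀).source) :
    P.TC x₀ (extChartAt 𝓘(ℝ, E) x₀ y) = coordL x₀ y (P.T y) := rep_chart hy _

lemma contDiffOn_thetaC : ContDiffOn ℝ ∞ (P.thetaC x₀) (extChartAt 𝓘(ℝ, E) x₀).target := by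
  rw [contDiffOn_clm_apply]
  intro w z hz
  have hy := symm_mem_source hz
  have h := ContMDiffAt.clm_bundle_apply (P.smooth_θ ((extChartAt 𝓘(ℝ, E) x₀).symm z))
    (smoothFieldAt_frameL hy w)
  rw [contMDiffAt_section] at h
  have h2 : ContMDiffAt 𝓘(ℝ, E) 𝓘(ℝ, ℝ) ∞ (fun y => P.θ y (frameL x₀ y w))
    ((extChartAt 𝓘(ℝ, E) x₀).symm z) := h
  rw [contMDiffAt_iff_chart hy, (extChartAt 𝓘(ℝ, E) x₀).right_inv hz] at h2
  exact h2.contDiffWithinAt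

lemma contDiffOn_JC : ContDiffOn ℝ ∞ (P.JC x₀) (extChartAt 𝓘(ℝ, E) x₀).target := by
  rw [contDiffOn_clm_apply]
  intro w z hz
  have hy := symm_mem_source hz
  have h : SmoothFieldAt (fun y => P.J y (frameL x₀ y w)) _ :=
    ContMDiffAt.clm_bundle_apply (P.smooth_J ((extChartAt 𝓘(ℝ, E) x₀).symm z))
      (smoothFieldAt_frameL hy w)
  rw [smoothFieldAt_iff hy, (extChartAt 𝓘(ℝ, E) x₀).right_inv hz] at h
  exact h.contDiffWithinAt

lemma contDiffOn_TC : ContDiffOn ℝ ∞ (P.TC x₀) (extChartAt 𝓘(ℝ, E) x₀).target := by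
  intro z hz
  have hy := symm_mem_source hz
  have h : SmoothFieldAt P.T _ := P.smooth_T ((extChartAt 𝓘(ℝ, E) x₀).symm z)
  rw [smoothFieldAt_iff hy, (extChartAt 𝓘(ℝ, E) x₀).right_inv hz] at h
  exact h.contDiffWithinAt

lemma contDiffOn_omegaC : ContDiffOn ℝ ∞ (P.omegaC x₀) (extChartAt 𝓘(ℝ, E) x₀).target := by
  have h : ContDiffOn ℝ ∞ (fderiv ℝ (P.thetaC x₀)) (extChartAt 𝓘(ℝ, E) x₀).target :=
    contDiffOn_thetaC.fderiv_of_isOpen isOpen_target (by simp)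
  rw [contDiffOn_clm_apply]
  intro u
  rw [contDiffOn_clm_apply]
  intro v
  simp only [omegaC_apply]
  exact contDiffOn_const.mul (((h.clm_apply contDiffOn_const).clm_apply contDiffOn_const).sub
    ((h.clm_apply contDiffOn_const).clm_apply contDiffOn_const))

lemma contDiffOn_gC : ContDiffOn ℝ ∞ (P.gC x₀) (extChartAt 𝓘(ℝ, E) x₀).target := by
  rw [contDiffOn_clm_apply]
  intro u
  rw [contDiffOn_clm_apply]
  intro v
  simp only [gC_apply]
  exact ((contDiffOn_omegaC.clm_apply contDiffOn_const).clm_apply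
    (contDiffOn_JC.clm_apply contDiffOn_const)).add
    ((contDiffOn_thetaC.clm_apply contDiffOn_const).mul
      (contDiffOn_thetaC.clm_apply contDiffOn_const))

lemma hasFDerivAt_thetaC (hy : y ∈ (chartAt E x₀).source) : HasFDerivAt (P.thetaC x₀)
    (fderiv ℝ (P.thetaC x₀) (extChartAt 𝓘(ℝ, E) x₀ y)) (extChartAt 𝓘(ℝ, E) x₀ y) :=
  ((contDiffOn_thetaC.contDiffAt (isOpen_target.mem_nhds (chart_mem_target hy))).differentiableAt
    (by simp)).hasFDerivAt

/-! ### Differentiating the contact form on vector fields -/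

lemma theta_field_comp (V : ∀ y : M, TangentSpace 𝓘(ℝ, E) y) (hy : y ∈ (chartAt E x₀).source) :
    (fun y => P.θ y (V y)) ∘ (extChartAt 𝓘(ℝ, E) x₀).symm
      =ᶠ[𝓝 (extChartAt 𝓘(ℝ, E) x₀ y)] fun z => P.thetaC x₀ z (rep x₀ V z) := by
  filter_upwards [isOpen_target.mem_nhds (chart_mem_target hy)] with z hz
  simp only [thetaC, rep, Function.comp_apply, ContinuousLinearMap.comp_apply]
  rw [frameL_coordL (symm_mem_source hz)]

lemma theta_field_hasFDerivAt {V : ∀ y : M, TangentSpace 𝓘(ℝ, E) y}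
    (hV : SmoothFieldAt V y) (hy : y ∈ (chartAt E x₀).source) :
    HasFDerivAt ((fun y => P.θ y (V y)) ∘ (extChartAt 𝓘(ℝ, E) x₀).symm)
      ((P.thetaC x₀ (extChartAt 𝓘(ℝ, E) x₀ y)).comp
        (fderiv ℝ (rep x₀ V) (extChartAt 𝓘(ℝ, E) x₀ y)) +
      (fderiv ℝ (P.thetaC x₀) (extChartAt 𝓘(ℝ, E) x₀ y)).flip (coordL x₀ y (V y)))
      (extChartAt 𝓘(ℝ, E) x₀ y) := by
  have h2 := (((smoothFieldAt_iff hy).1 hV).differentiableAt (by simp)).hasFDerivAt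
  have h := ((hasFDerivAt_thetaC (P := P) hy).clm_apply h2).congr_of_eventuallyEq
    (theta_field_comp V hy)
  rwa [rep_chart hy] at h

lemma theta_field_mdifferentiableAt {V : ∀ y : M, TangentSpace 𝓘(ℝ, E) y}
    (hV : SmoothFieldAt V y) :
    MDifferentiableAt 𝓘(ℝ, E) 𝓘(ℝ, ℝ) (fun y => P.θ y (V y)) y :=
  (mdifferentiableAt_iff_chart (mem_chart_source E y)).2
    (theta_field_hasFDerivAt hV (mem_chart_source E y)).differentiableAt

lemma mvfderiv_theta_field {V : ∀ y : M, TangentSpace 𝓘(ℝ, E) y}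
    (hV : SmoothFieldAt V y) (hy : y ∈ (chartAt E x₀).source) (u : TangentSpace 𝓘(ℝ, E) y) :
    mvfderiv 𝓘(ℝ, E) (fun y => P.θ y (V y)) y u =
      P.thetaC x₀ (extChartAt 𝓘(ℝ, E) x₀ y)
        (fderiv ℝ (rep x₀ V) (extChartAt 𝓘(ℝ, E) x₀ y) (coordL x₀ y u)) +
      fderiv ℝ (P.thetaC x₀) (extChartAt 𝓘(ℝ, E) x₀ y) (coordL x₀ y u) (coordL x₀ y (V y)) := by
  rw [mvfderiv_eq_chart hy (theta_field_mdifferentiableAt hV),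
    (theta_field_hasFDerivAt hV hy).fderiv]
  rfl

/-- The derivatives of the extended fields cancel against the bracket, leaving the antisymmetrized
derivative of the components of `θ`. Bilinearity and antisymmetry of `dθ` are read off from this. -/
lemma dθ_chart (hy : y ∈ (chartAt E x₀).source) (u v : TangentSpace 𝓘(ℝ, E) y) :
    P.dθ y u v =
      P.omegaC x₀ (extChartAt 𝓘(ℝ, E) x₀ y) (coordL x₀ y u) (coordL x₀ y v) := by
  have hU := smoothFieldAt_extend u
  have hV := smoothFieldAt_extend v
  rw [dθ, extDerivOne, mvfderiv_theta_field hU hy, mvfderiv_theta_field hV hy,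
    ← thetaC_chart hy (VectorField.mlieBracket 𝓘(ℝ, E) _ _ y),
    coordL_mlieBracket hy hU.mdifferentiableAt hV.mdifferentiableAt, omegaC_apply]
  simp only [FiberBundle.extend_apply_self, map_sub]
  ring

lemma g_chart (hy : y ∈ (chartAt E x₀).source) (u v : TangentSpace 𝓘(ℝ, E) y) :
    P.g y u v = P.gC x₀ (extChartAt 𝓘(ℝ, E) x₀ y) (coordL x₀ y u) (coordL x₀ y v) := by
  rw [g, dθ_chart hy, gC_apply, JC_chart hy, thetaC_chart hy, thetaC_chart hy]

/-! ### Pointwise algebra of `dθ`, `J`, `T` and the Webster metric -/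

lemma dθ_add_right (u v w : TangentSpace 𝓘(ℝ, E) y) :
    P.dθ y u (v + w) = P.dθ y u v + P.dθ y u w := by
  simp only [dθ_chart (mem_chart_source E y), map_add]

lemma dθ_smul_right (c : ℝ) (u v : TangentSpace 𝓘(ℝ, E) y) :
    P.dθ y u (c • v) = c * P.dθ y u v := by
  simp only [dθ_chart (mem_chart_source E y), map_smul, smul_eq_mul]

lemma dθ_swap (u v : TangentSpace 𝓘(ℝ, E) y) : P.dθ y u v = - P.dθ y v u := by
  simp only [dθ_chart (mem_chart_source E y), omegaC_apply]
  ring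

lemma dθ_neg_right (u v : TangentSpace 𝓘(ℝ, E) y) : P.dθ y u (-v) = - P.dθ y u v := by
  simp only [dθ_chart (mem_chart_source E y), map_neg]

lemma dθ_T_left (v : TangentSpace 𝓘(ℝ, E) y) : P.dθ y (P.T y) v = 0 := P.dθ_T y v

lemma dθ_add_left (u v w : TangentSpace 𝓘(ℝ, E) y) :
    P.dθ y (u + v) w = P.dθ y u w + P.dθ y v w := by
  rw [dθ_swap, dθ_add_right, dθ_swap u, dθ_swap v]; ring

lemma dθ_smul_left (c : ℝ) (u v : TangentSpace 𝓘(ℝ, E) y) :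
    P.dθ y (c • u) v = c * P.dθ y u v := by
  rw [dθ_swap, dθ_smul_right, dθ_swap u]; ring

variable (P) in
/-- The horizontal part of a tangent vector. -/
def hor (y : M) (v : TangentSpace 𝓘(ℝ, E) y) : TangentSpace 𝓘(ℝ, E) y := v - P.θ y v • P.T y

lemma hor_add (v : TangentSpace 𝓘(ℝ, E) y) : P.hor y v + P.θ y v • P.T y = v := by simp [hor]

lemma theta_hor (v : TangentSpace 𝓘(ℝ, E) y) : P.θ y (P.hor y v) = 0 := by simp [hor, P.θ_T]

lemma J_hor (v : TangentSpace 𝓘(ℝ, E) y) : P.J y (P.hor y v) = P.J y v := by simp [hor, P.J_T]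

lemma theta_J (v : TangentSpace 𝓘(ℝ, E) y) : P.θ y (P.J y v) = 0 := by
  rw [← J_hor]; exact P.θ_J y _ (theta_hor v)

lemma dθ_hor_left (u v : TangentSpace 𝓘(ℝ, E) y) : P.dθ y (P.hor y u) v = P.dθ y u v := by
  conv_rhs => rw [← hor_add u, dθ_add_left, dθ_smul_left, dθ_T_left]
  ring

lemma dθ_hor_right (u v : TangentSpace 𝓘(ℝ, E) y) : P.dθ y u (P.hor y v) = P.dθ y u v := by
  rw [dθ_swap, dθ_hor_left, dθ_swap v, neg_neg]

lemma g_T_left (v : TangentSpace 𝓘(ℝ, E) y) : P.g y (P.T y) v = P.θ y v := by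
  rw [g, dθ_T_left, P.θ_T]; ring

lemma g_T_right (v : TangentSpace 𝓘(ℝ, E) y) : P.g y v (P.T y) = P.θ y v := by
  have h := dθ_smul_right (P := P) 0 v (P.T y)
  rw [zero_smul, zero_mul] at h
  rw [g, P.J_T, h, P.θ_T]; ring

/-- `J² = -1` on the horizontal part, and `dθ` does not see the `T`-component. -/
lemma Ω_eq_neg_dθ (u v : TangentSpace 𝓘(ℝ, E) y) : P.Ω y u v = - P.dθ y u v := by
  rw [Ω, g, theta_J, mul_zero, add_zero, ← J_hor v, P.J_J y _ (theta_hor v), dθ_neg_right,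
    dθ_hor_right]

lemma smoothFieldAt_hor {Y : ∀ y : M, TangentSpace 𝓘(ℝ, E) y} (hY : SmoothFieldAt Y y) :
    SmoothFieldAt (fun y => P.hor y (Y y)) y := by
  have hm := mem_chart_source E y
  have h1 : ContMDiffAt 𝓘(ℝ, E) 𝓘(ℝ, ℝ) ∞ (fun y => P.θ y (Y y)) y := by
    refine (contMDiffAt_iff_chart (k := ⊤) hm).2
      (ContDiffAt.congr_of_eventuallyEq ?_ (theta_field_comp Y hm))
    exact (contDiffOn_thetaC.contDiffAt (isOpen_target.mem_nhds (chart_mem_target hm))).clm_apply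
      ((smoothFieldAt_iff hm).1 hY)
  exact ContMDiffAt.sub_section hY (ContMDiffAt.smul_section h1 (P.smooth_T y))

end PseudohermitianStructure

/-! ### The Tanaka-Webster connection of a Sasakian manifold in a chart -/

/-- The local form of the Tanaka-Webster connection of a Sasakian manifold: Christoffel symbols `Γ`
on an open set of a vector space, with torsion `2 B ⊗ T`, for which the symmetric form `G`, the
alternating form `B` and the vector field `T` are parallel. -/
structure IsLocalModel (V : Set E) (Γ : E → E →L[ℝ] E →L[ℝ] E) (G B : E → E →L[ℝ] E →L[ℝ] ℝ)
    (T : E → E) : Prop where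
  isOpen : IsOpen V
  smooth_Γ : ContDiffOn ℝ ∞ Γ V
  smooth_G : ContDiffOn ℝ ∞ G V
  smooth_B : ContDiffOn ℝ ∞ B V
  smooth_T : ContDiffOn ℝ ∞ T V
  G_symm : ∀ z ∈ V, ∀ u v, G z u v = G z v u
  B_swap : ∀ z ∈ V, ∀ u v, B z u v = - B z v u
  B_T : ∀ z ∈ V, ∀ u, B z (T z) u = 0
  torsion : ∀ z ∈ V, ∀ u v, Γ z u v - Γ z v u = (2 * B z u v) • T z
  parallel_G : ∀ z ∈ V, ∀ u v w, fderiv ℝ G z u v w = G z (Γ z u v) w + G z v (Γ z u w)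
  parallel_B : ∀ z ∈ V, ∀ u v w, fderiv ℝ B z u v w = B z (Γ z u v) w + B z v (Γ z u w)
  parallel_T : ∀ z ∈ V, ∀ u, fderiv ℝ T z u = - Γ z u (T z)

namespace PseudohermitianStructure

set_option synthInstance.maxHeartbeats 200000 in
lemma hasFDerivAt_gC (P : PseudohermitianStructure E M) {x₀ : M} {z : E}
    (hz : z ∈ (extChartAt 𝓘(ℝ, E) x₀).target) :
    HasFDerivAt (P.gC x₀) (fderiv ℝ (P.gC x₀) z) z :=
  ((contDiffOn_gC.contDiffAt (isOpen_target.mem_nhds hz)).differentiableAt (by simp)).hasFDerivAt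

set_option synthInstance.maxHeartbeats 200000 in
lemma hasFDerivAt_JC (P : PseudohermitianStructure E M) {x₀ : M} {z : E}
    (hz : z ∈ (extChartAt 𝓘(ℝ, E) x₀).target) :
    HasFDerivAt (P.JC x₀) (fderiv ℝ (P.JC x₀) z) z :=
  ((contDiffOn_JC.contDiffAt (isOpen_target.mem_nhds hz)).differentiableAt (by simp)).hasFDerivAt

set_option synthInstance.maxHeartbeats 200000 in
lemma hasFDerivAt_omegaC (P : PseudohermitianStructure E M) {x₀ : M} {z : E}
    (hz : z ∈ (extChartAt 𝓘(ℝ, E) x₀).target) :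
    HasFDerivAt (P.omegaC x₀) (fderiv ℝ (P.omegaC x₀) z) z :=
  ((contDiffOn_omegaC.contDiffAt (isOpen_target.mem_nhds hz)).differentiableAt (by simp)).hasFDerivAt

/-! ### Consequences of the Tanaka–Webster axioms -/

namespace IsTanakaWebster

variable {P : PseudohermitianStructure E M}
  {D : CovariantDerivative 𝓘(ℝ, E) E (TangentSpace 𝓘(ℝ, E) : M → Type _)}

lemma theta_nabla_T (hD : P.IsTanakaWebster D) (y : M) (v : TangentSpace 𝓘(ℝ, E) y) :
    P.θ y (D P.T y v) = 0 := by
  have h := hD.parallel_g y P.T P.T v (P.smooth_T y) (P.smooth_T y)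
  have h1 : (fun y => P.g y (P.T y) (P.T y)) = fun _ => (1 : ℝ) := by
    funext y; rw [g_T_left, P.θ_T]
  rw [h1, mvfderiv_const, g_T_left, g_T_right] at h
  simp only [zero_apply] at h
  linarith

/-- Let `w = ∇_v T`, which is horizontal by `theta_nabla_T`. For a horizontal field `Y` extending
`w`, differentiating `g(Y, T) = 0` and using that `H(M)` is parallel gives `g(w, w) = 0`,
contradicting positivity of the Levi form unless `w = 0`. -/
lemma nabla_T (hD : P.IsTanakaWebster D) (y : M) (v : TangentSpace 𝓘(ℝ, E) y) :
    D P.T y v = 0 := by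
  by_contra hne
  set w := D P.T y v with hw
  have hθw : P.θ y w = 0 := hD.theta_nabla_T y v
  have hpos := P.levi_pos y w hθw hne
  set Y : ∀ y : M, TangentSpace 𝓘(ℝ, E) y := fun y' => P.hor y' (FiberBundle.extend E w y') with hY
  have hYs : SmoothFieldAt Y y := smoothFieldAt_hor (smoothFieldAt_extend w)
  have hYy : Y y = w := by
    simp only [hY, FiberBundle.extend_apply_self, hor, hθw, zero_smul, sub_zero]
  have h := hD.parallel_g y Y P.T v hYs (P.smooth_T y)
  have h1 : (fun y => P.g y (Y y) (P.T y)) = fun _ => (0 : ℝ) := by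
    funext y'; rw [g_T_right]; exact theta_hor _
  have h2 := hD.parallel_H y Y v hYs (fun y' => theta_hor _)
  rw [h1, mvfderiv_const, g_T_right, h2, hYy, ← hw, g, hθw] at h
  simp only [zero_apply] at h
  unfold dθ at h
  linarith

/-- `θ = g(T, ·)` is parallel because both `g` and `T` are. -/
lemma mvfderiv_theta (hD : P.IsTanakaWebster D) {y : M} {Y : ∀ y : M, TangentSpace 𝓘(ℝ, E) y}
    (hY : SmoothFieldAt Y y) (v : TangentSpace 𝓘(ℝ, E) y) :
    mvfderiv 𝓘(ℝ, E) (fun y => P.θ y (Y y)) y v = P.θ y (D Y y v) := by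
  have h := hD.parallel_g y P.T Y v (P.smooth_T y) hY
  have h1 : (fun y => P.g y (P.T y) (Y y)) = fun y => P.θ y (Y y) := by
    funext y'; rw [g_T_left]
  have h0 := dθ_smul_left (P := P) 0 (0 : TangentSpace 𝓘(ℝ, E) y) (P.J y (Y y))
  rw [zero_smul, zero_mul] at h0
  rw [h1, hD.nabla_T, g_T_left, g, h0, map_zero] at h
  linarith

/-- As `θ` is parallel, `θ(T_∇(U, V)) = U θ(V) - V θ(U) - θ([U, V])`; the factor `2` comes from the
normalization of `dθ`. -/
lemma theta_torsion (hD : P.IsTanakaWebster D) (y : M) (u v : TangentSpace 𝓘(ℝ, E) y) :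
    P.θ y (D.torsion y u v) = 2 * P.dθ y u v := by
  rw [D.torsion_apply_eq_extend, map_sub, map_sub, FiberBundle.extend_apply_self,
    FiberBundle.extend_apply_self, ← hD.mvfderiv_theta (smoothFieldAt_extend v),
    ← hD.mvfderiv_theta (smoothFieldAt_extend u), dθ, extDerivOne]
  ring

lemma torsion_J_J (hD : P.IsTanakaWebster D) {y : M} {u v : TangentSpace 𝓘(ℝ, E) y}
    (hu : P.θ y u = 0) (hv : P.θ y v = 0) :
    D.torsion y (P.J y u) (P.J y v) = D.torsion y u v := by
  have h := hD.torsion_hol y (u, -P.J y u) ⟨u, hu, rfl⟩ (v, -P.J y v) ⟨v, hv, rfl⟩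
  have h1 := congrArg Prod.fst h
  simp only [complexify₂, map_neg, neg_apply, neg_neg, Prod.fst_zero] at h1
  exact (sub_eq_zero.1 h1).symm

/-- The real part of `T_∇(Z, W) = 0` on `T_{1,0}` makes the torsion `J`-invariant on horizontal
vectors; apply `θ`. -/
lemma dθ_J_J (hD : P.IsTanakaWebster D) {y : M} {u v : TangentSpace 𝓘(ℝ, E) y}
    (hu : P.θ y u = 0) (hv : P.θ y v = 0) :
    P.dθ y (P.J y u) (P.J y v) = P.dθ y u v := by
  have h1 := hD.theta_torsion y u v
  have h2 := hD.theta_torsion y (P.J y u) (P.J y v)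
  rw [hD.torsion_J_J hu hv] at h2
  linarith

/-- This is the real part of the mixed torsion identity for `Z = u - iJu` and `W̄ = v + iJv`. By
`J`-invariance of the torsion and of `dθ`, each side is twice the desired one. -/
lemma torsion_horizontal (hD : P.IsTanakaWebster D) {y : M} {u v : TangentSpace 𝓘(ℝ, E) y}
    (hu : P.θ y u = 0) (hv : P.θ y v = 0) :
    D.torsion y u v = (2 * P.dθ y u v) • P.T y := by
  have h := hD.torsion_mixed y (u, -P.J y u) ⟨u, hu, rfl⟩ (v, -P.J y v) ⟨v, hv, rfl⟩
  have h1 := congrArg Prod.fst h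
  have h2 : P.dθ y (-P.J y u) (P.J y v) = - P.dθ y u v := by
    rw [dθ_swap, dθ_neg_right, ← dθ_swap, hD.dθ_J_J hu hv]
  -- `2i · (-i) = 2`, and the real part of `dθ(Z, W̄)` is `dθ(u, v) + dθ(Ju, Jv) = 2 dθ(u, v)`.
  have h3 : (2 * Complex.I * (-Complex.I * complexifyForm (P.dθ y) (u, -P.J y u)
      (conjVec (v, -P.J y v)))).re = 4 * P.dθ y u v := by
    have : 2 * Complex.I * (-Complex.I * complexifyForm (P.dθ y) (u, -P.J y u)
      (conjVec (v, -P.J y v))) = 2 * complexifyForm (P.dθ y) (u, -P.J y u)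
      (conjVec (v, -P.J y v)) := by
      linear_combination (-2 * complexifyForm (P.dθ y) (u, -P.J y u)
      (conjVec (v, -P.J y v))) * Complex.I_mul_I
    rw [this]
    simp only [complexifyForm, conjVec, neg_neg, Complex.mul_re, Complex.re_ofNat, Complex.im_ofNat,
      zero_mul, sub_zero, h2]
    ring
  simp only [complexify₂, conjVec, csmulReal, levi, map_neg, neg_apply, neg_neg, sub_neg_eq_add,
    hD.torsion_J_J hu hv] at h1
  simp only [conjVec, neg_neg] at h3
  rw [h3, ← two_smul ℝ] at h1
  have h4 := congrArg (fun w => (1 / 2 : ℝ) • w) h1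
  simp only [smul_smul] at h4
  rw [show (1 / 2 : ℝ) * 2 = 1 by norm_num, one_smul,
    show (1 / 2 : ℝ) * (4 * P.dθ y u v) = 2 * P.dθ y u v by ring] at h4
  exact h4

/-- Split both vectors into horizontal and `T`-parts: the Sasakian condition kills every term
containing `T`, and `dθ` ignores the `T`-parts as well. -/
lemma torsion_eq (hD : P.IsTanakaWebster D) (hS : P.IsSasakian D) (y : M)
    (u v : TangentSpace 𝓘(ℝ, E) y) :
    D.torsion y u v = (2 * P.dθ y u v) • P.T y := by
  have hS' : ∀ w, D.torsion y w (P.T y) = 0 := fun w => by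
    rw [D.torsion_antisymm, hS y w, neg_zero]
  have h : D.torsion y u v = D.torsion y (P.hor y u) (P.hor y v) := by
    conv_lhs => rw [← hor_add (P := P) u, ← hor_add (P := P) v]
    simp only [map_add, map_smul, add_apply, smul_apply, hS y, hS', smul_zero, add_zero]
  rw [h, hD.torsion_horizontal (theta_hor u) (theta_hor v), dθ_hor_left, dθ_hor_right]

/-- For horizontal vectors, `dθ(u, Jv) = dθ(Ju, J²v) = -dθ(Ju, v) = dθ(v, Ju)`. -/
lemma g_symm (hD : P.IsTanakaWebster D) (y : M) (u v : TangentSpace 𝓘(ℝ, E) y) :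
    P.g y u v = P.g y v u := by
  have h : P.dθ y u (P.J y v) = P.dθ y v (P.J y u) := by
    rw [← dθ_hor_left u, ← dθ_hor_left v, ← J_hor u, ← J_hor v, dθ_swap (P.hor y v),
      ← hD.dθ_J_J (theta_hor u) (P.θ_J y _ (theta_hor v)), P.J_J y _ (theta_hor v), dθ_neg_right]
  rw [g, g, h, mul_comm (P.θ y u)]

/-- The axioms are evaluated on frame fields with constant components, so that every covariant
derivative is a Christoffel symbol. That `dθ` is parallel is not an axiom; it follows from `∇g = 0`
and `∇J = 0`. -/
lemma isLocalModel [T2Space M] (hD : P.IsTanakaWebster D) (hS : P.IsSasakian D) (x₀ : M) :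
    IsLocalModel (extChartAt 𝓘(ℝ, E) x₀).target (christoffel D x₀) (P.gC x₀) (P.omegaC x₀)
      (P.TC x₀) := by
  have hpar : ∀ z ∈ (extChartAt 𝓘(ℝ, E) x₀).target, ∀ u v w,
      fderiv ℝ (P.gC x₀) z u v w = P.gC x₀ z (christoffel D x₀ z u v) w
        + P.gC x₀ z v (christoffel D x₀ z u w) := by
    intro z hz u v w
    have hy := symm_mem_source hz
    have hzz := (extChartAt 𝓘(ℝ, E) x₀).right_inv hz
    set y := (extChartAt 𝓘(ℝ, E) x₀).symm z
    have h := hD.parallel_g y (fun y => frameL x₀ y v) (fun y => frameL x₀ y w) (frameL x₀ y u)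
      (smoothFieldAt_frameL hy v) (smoothFieldAt_frameL hy w)
    have hG := P.hasFDerivAt_gC hz
    have hd : HasFDerivAt ((fun y => P.g y (frameL x₀ y v) (frameL x₀ y w)) ∘
        (extChartAt 𝓘(ℝ, E) x₀).symm) (((fderiv ℝ (P.gC x₀) z).flip v).flip w) z := by
      have h1 := (hG.clm_apply (hasFDerivAt_const v z)).clm_apply (hasFDerivAt_const w z)
      refine (h1.congr_fderiv ?_).congr_of_eventuallyEq ?_
      · ext u; simp
      · filter_upwards [isOpen_target.mem_nhds hz] with z' hz'
        have hy' := symm_mem_source hz'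
        rw [Function.comp_apply, g_chart hy', coordL_frameL hy', coordL_frameL hy',
          (extChartAt 𝓘(ℝ, E) x₀).right_inv hz']
    rw [mvfderiv_eq_chart hy ((mdifferentiableAt_iff_chart hy).2 (by
      rw [hzz]; exact hd.differentiableAt)), hzz, hd.fderiv, g_chart hy, g_chart hy, hzz,
      coordL_frameL hy, coordL_frameL hy, coordL_frameL hy] at h
    rw [← hzz, christoffel_chart hy, christoffel_chart hy, hzz]
    exact h
  have hJ : ∀ z ∈ (extChartAt 𝓘(ℝ, E) x₀).target, ∀ u w,
      fderiv ℝ (P.JC x₀) z u w + christoffel D x₀ z u (P.JC x₀ z w)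
        = P.JC x₀ z (christoffel D x₀ z u w) := by
    intro z hz u w
    have hy := symm_mem_source hz
    have hzz := (extChartAt 𝓘(ℝ, E) x₀).right_inv hz
    set y := (extChartAt 𝓘(ℝ, E) x₀).symm z
    have h := congrArg (coordL x₀ y)
      (hD.parallel_J y (fun y => frameL x₀ y w) (frameL x₀ y u) (smoothFieldAt_frameL hy w))
    have hJd := P.hasFDerivAt_JC hz
    have hrep : rep x₀ (fun y => P.J y (frameL x₀ y w)) = fun z => P.JC x₀ z w := rfl
    have hd : HasFDerivAt (rep x₀ (fun y => P.J y (frameL x₀ y w)))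
        ((fderiv ℝ (P.JC x₀) z).flip w) z := by
      rw [hrep]
      refine (hJd.clm_apply (hasFDerivAt_const w z)).congr_fderiv ?_
      ext u; simp
    rw [coordL_covariantDerivative hy ((mdifferentiableAt_field_iff hy).2 (by
      rw [hzz]; exact hd.differentiableAt)), hzz, hd.fderiv, ← JC_chart hy, ← JC_chart hy,
      coordL_frameL hy, coordL_frameL hy, ← christoffel_chart hy, hzz] at h
    exact h
  -- `Ω = -dθ` in coordinates: this expresses `B` through the parallel tensors `G` and `J`.
  have hBG : ∀ z ∈ (extChartAt 𝓘(ℝ, E) x₀).target, ∀ v w,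
      P.omegaC x₀ z v w = - P.gC x₀ z v (P.JC x₀ z w) := by
    intro z hz v w
    have hy := symm_mem_source hz
    have hzz := (extChartAt 𝓘(ℝ, E) x₀).right_inv hz
    have h := Ω_eq_neg_dθ (P := P) (frameL x₀ ((extChartAt 𝓘(ℝ, E) x₀).symm z) v)
      (frameL x₀ ((extChartAt 𝓘(ℝ, E) x₀).symm z) w)
    rw [Ω, g_chart hy, dθ_chart hy, ← JC_chart hy, coordL_frameL hy, coordL_frameL hy, hzz] at h
    linarith
  refine ⟨isOpen_target, contDiffOn_christoffel hD.smooth, contDiffOn_gC, contDiffOn_omegaC,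
    contDiffOn_TC, ?_, ?_, ?_, ?_, hpar, ?_, ?_⟩
  · intro z hz u v
    have hy := symm_mem_source hz
    have h := hD.g_symm _ (frameL x₀ ((extChartAt 𝓘(ℝ, E) x₀).symm z) u) (frameL x₀ _ v)
    rwa [g_chart hy, g_chart hy, coordL_frameL hy, coordL_frameL hy,
      (extChartAt 𝓘(ℝ, E) x₀).right_inv hz] at h
  · intro z hz u v
    rw [omegaC_apply, omegaC_apply]
    ring
  · intro z hz u
    have hy := symm_mem_source hz
    have h := dθ_T_left (P := P) (frameL x₀ ((extChartAt 𝓘(ℝ, E) x₀).symm z) u)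
    rwa [dθ_chart hy, coordL_frameL hy, ← TC_chart hy,
      (extChartAt 𝓘(ℝ, E) x₀).right_inv hz] at h
  · intro z hz u v
    have hy := symm_mem_source hz
    have h := congrArg (coordL x₀ _) (hD.torsion_eq hS _
      (frameL x₀ ((extChartAt 𝓘(ℝ, E) x₀).symm z) u) (frameL x₀ _ v))
    rwa [coordL_torsion hy, map_smul, dθ_chart hy, coordL_frameL hy, coordL_frameL hy,
      ← TC_chart hy, (extChartAt 𝓘(ℝ, E) x₀).right_inv hz] at h
  · intro z hz u v w
    have hG := P.hasFDerivAt_gC hz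
    have hJd := P.hasFDerivAt_JC hz
    have hB := P.hasFDerivAt_omegaC hz
    have h1 := (hB.clm_apply (hasFDerivAt_const v z)).clm_apply (hasFDerivAt_const w z)
    have h2 := ((hG.clm_apply (hasFDerivAt_const v z)).clm_apply
      (hJd.clm_apply (hasFDerivAt_const w z))).neg
    have h3 := h2.congr_of_eventuallyEq (f₁ := fun z => P.omegaC x₀ z v w) (by
      filter_upwards [isOpen_target.mem_nhds hz] with z' hz' using hBG z' hz' v w)
    have h4 := DFunLike.congr_fun (h1.unique h3) u
    simp only [add_apply, neg_apply, ContinuousLinearMap.comp_apply,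
      ContinuousLinearMap.flip_apply, zero_apply, map_zero, zero_add] at h4
    rw [h4, hpar z hz, hBG z hz, hBG z hz, ← hJ z hz]
    simp only [map_add]
    ring
  · intro z hz u
    have hy := symm_mem_source hz
    have h := congrArg (coordL x₀ _) (hD.nabla_T _ (frameL x₀ ((extChartAt 𝓘(ℝ, E) x₀).symm z) u))
    rw [coordL_covariantDerivative hy (SmoothFieldAt.mdifferentiableAt (P.smooth_T _)),
      coordL_frameL hy, ← TC_chart hy, (extChartAt 𝓘(ℝ, E) x₀).right_inv hz, map_zero] at h
    exact eq_neg_of_add_eq_zero_left h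

end IsTanakaWebster
end PseudohermitianStructure

/-! ### Covariant calculus along maps into a local model -/

section LocalModel

variable {Q : Type*} [NormedAddCommGroup Q] [NormedSpace ℝ Q]
  {W : Type*} [NormedAddCommGroup W] [NormedSpace ℝ W]

set_option synthInstance.maxHeartbeats 200000 in
lemma hasFDerivAt_bilin_comp {X U₁ U₂ : Type*} [NormedAddCommGroup X] [NormedSpace ℝ X]
    [NormedAddCommGroup U₁] [NormedSpace ℝ U₁] [NormedAddCommGroup U₂] [NormedSpace ℝ U₂]
    {A : X → U₁ →L[ℝ] U₂ →L[ℝ] W} {F : Q → X} {Y : Q → U₁} {Z : Q → U₂} {p : Q}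
    (hA : DifferentiableAt ℝ A (F p)) (hF : DifferentiableAt ℝ F p)
    (hY : DifferentiableAt ℝ Y p) (hZ : DifferentiableAt ℝ Z p) :
    DifferentiableAt ℝ (fun p => A (F p) (Y p) (Z p)) p ∧
    ∀ d, fderiv ℝ (fun p => A (F p) (Y p) (Z p)) p d =
      fderiv ℝ A (F p) (fderiv ℝ F p d) (Y p) (Z p) + A (F p) (fderiv ℝ Y p d) (Z p)
        + A (F p) (Y p) (fderiv ℝ Z p d) := by
  have h0 : HasFDerivAt (fun p => A (F p)) ((fderiv ℝ A (F p)).comp (fderiv ℝ F p)) p :=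
    HasFDerivAt.comp (G := U₁ →L[ℝ] U₂ →L[ℝ] W) p hA.hasFDerivAt hF.hasFDerivAt
  have h1 := (h0.clm_apply hY.hasFDerivAt).clm_apply hZ.hasFDerivAt
  refine ⟨h1.differentiableAt, fun d => ?_⟩
  rw [h1.fderiv]
  simp only [add_apply, ContinuousLinearMap.comp_apply, ContinuousLinearMap.flip_apply]
  abel

/-- The covariant derivative in the direction `d` of a vector field `Y` along a map `F`. -/
def covAlong (Γ : E → E →L[ℝ] E →L[ℝ] E) (F Y : Q → E) (d p : Q) : E :=
  fderiv ℝ Y p d + Γ (F p) (fderiv ℝ F p d) (Y p)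

namespace IsLocalModel

variable {V : Set E} {Γ : E → E →L[ℝ] E →L[ℝ] E} {G B : E → E →L[ℝ] E →L[ℝ] ℝ} {T : E → E}
  {F Y Z : Q → E} {p : Q} {z : E}

lemma diff_Γ (h : IsLocalModel V Γ G B T) (hz : z ∈ V) : DifferentiableAt ℝ Γ z :=
  (h.smooth_Γ.contDiffAt (h.isOpen.mem_nhds hz)).differentiableAt (by simp)

lemma diff_G (h : IsLocalModel V Γ G B T) (hz : z ∈ V) : DifferentiableAt ℝ G z :=
  (h.smooth_G.contDiffAt (h.isOpen.mem_nhds hz)).differentiableAt (by simp)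

lemma diff_B (h : IsLocalModel V Γ G B T) (hz : z ∈ V) : DifferentiableAt ℝ B z :=
  (h.smooth_B.contDiffAt (h.isOpen.mem_nhds hz)).differentiableAt (by simp)

lemma diff_T (h : IsLocalModel V Γ G B T) (hz : z ∈ V) : DifferentiableAt ℝ T z :=
  (h.smooth_T.contDiffAt (h.isOpen.mem_nhds hz)).differentiableAt (by simp)

lemma fderiv_G_comp (h : IsLocalModel V Γ G B T) (hp : F p ∈ V) (hF : DifferentiableAt ℝ F p)
    (hY : DifferentiableAt ℝ Y p) (hZ : DifferentiableAt ℝ Z p) (d : Q) :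
    fderiv ℝ (fun p => G (F p) (Y p) (Z p)) p d =
      G (F p) (covAlong Γ F Y d p) (Z p) + G (F p) (Y p) (covAlong Γ F Z d p) := by
  rw [(hasFDerivAt_bilin_comp (h.diff_G hp) hF hY hZ).2 d, h.parallel_G _ hp]
  simp only [covAlong, map_add, add_apply]
  ring

lemma differentiableAt_G_comp (h : IsLocalModel V Γ G B T) (hp : F p ∈ V)
    (hF : DifferentiableAt ℝ F p) (hY : DifferentiableAt ℝ Y p) (hZ : DifferentiableAt ℝ Z p) :
    DifferentiableAt ℝ (fun p => G (F p) (Y p) (Z p)) p :=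
  (hasFDerivAt_bilin_comp (h.diff_G hp) hF hY hZ).1

lemma differentiableAt_B_comp (h : IsLocalModel V Γ G B T) (hp : F p ∈ V)
    (hF : DifferentiableAt ℝ F p) (hY : DifferentiableAt ℝ Y p) (hZ : DifferentiableAt ℝ Z p) :
    DifferentiableAt ℝ (fun p => B (F p) (Y p) (Z p)) p :=
  (hasFDerivAt_bilin_comp (h.diff_B hp) hF hY hZ).1

lemma covAlong_T (h : IsLocalModel V Γ G B T) (hp : F p ∈ V) (hF : DifferentiableAt ℝ F p) (d : Q) :
    covAlong Γ F (fun p => T (F p)) d p = 0 := by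
  have h1 : fderiv ℝ (fun p => T (F p)) p d = fderiv ℝ T (F p) (fderiv ℝ F p d) := by
    have := ((h.diff_T hp).hasFDerivAt.comp p hF.hasFDerivAt).fderiv
    exact DFunLike.congr_fun this d
  rw [covAlong, h1, h.parallel_T _ hp, neg_add_cancel]

/-- Second derivatives of `F` commute, so only the antisymmetric part of `Γ`, that is the torsion,
distinguishes the two mixed covariant derivatives. -/
lemma covAlong_comm (h : IsLocalModel V Γ G B T) (hp : F p ∈ V) (hF : ContDiffAt ℝ 2 F p)
    (a b : Q) :
    covAlong Γ F (fun p => fderiv ℝ F p b) a p = covAlong Γ F (fun p => fderiv ℝ F p a) b p +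
      (2 * B (F p) (fderiv ℝ F p a) (fderiv ℝ F p b)) • T (F p) := by
  have hFd : DifferentiableAt ℝ (fderiv ℝ F) p :=
    (hF.fderiv_right (m := 1) (by norm_num)).differentiableAt (by simp)
  have hsymm : fderiv ℝ (fderiv ℝ F) p a b = fderiv ℝ (fderiv ℝ F) p b a :=
    (hF.isSymmSndFDerivAt (by
      simp only [minSmoothness_of_isRCLikeNormedField, le_refl])).eq a b
  have h1 : ∀ c d, fderiv ℝ (fun p => fderiv ℝ F p c) p d = fderiv ℝ (fderiv ℝ F) p d c := by
    intro c d
    rw [(hFd.hasFDerivAt.clm_apply (hasFDerivAt_const c p)).fderiv]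
    simp
  rw [covAlong, covAlong, h1, h1, hsymm, ← h.torsion _ hp]
  abel

lemma covAlong_smul {f : Q → ℝ} (hf : DifferentiableAt ℝ f p) (hY : DifferentiableAt ℝ Y p)
    (d : Q) : covAlong Γ F (fun p => f p • Y p) d p =
      f p • covAlong Γ F Y d p + fderiv ℝ f p d • Y p := by
  have := fderiv_fun_smul hf hY
  rw [covAlong, this, covAlong]
  simp
  abel

lemma covAlong_add (hZ : DifferentiableAt ℝ Z p) (hY : DifferentiableAt ℝ Y p)
    (d : Q) : covAlong Γ F (fun p => Y p + Z p) d p =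
      covAlong Γ F Y d p + covAlong Γ F Z d p := by
  rw [covAlong, fderiv_fun_add hY hZ, covAlong, covAlong]
  simp
  abel

lemma contDiffAt_Γ (h : IsLocalModel V Γ G B T) (hp : z ∈ V) : ContDiffAt ℝ ∞ Γ z :=
  h.smooth_Γ.contDiffAt (h.isOpen.mem_nhds hp)

lemma contDiffAt_fderiv_apply {F : Q → E} (hF : ContDiffAt ℝ ∞ F p) (d : Q) :
    ContDiffAt ℝ ∞ (fun p => fderiv ℝ F p d) p :=
  (hF.fderiv_right (m := ∞) (by simp)).clm_apply contDiffAt_const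

lemma contDiffAt_covAlong (h : IsLocalModel V Γ G B T) (hp : F p ∈ V) (hF : ContDiffAt ℝ ∞ F p)
    (hY : ContDiffAt ℝ ∞ Y p) (d : Q) : ContDiffAt ℝ ∞ (covAlong Γ F Y d) p :=
  (contDiffAt_fderiv_apply hY d).add
    ((((h.contDiffAt_Γ hp).comp p hF).clm_apply (contDiffAt_fderiv_apply hF d)).clm_apply hY)

/-- No bracket term appears because `a` and `b` are constant directions; torsion plays no role,
since the commutator acts on an arbitrary field `Y` along `F`. -/
lemma covAlong_curv (h : IsLocalModel V Γ G B T) (hp : F p ∈ V) (hF : ContDiffAt ℝ ∞ F p)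
    (hY : ContDiffAt ℝ ∞ Y p) (a b : Q) :
    covAlong Γ F (covAlong Γ F Y b) a p = covAlong Γ F (covAlong Γ F Y a) b p +
      christoffelCurv Γ (F p) (fderiv ℝ F p a) (fderiv ℝ F p b) (Y p) := by
  have two : (2 : WithTop ℕ∞) ≤ ∞ := WithTop.coe_le_coe.2 le_top
  have hd : ∀ {F : Q → E}, ContDiffAt ℝ ∞ F p → DifferentiableAt ℝ (fderiv ℝ F) p := fun hF =>
    (hF.fderiv_right (m := 1) two).differentiableAt (by simp)
  have hsymm : ∀ {F : Q → E}, ContDiffAt ℝ ∞ F p →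
      fderiv ℝ (fderiv ℝ F) p a b = fderiv ℝ (fderiv ℝ F) p b a := fun hF =>
    (hF.isSymmSndFDerivAt (by
      simp only [minSmoothness_of_isRCLikeNormedField]; exact two)).eq a b
  have h1 : ∀ {F : Q → E}, ContDiffAt ℝ ∞ F p → ∀ c d,
      fderiv ℝ (fun p => fderiv ℝ F p c) p d = fderiv ℝ (fderiv ℝ F) p d c := by
    intro F hF c d
    rw [((hd hF).hasFDerivAt.clm_apply (hasFDerivAt_const c p)).fderiv]
    simp
  have key : ∀ c d, fderiv ℝ (covAlong Γ F Y c) p d =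
      fderiv ℝ (fderiv ℝ Y) p d c +
      (fderiv ℝ Γ (F p) (fderiv ℝ F p d) (fderiv ℝ F p c) (Y p)
        + Γ (F p) (fderiv ℝ (fderiv ℝ F) p d c) (Y p)
        + Γ (F p) (fderiv ℝ F p c) (fderiv ℝ Y p d)) := by
    intro c d
    have e1 := hasFDerivAt_bilin_comp (A := Γ) (F := F) (Y := fun p => fderiv ℝ F p c) (Z := Y)
      (h.diff_Γ hp) (hF.differentiableAt (by simp))
      ((contDiffAt_fderiv_apply hF c).differentiableAt (by simp)) (hY.differentiableAt (by simp))
    have e2 : fderiv ℝ (covAlong Γ F Y c) p = _ := fderiv_fun_add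
      ((contDiffAt_fderiv_apply hY c).differentiableAt (by simp)) e1.1
    rw [e2, add_apply, h1 hY, e1.2, h1 hF]
  have unf : ∀ c d, covAlong Γ F (covAlong Γ F Y c) d p = fderiv ℝ (covAlong Γ F Y c) p d
      + Γ (F p) (fderiv ℝ F p d) (fderiv ℝ Y p c + Γ (F p) (fderiv ℝ F p c) (Y p)) :=
    fun _ _ => rfl
  rw [unf, unf, key, key, hsymm hF, hsymm hY, christoffelCurv]
  simp only [map_add]
  abel

end IsLocalModel

end LocalModel

/-! ### Symmetries of the curvature and the second variation of the speed -/

section SecondVariation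

variable {Q : Type*} [NormedAddCommGroup Q] [NormedSpace ℝ Q]

lemma fderiv_fderiv_comm {W : Type*} [NormedAddCommGroup W] [NormedSpace ℝ W] {φ : Q → W} {p : Q}
    (hφ : ContDiffAt ℝ ∞ φ p) (a b : Q) :
    fderiv ℝ (fun p => fderiv ℝ φ p b) p a = fderiv ℝ (fun p => fderiv ℝ φ p a) p b := by
  have hd : DifferentiableAt ℝ (fderiv ℝ φ) p :=
    (hφ.fderiv_right (m := 1) (by exact WithTop.coe_le_coe.2 le_top)).differentiableAt (by simp)
  have hsymm : fderiv ℝ (fderiv ℝ φ) p a b = fderiv ℝ (fderiv ℝ φ) p b a :=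
    (hφ.isSymmSndFDerivAt (by
      simp only [minSmoothness_of_isRCLikeNormedField]; exact WithTop.coe_le_coe.2 le_top)).eq a b
  have h1 : ∀ c d, fderiv ℝ (fun p => fderiv ℝ φ p c) p d = fderiv ℝ (fderiv ℝ φ) p d c := by
    intro c d
    rw [(hd.hasFDerivAt.clm_apply (hasFDerivAt_const c p)).fderiv]
    simp
  rw [h1, h1, hsymm]

lemma eventually_differentiableAt {W : Type*} [NormedAddCommGroup W] [NormedSpace ℝ W] {φ : Q → W}
    {p : Q} (hφ : ContDiffAt ℝ ∞ φ p) : ∀ᶠ p' in 𝓝 p, DifferentiableAt ℝ φ p' := by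
  filter_upwards [(hφ.of_le (m := 1) (by exact WithTop.coe_le_coe.2 le_top)).eventually (by simp)]
    with p' hp'
  exact hp'.differentiableAt (by simp)

/-- A multilinear form with the algebraic symmetries of a curvature tensor is symmetric under the
exchange of pairs. -/
lemma curvature_pair_symm {α : Type*} {K : α → α → α → α → ℝ} (h1 : ∀ a b c d, K a b c d = -K b a c d)
    (h2 : ∀ a b c d, K a b c d = -K a b d c)
    (h3 : ∀ a b c d, K a b c d + K b c a d + K c a b d = 0) (a b c d : α) :
    K a b c d = K c d a b := by
  -- A signed combination of the four cyclic identities; the two skew-symmetries cancel all terms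
  -- except those being compared.
  linarith [h3 a b c d, h3 b c d a, h3 c d a b, h3 d a b c, h1 a b c d, h2 a b c d, h1 b c a d,
    h2 b c a d, h1 c a b d, h2 c a b d, h1 b c d a, h2 b c d a, h1 c d b a, h2 c d b a,
    h1 d b c a, h2 d b c a, h1 c d a b, h2 c d a b, h1 d a c b, h2 d a c b, h1 a c d b, h2 a c d b,
    h1 d a b c, h2 d a b c, h1 a b d c, h2 a b d c, h1 b d a c, h2 b d a c]

lemma contDiffAt_bilin_comp {X U₁ U₂ W : Type*} [NormedAddCommGroup X] [NormedSpace ℝ X]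
    [NormedAddCommGroup U₁] [NormedSpace ℝ U₁] [NormedAddCommGroup U₂] [NormedSpace ℝ U₂]
    [NormedAddCommGroup W] [NormedSpace ℝ W]
    {A : X → U₁ →L[ℝ] U₂ →L[ℝ] W} {F : Q → X} {Y : Q → U₁} {Z : Q → U₂} {p : Q} {m : WithTop ℕ∞}
    (hA : ContDiffAt ℝ m A (F p)) (hF : ContDiffAt ℝ m F p)
    (hY : ContDiffAt ℝ m Y p) (hZ : ContDiffAt ℝ m Z p) :
    ContDiffAt ℝ m (fun p => A (F p) (Y p) (Z p)) p :=
  ((hA.comp p hF).clm_apply hY).clm_apply hZ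

/-- The integrand of the index form in a local model, for `v` the velocity of the geodesic,
`x, y` two vector fields along it and `x', y'` their covariant derivatives. -/
def indexDensity (Γ : E → E →L[ℝ] E →L[ℝ] E) (G B : E → E →L[ℝ] E →L[ℝ] ℝ) (T : E → E)
    (z v x x' y y' : E) : ℝ :=
  -- The signs differ from those of `indexIntegrand` because `B` is `dθ = -Ω`; the form `θ` is
  -- written as `G z (T z)`.
  G z x' y' - G z (christoffelCurv Γ z x v v) y + 2 * B z x v * G z (T z) y'
    + 2 * (G z (T z) x' + 2 * B z x v) * B z y v

namespace IsLocalModel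

variable {V : Set E} {Γ : E → E →L[ℝ] E →L[ℝ] E} {G B : E → E →L[ℝ] E →L[ℝ] ℝ} {T : E → E}
  {F Y Z : Q → E} {p : Q} {z : E}

lemma contDiffAt_G (h : IsLocalModel V Γ G B T) (hz : z ∈ V) : ContDiffAt ℝ ∞ G z :=
  h.smooth_G.contDiffAt (h.isOpen.mem_nhds hz)

lemma covAlong_congr (h : Y =ᶠ[𝓝 p] Z) (d : Q) : covAlong Γ F Y d p = covAlong Γ F Z d p := by
  unfold covAlong
  rw [h.fderiv_eq, h.eq_of_nhds]

lemma eventually_mem (h : IsLocalModel V Γ G B T) (hp : F p ∈ V) (hF : ContDiffAt ℝ ∞ F p) :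
    ∀ᶠ p' in 𝓝 p, F p' ∈ V ∧ ContDiffAt ℝ 2 F p' :=
  (hF.continuousAt.eventually (h.isOpen.mem_nhds hp)).and
    ((hF.of_le (by exact WithTop.coe_le_coe.2 le_top)).eventually (by simp))

lemma fderiv_fderiv_G_comp (h : IsLocalModel V Γ G B T) (hp : F p ∈ V) (hF : ContDiffAt ℝ ∞ F p)
    (hY : ContDiffAt ℝ ∞ Y p) (hZ : ContDiffAt ℝ ∞ Z p) (a b : Q) :
    fderiv ℝ (fun p => fderiv ℝ (fun p => G (F p) (Y p) (Z p)) p b) p a =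
      G (F p) (covAlong Γ F (covAlong Γ F Y b) a p) (Z p)
      + G (F p) (covAlong Γ F Y b p) (covAlong Γ F Z a p)
      + (G (F p) (covAlong Γ F Y a p) (covAlong Γ F Z b p)
      + G (F p) (Y p) (covAlong Γ F (covAlong Γ F Z b) a p)) := by
  have hev : (fun p => fderiv ℝ (fun p => G (F p) (Y p) (Z p)) p b) =ᶠ[𝓝 p]
      fun p => G (F p) (covAlong Γ F Y b p) (Z p) + G (F p) (Y p) (covAlong Γ F Z b p) := by
    filter_upwards [h.eventually_mem hp hF, eventually_differentiableAt hY,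
      eventually_differentiableAt hZ] with p' hp' hY' hZ'
    exact h.fderiv_G_comp hp'.1 (hp'.2.differentiableAt (by simp)) hY' hZ' b
  have dF := hF.differentiableAt (by simp : (∞ : WithTop ℕ∞) ≠ 0)
  have dY := hY.differentiableAt (by simp : (∞ : WithTop ℕ∞) ≠ 0)
  have dZ := hZ.differentiableAt (by simp : (∞ : WithTop ℕ∞) ≠ 0)
  have dYb := (h.contDiffAt_covAlong hp hF hY b).differentiableAt (by simp)
  have dZb := (h.contDiffAt_covAlong hp hF hZ b).differentiableAt (by simp)
  rw [hev.fderiv_eq, fderiv_fun_add (h.differentiableAt_G_comp hp dF dYb dZ)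
    (h.differentiableAt_G_comp hp dF dY dZb), add_apply, h.fderiv_G_comp hp dF dYb dZ,
    h.fderiv_G_comp hp dF dY dZb]

/-- Apply both orders of differentiation to the function `G(w, x)` with constant `w` and `x`; `G`
being parallel, their equality says that `R(u, v)` is skew. -/
lemma curv_skew (h : IsLocalModel V Γ G B T) (hz : z ∈ V) (u v w x : E) :
    G z (christoffelCurv Γ z u v w) x = - G z (christoffelCurv Γ z u v x) w := by
  have hF : ContDiffAt ℝ ∞ (id : E → E) z := contDiffAt_id
  have hY : ContDiffAt ℝ ∞ (fun _ : E => w) z := contDiffAt_const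
  have hZ : ContDiffAt ℝ ∞ (fun _ : E => x) z := contDiffAt_const
  have hc := fderiv_fderiv_comm (contDiffAt_bilin_comp (h.contDiffAt_G hz) hF hY hZ) u v
  have e1 := h.fderiv_fderiv_G_comp (F := id) hz hF hY hZ u v
  have e2 := h.fderiv_fderiv_G_comp (F := id) hz hF hY hZ v u
  rw [e1, e2, h.covAlong_curv (F := id) hz hF hY u v, h.covAlong_curv (F := id) hz hF hZ u v,
    fderiv_id] at hc
  simp only [id, map_add, add_apply, ContinuousLinearMap.coe_id'] at hc
  rw [h.G_symm z hz (christoffelCurv Γ z u v x) w]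
  linarith

lemma curv_swap (u v w : E) : christoffelCurv Γ z u v w = - christoffelCurv Γ z v u w := by
  simp only [christoffelCurv]; abel

/-- For constant fields `R(u, v)w = ∇_u ∇_v w - ∇_v ∇_u w`. Regrouping the cyclic sum turns it into
derivatives of the torsion, which are multiples of `T` with coefficients in `B`; these add up to
zero. -/
lemma curv_bianchi (h : IsLocalModel V Γ G B T) (hz : z ∈ V) (u v w : E) :
    christoffelCurv Γ z u v w + christoffelCurv Γ z v w u + christoffelCurv Γ z w u v = 0 := by
  have hF : ContDiffAt ℝ ∞ (id : E → E) z := contDiffAt_id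
  have hY : ∀ w : E, ContDiffAt ℝ ∞ (fun _ : E => w) z := fun w => contDiffAt_const
  have hcov : ∀ u v : E, covAlong Γ id (fun _ => v) u = fun z => Γ z u v := by
    intro u v; funext z'; simp [covAlong]
  -- Exchanging the inner pair costs `∇_u (2 B(v, w) T)`. Since `T` is parallel only the scalar is
  -- differentiated, and since `B` is parallel its derivative contains Christoffel symbols alone.
  have tor : ∀ u v w : E, covAlong Γ id (covAlong Γ id (fun _ => w) v) u z =
      covAlong Γ id (covAlong Γ id (fun _ => v) w) u z +
        (2 * (B z (Γ z u v) w + B z v (Γ z u w))) • T z := by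
    intro u v w
    have hev : covAlong Γ id (fun _ => w) v =ᶠ[𝓝 z]
        fun z => (2 * B z v w) • T z + covAlong Γ id (fun _ => v) w z := by
      filter_upwards [h.isOpen.mem_nhds hz] with z' hz'
      rw [hcov, hcov]
      simp only
      rw [← h.torsion z' hz' v w]; abel
    have hB := hasFDerivAt_bilin_comp (A := B) (F := (id : E → E)) (Y := fun _ : E => v)
      (Z := fun _ : E => w) (p := z) (h.diff_B hz) differentiableAt_id
      (differentiableAt_const _) (differentiableAt_const _)
    have hBd : fderiv ℝ (fun z => 2 * B z v w) z u = 2 * (B z (Γ z u v) w + B z v (Γ z u w)) := by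
      have h1 := (hB.1.hasFDerivAt.const_mul 2).fderiv
      have h2 := hB.2 u
      simp only [id, fderiv_id, ContinuousLinearMap.coe_id', h.parallel_B z hz,
        fderiv_const_apply, zero_apply, map_zero, add_zero] at h1 h2
      rw [h1, smul_apply, h2, smul_eq_mul]
    have dBT : DifferentiableAt ℝ (fun z => 2 * B z v w) z := hB.1.const_mul 2
    have dBT' : DifferentiableAt ℝ (fun z => (2 * B z v w) • T z) z := dBT.smul (h.diff_T hz)
    have e1 : covAlong Γ id (covAlong Γ id (fun _ => w) v) u z =
        covAlong Γ id (fun z => (2 * B z v w) • T z + covAlong Γ id (fun _ => v) w z) u z := by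
      exact covAlong_congr hev u
    rw [e1, covAlong_add ((h.contDiffAt_covAlong hz hF (hY v) w).differentiableAt (by simp))
      dBT', covAlong_smul dBT (h.diff_T hz),
      show covAlong Γ id T u z = 0 from h.covAlong_T (F := id) hz differentiableAt_id u, hBd, smul_zero, zero_add, add_comm]
  have cur : ∀ u v w : E, christoffelCurv Γ z u v w =
      covAlong Γ id (covAlong Γ id (fun _ => w) v) u z -
      covAlong Γ id (covAlong Γ id (fun _ => w) u) v z := by
    intro u v w
    rw [h.covAlong_curv (F := id) hz hF (hY w) u v]
    simp
  -- `Γ` is symmetric modulo `T`, which `B` annihilates. With skewness of `B`, the six terms of the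
  -- cyclic sum then cancel in pairs.
  have hBs : ∀ u v w : E, B z (Γ z u v) w = B z (Γ z v u) w := by
    intro u v w
    have := congrArg (fun x => B z x w) (h.torsion z hz u v)
    simp only [map_sub, sub_apply, map_smul, smul_apply, h.B_T z hz, smul_zero] at this
    linarith
  rw [cur, cur, cur, tor u v w, tor v w u, tor w u v]
  have hsum : (2 * (B z (Γ z u v) w + B z v (Γ z u w))) + (2 * (B z (Γ z v w) u + B z w (Γ z v u)))
      + (2 * (B z (Γ z w u) v + B z u (Γ z w v))) = 0 := by
    rw [h.B_swap z hz v, h.B_swap z hz w, h.B_swap z hz u, hBs u v w, hBs v w u, hBs w u v]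
    ring
  have := congrArg (fun c : ℝ => c • T z) hsum
  simp only [add_smul, zero_smul] at this
  rw [← this]
  abel

lemma curv_pair (h : IsLocalModel V Γ G B T) (hz : z ∈ V) (u v w x : E) :
    G z (christoffelCurv Γ z u v w) x = G z (christoffelCurv Γ z w x u) v := by
  refine curvature_pair_symm (K := fun u v w x => G z (christoffelCurv Γ z u v w) x) ?_ ?_ ?_ u v w x
  · intro a b c d; rw [curv_swap]; simp
  · intro a b c d; exact h.curv_skew hz a b c d
  · intro a b c d
    have := congrArg (fun y => G z y d) (h.curv_bianchi hz a b c)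
    simpa only [map_add, add_apply, map_zero, zero_apply] using this

/-- Pair symmetry followed by the two skew-symmetries. This makes the curvature term of the index
form symmetric, as polarization requires. -/
lemma curv_symm (h : IsLocalModel V Γ G B T) (hz : z ∈ V) (v x y : E) :
    G z (christoffelCurv Γ z x v v) y = G z (christoffelCurv Γ z y v v) x := by
  rw [h.curv_pair hz, h.curv_skew hz, curv_swap]
  simp

/-! ### Second variation of the squared speed and of the speed -/

lemma fderiv_speed (h : IsLocalModel V Γ G B T) (hp : F p ∈ V) (hF : ContDiffAt ℝ ∞ F p) (a b : Q) :
    fderiv ℝ (fun p => G (F p) (fderiv ℝ F p a) (fderiv ℝ F p a)) p b =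
      2 * G (F p) (covAlong Γ F (fun p => fderiv ℝ F p a) b p) (fderiv ℝ F p a) := by
  have dV := (contDiffAt_fderiv_apply hF a).differentiableAt (by simp)
  rw [h.fderiv_G_comp hp (hF.differentiableAt (by simp)) dV dV, h.G_symm _ hp (fderiv ℝ F p a)]
  ring

/-- Here `a` is the direction of the curve parameter and `b` that of the variation. Replace `∇_b V`
by `∇_a X` plus torsion, differentiate again in `b`, and exchange `∇_b ∇_a X` for `∇_a ∇_b X` plus
curvature. The geodesic equation makes the remaining term a total derivative in `a`. -/
lemma fderiv_fderiv_speed (h : IsLocalModel V Γ G B T) (hp : F p ∈ V) (hF : ContDiffAt ℝ ∞ F p)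
    (a b : Q) (hT : G (F p) (T (F p)) (fderiv ℝ F p a) = 0)
    (hgeo : covAlong Γ F (fun p => fderiv ℝ F p a) a p = 0) {A : E}
    (hA : A = covAlong Γ F (fun p => fderiv ℝ F p b) a p
      + (2 * B (F p) (fderiv ℝ F p b) (fderiv ℝ F p a)) • T (F p)) :
    fderiv ℝ (fun p => fderiv ℝ (fun p => G (F p) (fderiv ℝ F p a) (fderiv ℝ F p a)) p b) p b =
      2 * (G (F p) A A
        + G (F p) (christoffelCurv Γ (F p) (fderiv ℝ F p b) (fderiv ℝ F p a) (fderiv ℝ F p b))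
            (fderiv ℝ F p a)
        + fderiv ℝ (fun p => G (F p) (covAlong Γ F (fun p => fderiv ℝ F p b) b p)
            (fderiv ℝ F p a)) p a) := by
  have sV := contDiffAt_fderiv_apply hF a
  have sX := contDiffAt_fderiv_apply hF b
  have dF := hF.differentiableAt (by simp : (∞ : WithTop ℕ∞) ≠ 0)
  have dV := sV.differentiableAt (by simp)
  have hcomm : covAlong Γ F (fun p => fderiv ℝ F p a) b =ᶠ[𝓝 p] fun p =>
      (2 * B (F p) (fderiv ℝ F p b) (fderiv ℝ F p a)) • T (F p)
      + covAlong Γ F (fun p => fderiv ℝ F p b) a p := by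
    filter_upwards [h.eventually_mem hp hF] with p' hp'
    rw [h.covAlong_comm hp'.1 hp'.2 b a, add_comm]
  have hVA : covAlong Γ F (fun p => fderiv ℝ F p a) b p = A := by
    rw [hcomm.eq_of_nhds, hA, add_comm]
  have dBq : DifferentiableAt ℝ (fun p => 2 * B (F p) (fderiv ℝ F p b) (fderiv ℝ F p a)) p :=
    (h.differentiableAt_B_comp hp dF (sX.differentiableAt (by simp)) dV).const_mul 2
  have dTF : DifferentiableAt ℝ (fun p => T (F p)) p :=
    ((h.diff_T hp).hasFDerivAt.comp p dF.hasFDerivAt).differentiableAt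
  have dBT : DifferentiableAt ℝ
      (fun p => (2 * B (F p) (fderiv ℝ F p b) (fderiv ℝ F p a)) • T (F p)) p := dBq.smul dTF
  -- `T` being parallel, the torsion term contributes only a multiple of `T`, which disappears when
  -- paired with `V` through `hT`.
  have hVV : covAlong Γ F (covAlong Γ F (fun p => fderiv ℝ F p a) b) b p =
      covAlong Γ F (covAlong Γ F (fun p => fderiv ℝ F p b) a) b p
      + fderiv ℝ (fun p => 2 * B (F p) (fderiv ℝ F p b) (fderiv ℝ F p a)) p b • T (F p) := by
    rw [covAlong_congr hcomm, covAlong_add ((h.contDiffAt_covAlong hp hF sX a).differentiableAt (by simp))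
      dBT, covAlong_smul dBq dTF, h.covAlong_T hp dF, smul_zero, zero_add, add_comm]
  have hda : fderiv ℝ (fun p => G (F p) (covAlong Γ F (fun p => fderiv ℝ F p b) b p)
      (fderiv ℝ F p a)) p a = G (F p) (covAlong Γ F (covAlong Γ F (fun p => fderiv ℝ F p b) b) a p)
        (fderiv ℝ F p a) := by
    rw [h.fderiv_G_comp hp dF ((h.contDiffAt_covAlong hp hF sX b).differentiableAt (by simp)) dV,
      hgeo, map_zero, add_zero]
  rw [h.fderiv_fderiv_G_comp hp hF sV sV b b, hVA, hVV, h.covAlong_curv hp hF sX b a, hda,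
    h.G_symm _ hp (fderiv ℝ F p a)]
  simp only [map_add, add_apply, map_smul, smul_apply, hT, smul_zero, add_zero]
  ring

-- Completing the square gives `|x' + 2 B(x, v) T|² = |x'|² + 4 B(x, v) G(T, x') + 4 B(x, v)²`,
-- which are the terms without curvature. Since `R(v, v) = 0`, `G(R(x, v)v, v) = 0`, `B(v, v) = 0`
-- and `G(T, v) = 0`, the tangential parts affect only `|x'|²`, lowering it by `G(x', v)²/r²`.
set_option synthInstance.maxHeartbeats 200000 in
lemma indexDensity_perp (h : IsLocalModel V Γ G B T) (hz : z ∈ V) (hTT : G z (T z) (T z) = 1)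
    {r : ℝ} (hr : 0 < r) {v x x' : E} (hv : G z v v = r ^ 2) (hT : G z (T z) v = 0) :
    indexDensity Γ G B T z v (x - (1 / r ^ 2 * G z x v) • v) (x' - (1 / r ^ 2 * G z x' v) • v)
        (x - (1 / r ^ 2 * G z x v) • v) (x' - (1 / r ^ 2 * G z x' v) • v) =
      G z (x' + (2 * B z x v) • T z) (x' + (2 * B z x v) • T z)
        + G z (christoffelCurv Γ z x v x) v - (G z x' v) ^ 2 / r ^ 2 := by
  have hBv : B z v v = 0 := by have := h.B_swap z hz v v; linarith
  have hR0 : christoffelCurv Γ z v v v = 0 := by simp [christoffelCurv]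
  have hlin : ∀ c : ℝ, christoffelCurv Γ z (x - c • v) v v = christoffelCurv Γ z x v v := by
    intro c
    have : christoffelCurv Γ z (x - c • v) v v =
        christoffelCurv Γ z x v v - c • christoffelCurv Γ z v v v := by
      simp only [christoffelCurv, map_sub, map_smul, sub_apply, smul_apply, smul_sub, smul_add]
      abel
    rw [this, hR0, smul_zero, sub_zero]
  have hRv : G z (christoffelCurv Γ z x v v) v = 0 := by have := h.curv_skew hz x v v v; linarith
  have hRx := h.curv_skew hz x v v x
  rw [indexDensity, hlin]
  simp only [map_sub, map_smul, map_add, add_apply, sub_apply, smul_apply, smul_eq_mul, hRv, hRx,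
    hBv, hT, hv, hTT, h.G_symm z hz v x', h.G_symm z hz x' (T z)]
  field_simp
  ring

lemma contDiffAt_speed (h : IsLocalModel V Γ G B T) (hp : F p ∈ V) (hF : ContDiffAt ℝ ∞ F p)
    (a : Q) : ContDiffAt ℝ ∞ (fun p => G (F p) (fderiv ℝ F p a) (fderiv ℝ F p a)) p :=
  contDiffAt_bilin_comp (h.contDiffAt_G hp) hF (contDiffAt_fderiv_apply hF a)
    (contDiffAt_fderiv_apply hF a)

/-- The second variation of the speed of a lengthy geodesic. -/
lemma fderiv_fderiv_sqrt_speed (h : IsLocalModel V Γ G B T) (hp : F p ∈ V)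
    (hTT : G (F p) (T (F p)) (T (F p)) = 1) (hF : ContDiffAt ℝ ∞ F p) (a b : Q)
    {r : ℝ} (hr : 0 < r) (hq : G (F p) (fderiv ℝ F p a) (fderiv ℝ F p a) = r ^ 2)
    (hT : G (F p) (T (F p)) (fderiv ℝ F p a) = 0)
    (hgeo : covAlong Γ F (fun p => fderiv ℝ F p a) a p = 0) {v x x' : E}
    (hv : v = fderiv ℝ F p a) (hx : x = fderiv ℝ F p b)
    (hx' : x' = covAlong Γ F (fun p => fderiv ℝ F p b) a p) :
    fderiv ℝ (fun p => fderiv ℝ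
        (fun p => √(G (F p) (fderiv ℝ F p a) (fderiv ℝ F p a))) p b) p b =
      1 / r * (indexDensity Γ G B T (F p) v
          (x - (1 / r ^ 2 * G (F p) x v) • v) (x' - (1 / r ^ 2 * G (F p) x' v) • v)
          (x - (1 / r ^ 2 * G (F p) x v) • v) (x' - (1 / r ^ 2 * G (F p) x' v) • v)
        + fderiv ℝ (fun p => G (F p) (covAlong Γ F (fun p => fderiv ℝ F p b) b p)
            (fderiv ℝ F p a)) p a) := by
  set q : Q → ℝ := fun p => G (F p) (fderiv ℝ F p a) (fderiv ℝ F p a) with hqdef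
  have sq : ContDiffAt ℝ ∞ q p := h.contDiffAt_speed hp hF a
  have hqp : q p = r ^ 2 := hq
  have hq0 : q p ≠ 0 := by rw [hqp]; positivity
  have hsq : √(q p) = r := by rw [hqp]; exact Real.sqrt_sq hr.le
  have hev : (fun p => fderiv ℝ (fun p => √(q p)) p b) =ᶠ[𝓝 p]
      fun p => fderiv ℝ q p b * (2 * √(q p))⁻¹ := by
    filter_upwards [eventually_differentiableAt sq, sq.continuousAt.eventually_ne hq0] with p' hp' hq'
    rw [fderiv_sqrt hp' hq', smul_apply, smul_eq_mul]
    ring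
  have dq := sq.differentiableAt (by simp : (∞ : WithTop ℕ∞) ≠ 0)
  have dqb := (contDiffAt_fderiv_apply sq b).differentiableAt (by simp : (∞ : WithTop ℕ∞) ≠ 0)
  have hsd : HasFDerivAt (fun p => √(q p)) _ p := dq.hasFDerivAt.sqrt hq0
  have hinv : HasFDerivAt (fun p => (2 * √(q p))⁻¹) _ p :=
    (hasDerivAt_inv (by rw [hsq]; positivity : 2 * √(q p) ≠ 0)).comp_hasFDerivAt p
      (hsd.const_mul 2)
  have hmul := (dqb.hasFDerivAt.fun_mul hinv).fderiv
  -- The torsion part of `∇_b V` is a multiple of `T`, hence orthogonal to `V`.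
  have e1 : fderiv ℝ q p b = 2 * G (F p) x' v := by
    rw [h.fderiv_speed hp hF,
      h.covAlong_comm hp (hF.of_le (by exact WithTop.coe_le_coe.2 le_top)), ← hx', ← hv]
    simp [hv, hT]
  have e2 : fderiv ℝ (fun p => fderiv ℝ q p b) p b = _ := h.fderiv_fderiv_speed hp hF a b hT hgeo rfl
  rw [hev.fderiv_eq, hmul]
  simp only [add_apply, smul_apply, smul_eq_mul]
  rw [e1, e2, h.indexDensity_perp hp hTT hr (hv ▸ hq) (hv ▸ hT), hsq, ← hx', ← hv, ← hx]
  field_simp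
  ring

end IsLocalModel

end SecondVariation

/-! ### Differentiation of integrals over strips, and the length of a variation in a local model -/

section Strip

variable {c d δ : ℝ}

lemma uniqueDiffOn_strip (hcd : c < d) : UniqueDiffOn ℝ (Icc c d ×ˢ Ioo (-δ) δ : Set (ℝ × ℝ)) :=
  (uniqueDiffOn_Icc hcd).prod isOpen_Ioo.uniqueDiffOn

lemma strip_mem_nhds {t s : ℝ} (ht : t ∈ Ioo c d) (hs : s ∈ Ioo (-δ) δ) :
    (Icc c d ×ˢ Ioo (-δ) δ : Set (ℝ × ℝ)) ∈ 𝓝 (t, s) :=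
  prod_mem_nhds (Icc_mem_nhds ht.1 ht.2) (isOpen_Ioo.mem_nhds hs)

lemma eventually_mem_Ioo_symm (hδ : 0 < δ) : ∀ᶠ s in 𝓝 (0 : ℝ), s ∈ Ioo (-δ) δ :=
  Ioo_mem_nhds (neg_lt_zero.2 hδ) hδ

/-- Tube lemma around the compact slice `s = 0`: an open condition on the original curve persists on
a thinner strip. It is used for staying in a chart and for keeping the speed positive. -/
lemma exists_strip_subset {Y : Type*} [TopologicalSpace Y] (hδ : 0 < δ) {g : ℝ × ℝ → Y}
    (hg : ContinuousOn g (Icc c d ×ˢ Ioo (-δ) δ)) {U : Set Y} (hU : IsOpen U)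
    (h0 : ∀ t ∈ Icc c d, g (t, 0) ∈ U) :
    ∃ δ', 0 < δ' ∧ δ' ≤ δ ∧ ∀ p ∈ (Icc c d ×ˢ Ioo (-δ') δ' : Set (ℝ × ℝ)), g p ∈ U := by
  obtain ⟨W, hW, hWe⟩ := continuousOn_iff'.1 hg U hU
  have hsub : Icc c d ×ˢ ({0} : Set ℝ) ⊆ W := by
    rintro ⟨t, s⟩ ⟨ht, hs⟩
    obtain rfl : s = 0 := hs
    have : (t, (0 : ℝ)) ∈ g ⁻¹' U ∩ Icc c d ×ˢ Ioo (-δ) δ :=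
      ⟨h0 t ht, ht, neg_lt_zero.2 hδ, hδ⟩
    rw [hWe] at this
    exact this.1
  obtain ⟨u, v, -, hv, hu, hv0, huv⟩ := generalized_tube_lemma isCompact_Icc isCompact_singleton hW hsub
  obtain ⟨η, hη, hball⟩ := Metric.isOpen_iff.1 hv 0 (hv0 rfl)
  refine ⟨min η δ, lt_min hη hδ, min_le_right _ _, ?_⟩
  rintro ⟨t, s⟩ ⟨ht, hs⟩
  have hsη : s ∈ Ioo (-η) η :=
    ⟨(neg_le_neg (min_le_left _ _)).trans_lt hs.1, hs.2.trans_le (min_le_left _ _)⟩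
  have hsδ : s ∈ Ioo (-δ) δ :=
    ⟨(neg_le_neg (min_le_right _ _)).trans_lt hs.1, hs.2.trans_le (min_le_right _ _)⟩
  have hsv : s ∈ v := hball (by rw [Real.ball_eq_Ioo]; simpa using hsη)
  have : (t, s) ∈ W ∩ Icc c d ×ˢ Ioo (-δ) δ := ⟨huv ⟨hu ht, hsv⟩, ht, hsδ⟩
  rw [← hWe] at this
  exact this.1

lemma continuousOn_slice {Y : Type*} [TopologicalSpace Y] {g : ℝ × ℝ → Y}
    (hg : ContinuousOn g (Icc c d ×ˢ Ioo (-δ) δ)) {s : ℝ} (hs : s ∈ Ioo (-δ) δ) :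
    ContinuousOn (fun t => g (t, s)) (Icc c d) :=
  hg.comp (by fun_prop) fun _ ht => ⟨ht, hs⟩

lemma intervalIntegrable_slice (hcd : c < d) {g : ℝ × ℝ → ℝ}
    (hg : ContinuousOn g (Icc c d ×ˢ Ioo (-δ) δ)) {s : ℝ} (hs : s ∈ Ioo (-δ) δ) :
    IntervalIntegrable (fun t => g (t, s)) volume c d :=
  (continuousOn_slice hg hs).intervalIntegrable_of_Icc hcd.le

lemma hasDerivAt_slice {W : Type*} [NormedAddCommGroup W] [NormedSpace ℝ W] {φ : ℝ × ℝ → W}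
    {t s : ℝ} (hφ : DifferentiableWithinAt ℝ φ (Icc c d ×ˢ Ioo (-δ) δ) (t, s))
    (ht : t ∈ Icc c d) (hs : s ∈ Ioo (-δ) δ) :
    HasDerivAt (fun s => φ (t, s)) (fderivWithin ℝ φ (Icc c d ×ˢ Ioo (-δ) δ) (t, s) (0, 1)) s := by
  have h1 : HasDerivWithinAt (fun s : ℝ => (t, s)) ((0 : ℝ), (1 : ℝ)) (Ioo (-δ) δ) s :=
    ((hasDerivAt_const s t).prodMk (hasDerivAt_id s)).hasDerivWithinAt
  exact (hφ.hasFDerivWithinAt.comp_hasDerivWithinAt s h1 fun _ hs' => ⟨ht, hs'⟩).hasDerivAt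
    (isOpen_Ioo.mem_nhds hs)

lemma hasDerivWithinAt_slice {W : Type*} [NormedAddCommGroup W] [NormedSpace ℝ W] {φ : ℝ × ℝ → W}
    {t s : ℝ} (hφ : DifferentiableWithinAt ℝ φ (Icc c d ×ˢ Ioo (-δ) δ) (t, s))
    (hs : s ∈ Ioo (-δ) δ) :
    HasDerivWithinAt (fun t => φ (t, s)) (fderivWithin ℝ φ (Icc c d ×ˢ Ioo (-δ) δ) (t, s) (1, 0))
      (Icc c d) t := by
  have h1 : HasDerivWithinAt (fun t : ℝ => (t, s)) ((1 : ℝ), (0 : ℝ)) (Icc c d) t :=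
    ((hasDerivAt_id t).prodMk (hasDerivAt_const t s)).hasDerivWithinAt
  exact hφ.hasFDerivWithinAt.comp_hasDerivWithinAt t h1 (t := Icc c d ×ˢ Ioo (-δ) δ)
    fun _ ht' => mk_mem_prod ht' hs

lemma ContDiffOn.fderivWithin_apply_strip {W : Type*} [NormedAddCommGroup W] [NormedSpace ℝ W]
    (hcd : c < d) {φ : ℝ × ℝ → W} (hφ : ContDiffOn ℝ ∞ φ (Icc c d ×ˢ Ioo (-δ) δ)) (v : ℝ × ℝ) :
    ContDiffOn ℝ ∞ (fun p => fderivWithin ℝ φ (Icc c d ×ˢ Ioo (-δ) δ) p v)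
      (Icc c d ×ˢ Ioo (-δ) δ) :=
  (hφ.fderivWithin (m := ∞) (uniqueDiffOn_strip hcd) (by simp)).clm_apply contDiffOn_const

/-- The `s`-derivative is continuous up to the edges `t = c, d`, hence bounded on a compact
substrip, and a constant dominates it. -/
lemma hasDerivAt_integral_slice (hcd : c < d) {φ : ℝ × ℝ → ℝ}
    (hφ : ContDiffOn ℝ ∞ φ (Icc c d ×ˢ Ioo (-δ) δ)) {s : ℝ} (hs : s ∈ Ioo (-δ) δ) :
    HasDerivAt (fun s => ∫ t in c..d, φ (t, s))
      (∫ t in c..d, fderivWithin ℝ φ (Icc c d ×ˢ Ioo (-δ) δ) (t, s) (0, 1)) s := by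
  have hφ' : ContinuousOn (fun p => fderivWithin ℝ φ (Icc c d ×ˢ Ioo (-δ) δ) p (0, 1))
      (Icc c d ×ˢ Ioo (-δ) δ) := (ContDiffOn.fderivWithin_apply_strip hcd hφ _).continuousOn
  obtain ⟨η, hη, hball⟩ := Metric.nhds_basis_closedBall.mem_iff.1 (isOpen_Ioo.mem_nhds hs)
  have hcomp : IsCompact (Icc c d ×ˢ Metric.closedBall s η) :=
    isCompact_Icc.prod (isCompact_closedBall s η)
  obtain ⟨C, hC⟩ := hcomp.exists_bound_of_continuousOn (hφ'.mono (prod_mono_right hball))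
  have hIoc : uIoc c d ⊆ Icc c d := by rw [uIoc_of_le hcd.le]; exact Ioc_subset_Icc_self
  refine (intervalIntegral.hasDerivAt_integral_of_dominated_loc_of_deriv_le (𝕜 := ℝ)
    (F := fun s t => φ (t, s))
    (F' := fun s t => fderivWithin ℝ φ (Icc c d ×ˢ Ioo (-δ) δ) (t, s) (0, 1))
    (bound := fun _ => C) (Metric.closedBall_mem_nhds s hη) ?_ ?_ ?_ ?_ ?_ ?_).2
  · filter_upwards [isOpen_Ioo.mem_nhds hs] with s' hs'
    exact ((continuousOn_slice hφ.continuousOn hs').mono hIoc).aestronglyMeasurable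
      measurableSet_uIoc
  · exact intervalIntegrable_slice hcd hφ.continuousOn hs
  · exact ((continuousOn_slice hφ' hs).mono hIoc).aestronglyMeasurable measurableSet_uIoc
  · exact Eventually.of_forall fun t ht s' hs' => hC (t, s') ⟨hIoc ht, hs'⟩
  · exact intervalIntegrable_const
  · refine Eventually.of_forall fun t ht s' hs' => ?_
    exact hasDerivAt_slice ((hφ.differentiableOn (by simp)) _ ⟨hIoc ht, hball hs'⟩) (hIoc ht)
      (hball hs')

end Strip

/-- The integrand of the index form on the components orthogonal to `v`. -/
def perpDensity (Γ : E → E →L[ℝ] E →L[ℝ] E) (G B : E → E →L[ℝ] E →L[ℝ] ℝ) (T : E → E) (r : ℝ)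
    (z v x x' y y' : E) : ℝ :=
  indexDensity Γ G B T z v (x - (1 / r ^ 2 * G z x v) • v) (x' - (1 / r ^ 2 * G z x' v) • v)
    (y - (1 / r ^ 2 * G z y v) • v) (y' - (1 / r ^ 2 * G z y' v) • v)

/-- The boundary term `g(∇_s ∂_s f, ∂_t f)` of the second variation of the length, in a local model:
`A` is the second derivative in `s`, and `x`, `v` are the first derivatives in `s`, `t`. -/
def boundaryTerm (Γ : E → E →L[ℝ] E →L[ℝ] E) (G : E → E →L[ℝ] E →L[ℝ] ℝ) (z A x v : E) : ℝ :=
  G z (A + Γ z x x) v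

lemma contDiffOn_bilin_comp {Q X U₁ U₂ W : Type*} [NormedAddCommGroup Q] [NormedSpace ℝ Q]
    [NormedAddCommGroup X] [NormedSpace ℝ X]
    [NormedAddCommGroup U₁] [NormedSpace ℝ U₁] [NormedAddCommGroup U₂] [NormedSpace ℝ U₂]
    [NormedAddCommGroup W] [NormedSpace ℝ W]
    {A : X → U₁ →L[ℝ] U₂ →L[ℝ] W} {F : Q → X} {Y : Q → U₁} {Z : Q → U₂} {V : Set X} {K : Set Q}
    {m : WithTop ℕ∞} (hA : ContDiffOn ℝ m A V) (hF : ContDiffOn ℝ m F K) (hFV : MapsTo F K V)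
    (hY : ContDiffOn ℝ m Y K) (hZ : ContDiffOn ℝ m Z K) :
    ContDiffOn ℝ m (fun p => A (F p) (Y p) (Z p)) K :=
  ((hA.comp hF hFV).clm_apply hY).clm_apply hZ

/-- The length of the curves of a variation of a lengthy geodesic in a local model is twice
differentiable, with the expected second derivative. -/
lemma IsLocalModel.hasDerivAt_length {V : Set E} {Γ : E → E →L[ℝ] E →L[ℝ] E}
    {G B : E → E →L[ℝ] E →L[ℝ] ℝ} {T : E → E} (h : IsLocalModel V Γ G B T)
    (hTT : ∀ z ∈ V, G z (T z) (T z) = 1) {c d δ : ℝ} (hcd : c < d) (hδ : 0 < δ) {F : ℝ × ℝ → E}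
    (hF : ContDiffOn ℝ ∞ F (Icc c d ×ˢ Ioo (-δ) δ)) (hFV : MapsTo F (Icc c d ×ˢ Ioo (-δ) δ) V)
    {r : ℝ} (hr : 0 < r)
    (hq : ∀ t ∈ Ioo c d,
      G (F (t, 0)) (fderiv ℝ F (t, 0) (1, 0)) (fderiv ℝ F (t, 0) (1, 0)) = r ^ 2)
    (hT : ∀ t ∈ Ioo c d, G (F (t, 0)) (T (F (t, 0))) (fderiv ℝ F (t, 0) (1, 0)) = 0)
    (hgeo : ∀ t ∈ Ioo c d, covAlong Γ F (fun p => fderiv ℝ F p (1, 0)) (1, 0) (t, 0) = 0)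
    {dens H : ℝ → ℝ}
    (hdens : ∀ t ∈ Ioo c d, dens t = perpDensity Γ G B T r (F (t, 0)) (fderiv ℝ F (t, 0) (1, 0))
      (fderiv ℝ F (t, 0) (0, 1)) (covAlong Γ F (fun p => fderiv ℝ F p (0, 1)) (1, 0) (t, 0))
      (fderiv ℝ F (t, 0) (0, 1)) (covAlong Γ F (fun p => fderiv ℝ F p (0, 1)) (1, 0) (t, 0)))
    (hH : ∀ t ∈ Icc c d, H t = boundaryTerm Γ G (F (t, 0))
      (fderivWithin ℝ (fun p => fderivWithin ℝ F (Icc c d ×ˢ Ioo (-δ) δ) p (0, 1))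
        (Icc c d ×ˢ Ioo (-δ) δ) (t, 0) (0, 1))
      (fderivWithin ℝ F (Icc c d ×ˢ Ioo (-δ) δ) (t, 0) (0, 1))
      (fderivWithin ℝ F (Icc c d ×ˢ Ioo (-δ) δ) (t, 0) (1, 0)))
    {ℓ : ℝ → ℝ → ℝ}
    (hℓ : ∀ t ∈ Ioo c d, ∀ s ∈ Ioo (-δ) δ, ℓ s t =
      √(G (F (t, s)) (fderiv ℝ F (t, s) (1, 0)) (fderiv ℝ F (t, s) (1, 0)))) :
    (∀ᶠ s in 𝓝 0, IntervalIntegrable (ℓ s) volume c d) ∧ IntervalIntegrable dens volume c d ∧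
    ∃ L' : ℝ → ℝ, (∀ᶠ s in 𝓝 0, HasDerivAt (fun s => ∫ t in c..d, ℓ s t) (L' s) s) ∧
      HasDerivAt L' (1 / r * ((∫ t in c..d, dens t) + H d - H c)) 0 := by
  set K : Set (ℝ × ℝ) := Icc c d ×ˢ Ioo (-δ) δ with hK
  have sV := ContDiffOn.fderivWithin_apply_strip hcd hF (1, 0)
  have sX := ContDiffOn.fderivWithin_apply_strip hcd hF (0, 1)
  have sXX := ContDiffOn.fderivWithin_apply_strip hcd sX (0, 1)
  set q : ℝ × ℝ → ℝ := fun p => G (F p) (fderivWithin ℝ F K p (1, 0)) (fderivWithin ℝ F K p (1, 0))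
    with hqdef
  have sq : ContDiffOn ℝ ∞ q K := contDiffOn_bilin_comp h.smooth_G hF hFV sV sV
  have hint : ∀ p ∈ Ioo c d ×ˢ Ioo (-δ) δ, K ∈ 𝓝 p := fun p hp => strip_mem_nhds hp.1 hp.2
  have hopen : IsOpen (Ioo c d ×ˢ Ioo (-δ) δ) := isOpen_Ioo.prod isOpen_Ioo
  have hfd : ∀ {W : Type _} [NormedAddCommGroup W] [NormedSpace ℝ W] (φ : ℝ × ℝ → W),
      ∀ p ∈ Ioo c d ×ˢ Ioo (-δ) δ, fderivWithin ℝ φ K p = fderiv ℝ φ p :=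
    fun φ p hp => fderivWithin_of_mem_nhds (hint p hp)
  have h0 : (0 : ℝ) ∈ Ioo (-δ) δ := ⟨neg_lt_zero.2 hδ, hδ⟩
  -- The speed is known on the open interval only; continuity extends it to the ends, which the tube
  -- lemma needs.
  have hq0 : ∀ t ∈ Icc c d, q (t, 0) = r ^ 2 := by
    have hcl : closure (Ioo c d) = Icc c d := closure_Ioo hcd.ne
    have hcont := continuousOn_slice sq.continuousOn h0
    have hEq : EqOn (fun t => q (t, 0)) (fun _ => r ^ 2) (Ioo c d) := by
      intro t ht
      simp only [hqdef]
      rw [hfd F (t, 0) ⟨ht, h0⟩, hq t ht]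
    have := hEq.of_subset_closure hcont continuousOn_const Ioo_subset_Icc_self hcl.ge
    exact fun t ht => this ht
  obtain ⟨δ', hδ', hδδ', hpos⟩ := exists_strip_subset hδ sq.continuousOn isOpen_Ioi
    (U := Ioi (0 : ℝ)) (fun t ht => by rw [hq0 t ht]; exact mem_Ioi.2 (by positivity))
  have hIoo : Ioo (-δ') δ' ⊆ Ioo (-δ) δ := Ioo_subset_Ioo (neg_le_neg hδδ') hδδ'
  have hsub : Icc c d ×ˢ Ioo (-δ') δ' ⊆ K := prod_mono_right hIoo
  set φ : ℝ × ℝ → ℝ := fun p => √(q p) with hφdef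
  have sφ : ContDiffOn ℝ ∞ φ (Icc c d ×ˢ Ioo (-δ') δ') :=
    (sq.mono hsub).sqrt fun p hp => (hpos p hp).ne'
  have sφb := ContDiffOn.fderivWithin_apply_strip hcd sφ (0, 1)
  have sφbb := ContDiffOn.fderivWithin_apply_strip hcd sφb (0, 1)
  have h0' : (0 : ℝ) ∈ Ioo (-δ') δ' := ⟨neg_lt_zero.2 hδ', hδ'⟩
  have hℓφ : ∀ s ∈ Ioo (-δ') δ', EqOn (fun t => φ (t, s)) (ℓ s) (Ioo c d) := by
    intro s hs t ht
    simp only [hφdef, hqdef]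
    rw [hfd F (t, s) ⟨ht, hIoo hs⟩, hℓ t ht s (hIoo hs)]
  have hLeq : ∀ s ∈ Ioo (-δ') δ', ∫ t in c..d, ℓ s t = ∫ t in c..d, φ (t, s) := fun s hs =>
    (intervalIntegral.integral_congr_Ioo_of_le hcd.le (hℓφ s hs)).symm
  have congrI : ∀ {f g : ℝ → ℝ}, EqOn f g (Ioo c d) → IntervalIntegrable f volume c d →
      IntervalIntegrable g volume c d := by
    intro f g hfg hf
    rw [intervalIntegrable_iff_integrableOn_Ioo_of_le hcd.le] at hf ⊢
    exact hf.congr_fun hfg measurableSet_Ioo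
  set Hw : ℝ × ℝ → ℝ := fun p => boundaryTerm Γ G (F p)
      (fderivWithin ℝ (fun p => fderivWithin ℝ F K p (0, 1)) K p (0, 1))
      (fderivWithin ℝ F K p (0, 1)) (fderivWithin ℝ F K p (1, 0)) with hHw
  have sHw : ContDiffOn ℝ ∞ Hw K := contDiffOn_bilin_comp h.smooth_G hF hFV
    (sXX.add (contDiffOn_bilin_comp h.smooth_Γ hF hFV sX sX)) sV
  have sHwt := ContDiffOn.fderivWithin_apply_strip hcd sHw (1, 0)
  -- In the interior all one-sided derivatives are ordinary ones, so the pointwise formula for the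
  -- second variation of the speed applies; the integrals see only the interior.
  have key : ∀ t ∈ Ioo c d, fderivWithin ℝ
      (fun p => fderivWithin ℝ φ (Icc c d ×ˢ Ioo (-δ') δ') p (0, 1))
        (Icc c d ×ˢ Ioo (-δ') δ') (t, 0) (0, 1) =
      1 / r * (dens t + fderivWithin ℝ Hw K (t, 0) (1, 0)) := by
    intro t ht
    have hp : (t, (0 : ℝ)) ∈ Ioo c d ×ˢ Ioo (-δ) δ := ⟨ht, h0⟩
    have hFp : ContDiffAt ℝ ∞ F (t, 0) := hF.contDiffAt (hint _ hp)
    have hnhds : Ioo c d ×ˢ Ioo (-δ') δ' ∈ 𝓝 (t, (0 : ℝ)) :=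
      (isOpen_Ioo.prod isOpen_Ioo).mem_nhds ⟨ht, h0'⟩
    have hVev : ∀ p ∈ Ioo c d ×ˢ Ioo (-δ) δ, q p =
        G (F p) (fderiv ℝ F p (1, 0)) (fderiv ℝ F p (1, 0)) := by
      intro p hp
      simp only [hqdef]
      rw [hfd F p hp]
    have e1 : (fun p => fderivWithin ℝ φ (Icc c d ×ˢ Ioo (-δ') δ') p (0, 1)) =ᶠ[𝓝 (t, (0 : ℝ))]
        fun p => fderiv ℝ (fun p => √(G (F p) (fderiv ℝ F p (1, 0)) (fderiv ℝ F p (1, 0)))) p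
          (0, 1) := by
      filter_upwards [hnhds] with p hp'
      rw [fderivWithin_of_mem_nhds (strip_mem_nhds hp'.1 hp'.2)]
      have : φ =ᶠ[𝓝 p] fun p => √(G (F p) (fderiv ℝ F p (1, 0)) (fderiv ℝ F p (1, 0))) := by
        filter_upwards [hopen.mem_nhds ⟨hp'.1, hIoo hp'.2⟩] with p'' hp''
        simp only [hφdef]
        rw [hVev p'' hp'']
      rw [this.fderiv_eq]
    have e2 : Hw =ᶠ[𝓝 (t, (0 : ℝ))] fun p =>
        G (F p) (covAlong Γ F (fun p => fderiv ℝ F p (0, 1)) (0, 1) p) (fderiv ℝ F p (1, 0)) := by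
      filter_upwards [hopen.mem_nhds hp] with p hp'
      have e3 : (fun p => fderivWithin ℝ F K p (0, 1)) =ᶠ[𝓝 p] fun p => fderiv ℝ F p (0, 1) := by
        filter_upwards [hopen.mem_nhds hp'] with p'' hp''
        rw [hfd F p'' hp'']
      simp only [hHw, boundaryTerm, covAlong]
      rw [hfd _ p hp', e3.fderiv_eq, hfd F p hp']
    rw [fderivWithin_of_mem_nhds (strip_mem_nhds ht h0'), e1.fderiv_eq,
      fderivWithin_of_mem_nhds (hint _ hp), e2.fderiv_eq, hdens t ht, perpDensity,
      h.fderiv_fderiv_sqrt_speed (hFV (mem_of_mem_nhds (hint _ hp)))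
        (hTT _ (hFV (mem_of_mem_nhds (hint _ hp)))) hFp (1, 0) (0, 1) hr (hq t ht) (hT t ht)
        (hgeo t ht) rfl rfl rfl]
  -- Integrability of the density comes from solving `key` for it: it agrees on the open interval
  -- with a combination of functions continuous on the closed one.
  have hdI : IntervalIntegrable dens volume c d := by
    have hI := (intervalIntegrable_slice hcd sφbb.continuousOn h0').const_mul r |>.sub
      (intervalIntegrable_slice hcd sHwt.continuousOn h0)
    refine congrI (fun t ht => ?_) hI
    rw [key t ht]
    field_simp
    ring
  refine ⟨?_, hdI, fun s => ∫ t in c..d, fderivWithin ℝ φ (Icc c d ×ˢ Ioo (-δ') δ') (t, s) (0, 1),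
    ?_, ?_⟩
  · filter_upwards [eventually_mem_Ioo_symm hδ'] with s hs
    exact congrI (hℓφ s hs) (intervalIntegrable_slice hcd sφ.continuousOn hs)
  · filter_upwards [eventually_mem_Ioo_symm hδ'] with s hs
    refine (hasDerivAt_integral_slice hcd sφ hs).congr_of_eventuallyEq ?_
    filter_upwards [isOpen_Ioo.mem_nhds hs] with s' hs'
    exact hLeq s' hs'
  · have h2 := hasDerivAt_integral_slice hcd sφb h0'
    refine h2.congr_deriv ?_
    rw [intervalIntegral.integral_congr_Ioo_of_le hcd.le key, intervalIntegral.integral_const_mul,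
      intervalIntegral.integral_add hdI (intervalIntegrable_slice hcd sHwt.continuousOn h0),
      hH d (right_mem_Icc.2 hcd.le), hH c (left_mem_Icc.2 hcd.le), add_sub_assoc]
    congr 2
    exact intervalIntegral.integral_eq_sub_of_hasDerivAt_of_le hcd.le
      (f := fun t => Hw (t, 0)) (continuousOn_slice sHw.continuousOn h0)
      (fun t ht => (hasDerivWithinAt_slice ((sHw.differentiableOn (by simp)) _
        ⟨Ioo_subset_Icc_self ht, h0⟩) h0).hasDerivAt (Icc_mem_nhds ht.1 ht.2))
      (intervalIntegrable_slice hcd sHwt.continuousOn h0)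

/-- A relation between end points which is additive and holds on all small intervals ending or
starting at a given point holds on the whole interval. -/
lemma interval_induction {a b : ℝ} (hab : a < b) {Q : ℝ → ℝ → Prop}
    (hadd : ∀ c m d, a ≤ c → c < m → m < d → d ≤ b → Q c m → Q m d → Q c d)
    (hloc : ∀ x ∈ Icc a b, ∃ η > 0, ∀ c d, a ≤ c → c < d → d ≤ b → x - η < c → d < x + η →
      c = x ∨ d = x → Q c d) : Q a b := by
  set S : Set ℝ := {t | t ∈ Icc a b ∧ (t = a ∨ Q a t)} with hS
  have haS : a ∈ S := ⟨left_mem_Icc.2 hab.le, Or.inl rfl⟩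
  have hbdd : BddAbove S := ⟨b, fun t ht => ht.1.2⟩
  set σ := sSup S with hσ
  have haσ : a ≤ σ := le_csSup hbdd haS
  have hσb : σ ≤ b := csSup_le ⟨a, haS⟩ fun t ht => ht.1.2
  obtain ⟨η, hη, hQ⟩ := hloc σ ⟨haσ, hσb⟩
  obtain ⟨t, htS, ht⟩ := exists_lt_of_lt_csSup ⟨a, haS⟩ (show σ - η < sSup S by linarith)
  have htσ : t ≤ σ := le_csSup hbdd htS
  have hσS : σ ∈ S := by
    rcases htσ.eq_or_lt with h | h
    · rwa [← h]
    · refine ⟨⟨haσ, hσb⟩, Or.inr ?_⟩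
      have h1 : Q t σ := hQ t σ htS.1.1 h hσb ht (by linarith) (Or.inr rfl)
      rcases htS.2 with h2 | h2
      · rwa [← h2]
      · rcases htS.1.1.eq_or_lt with h3 | h3
        · rwa [h3]
        · exact hadd a t σ le_rfl h3 h hσb h2 h1
  rcases hσb.eq_or_lt with h | h
  · rcases hσS.2 with h2 | h2
    · linarith
    · rwa [← h]
  · exfalso
    set u := min b (σ + η / 2) with hu
    have hσu : σ < u := lt_min h (by linarith)
    have hub : u ≤ b := min_le_left _ _
    have hu2 : u ≤ σ + η / 2 := min_le_right _ _
    have h1 : Q σ u := hQ σ u haσ hσu hub (by linarith) (by linarith) (Or.inl rfl)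
    have : u ∈ S := by
      refine ⟨⟨haσ.trans hσu.le, hub⟩, Or.inr ?_⟩
      rcases haσ.eq_or_lt with h3 | h3
      · rwa [h3]
      · rcases hσS.2 with h2 | h2
        · linarith
        · exact hadd a σ u le_rfl h3 hσu hub h2 h1
    linarith [le_csSup hbdd this]

/-! ### The index form in a chart -/

section CurveInChart

variable {P : PseudohermitianStructure E M}
  {D : CovariantDerivative 𝓘(ℝ, E) E (TangentSpace 𝓘(ℝ, E) : M → Type _)}
  {x₀ : M} {γ : ℝ → M} {t r : ℝ}

/-- The covariant derivative of a metric coefficient along a curve in a local model. -/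
lemma IsLocalModel.hasDerivAt_G {V : Set E} {Γ : E → E →L[ℝ] E →L[ℝ] E}
    {G B : E → E →L[ℝ] E →L[ℝ] ℝ} {T : E → E} (h : IsLocalModel V Γ G B T) {F X Y : ℝ → E}
    {F' X' Y' : E} (hp : F t ∈ V) (hF : HasDerivAt F F' t) (hX : HasDerivAt X X' t)
    (hY : HasDerivAt Y Y' t) : HasDerivAt (fun s => G (F s) (X s) (Y s))
      (G (F t) (X' + Γ (F t) F' (X t)) (Y t) + G (F t) (X t) (Y' + Γ (F t) F' (Y t))) t := by
  have h1 := (h.differentiableAt_G_comp hp hF.differentiableAt hX.differentiableAt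
    hY.differentiableAt).hasDerivAt
  rw [← fderiv_apply_one_eq_deriv, h.fderiv_G_comp hp hF.differentiableAt hX.differentiableAt
    hY.differentiableAt] at h1
  simpa only [covAlong, fderiv_apply_one_eq_deriv, hF.deriv, hX.deriv, hY.deriv] using h1

/-- The curve `γ`, which near `t` lies in the chart around `x₀`, has there velocity `c` with
derivative `c'` at `t`, and satisfies the geodesic equation at `t`. -/
structure GeodesicAt (D : CovariantDerivative 𝓘(ℝ, E) E (TangentSpace 𝓘(ℝ, E) : M → Type _))
    (x₀ : M) (γ : ℝ → M) (t : ℝ) (c : ℝ → E) (c' : E) : Prop where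
  mem_source : γ t ∈ (chartAt E x₀).source
  continuousAt : ∀ᶠ s in 𝓝 t, ContinuousAt γ s
  hasDerivAt : ∀ᶠ s in 𝓝 t, HasDerivAt (fun s => extChartAt 𝓘(ℝ, E) x₀ (γ s)) (c s) s
  hasDerivAt_velocity : HasDerivAt c c' t
  geodesic : covDerivAlong D γ (velocity γ) t = 0

namespace GeodesicAt

variable {c : ℝ → E} {c' : E}

lemma coordL_velocity_eventuallyEq (h : GeodesicAt D x₀ γ t c c') :
    ∀ᶠ s in 𝓝 t, γ s ∈ (chartAt E x₀).source ∧ coordL x₀ (γ s) (velocity γ s) = c s := by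
  filter_upwards [h.continuousAt, h.hasDerivAt, h.continuousAt.self_of_nhds.eventually
    ((chartAt E x₀).open_source.mem_nhds h.mem_source)] with s h1 h2 h3
  exact ⟨h3, coordL_velocity h3 h1 h2⟩

lemma equation (h : GeodesicAt D x₀ γ t c c') :
    c' + christoffel D x₀ (extChartAt 𝓘(ℝ, E) x₀ (γ t)) (c t) (c t) = 0 := by
  have h1 : HasDerivAt (fun s => coordL x₀ (γ s) (velocity γ s)) c' t :=
    h.hasDerivAt_velocity.congr_of_eventuallyEq
      (h.coordL_velocity_eventuallyEq.mono fun s hs => hs.2)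
  have h2 := coordL_covDerivAlong (D := D) h.mem_source h.continuousAt.self_of_nhds
    h.hasDerivAt.self_of_nhds h1
  rw [h.geodesic, map_zero, h.coordL_velocity_eventuallyEq.self_of_nhds.2] at h2
  exact h2.symm

lemma coordL_perp (h : GeodesicAt D x₀ γ t c c') (X : ∀ s, TangentSpace 𝓘(ℝ, E) (γ s)) :
    (fun s => coordL x₀ (γ s) (P.perp r γ X s)) =ᶠ[𝓝 t] fun s => coordL x₀ (γ s) (X s) -
      (1 / r ^ 2 * P.gC x₀ (extChartAt 𝓘(ℝ, E) x₀ (γ s)) (coordL x₀ (γ s) (X s)) (c s)) • c s := by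
  filter_upwards [h.coordL_velocity_eventuallyEq] with s hs
  rw [PseudohermitianStructure.perp, map_sub, map_smul, PseudohermitianStructure.g_chart hs.1, hs.2]

variable [T2Space M]

/-- The velocity and the metric are both parallel along `γ`, so projection orthogonal to the
velocity commutes with covariant differentiation. -/
lemma coordL_covDerivAlong_perp (hD : P.IsTanakaWebster D) (hS : P.IsSasakian D)
    (h : GeodesicAt D x₀ γ t c c')
    {X : ∀ s, TangentSpace 𝓘(ℝ, E) (γ s)} {X' : E}
    (hX : HasDerivAt (fun s => coordL x₀ (γ s) (X s)) X' t) {x' : E}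
    (hx' : x' = X' + christoffel D x₀ (extChartAt 𝓘(ℝ, E) x₀ (γ t)) (c t)
      (coordL x₀ (γ t) (X t))) :
    coordL x₀ (γ t) (covDerivAlong D γ (P.perp r γ X) t) =
      x' - (1 / r ^ 2 * P.gC x₀ (extChartAt 𝓘(ℝ, E) x₀ (γ t)) x' (c t)) • c t := by
  have hm := hD.isLocalModel hS x₀
  have hz := chart_mem_target (E := E) h.mem_source
  have h1 := (hm.hasDerivAt_G (F := fun s => extChartAt 𝓘(ℝ, E) x₀ (γ s)) hz
    h.hasDerivAt.self_of_nhds hX h.hasDerivAt_velocity).const_mul (1 / r ^ 2)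
  have h2 := (hX.sub (h1.smul h.hasDerivAt_velocity)).congr_of_eventuallyEq (h.coordL_perp X)
  have hX2 := (h.coordL_perp (P := P) (r := r) X).self_of_nhds
  simp only at hX2
  rw [coordL_covDerivAlong h.mem_source h.continuousAt.self_of_nhds h.hasDerivAt.self_of_nhds h2,
    hX2, h.equation, ← hx', map_zero, add_zero, map_sub, map_smul]
  have h3 := h.equation
  rw [hx']
  set g₀ := P.gC x₀ (extChartAt 𝓘(ℝ, E) x₀ (γ t))
  set Γ₀ := christoffel D x₀ (extChartAt 𝓘(ℝ, E) x₀ (γ t))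
  rw [eq_neg_of_add_eq_zero_left h3]
  simp only [smul_neg]
  abel

/-- The integrand of the index form in a chart. -/
lemma indexIntegrand_perp (hD : P.IsTanakaWebster D) (hS : P.IsSasakian D)
    (h : GeodesicAt D x₀ γ t c c')
    {X Y : ∀ s, TangentSpace 𝓘(ℝ, E) (γ s)} {X' Y' : E}
    (hX : HasDerivAt (fun s => coordL x₀ (γ s) (X s)) X' t)
    (hY : HasDerivAt (fun s => coordL x₀ (γ s) (Y s)) Y' t) :
    P.indexIntegrand D γ (P.perp r γ X) (P.perp r γ Y) t =
      perpDensity (christoffel D x₀) (P.gC x₀) (P.omegaC x₀) (P.TC x₀) r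
        (extChartAt 𝓘(ℝ, E) x₀ (γ t)) (c t) (coordL x₀ (γ t) (X t))
        (X' + christoffel D x₀ (extChartAt 𝓘(ℝ, E) x₀ (γ t)) (c t) (coordL x₀ (γ t) (X t)))
        (coordL x₀ (γ t) (Y t))
        (Y' + christoffel D x₀ (extChartAt 𝓘(ℝ, E) x₀ (γ t)) (c t) (coordL x₀ (γ t) (Y t))) := by
  have hy := h.mem_source
  have hv := h.coordL_velocity_eventuallyEq.self_of_nhds.2
  have hΓ := (hD.isLocalModel hS x₀).smooth_Γ
  have hθ : ∀ w : TangentSpace 𝓘(ℝ, E) (γ t), P.θ (γ t) w =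
      P.gC x₀ (extChartAt 𝓘(ℝ, E) x₀ (γ t)) (P.TC x₀ (extChartAt 𝓘(ℝ, E) x₀ (γ t)))
        (coordL x₀ (γ t) w) := fun w => by
    rw [← PseudohermitianStructure.g_T_left, PseudohermitianStructure.g_chart hy,
      PseudohermitianStructure.TC_chart hy]
  have hX2 := (h.coordL_perp (P := P) (r := r) X).self_of_nhds
  have hY2 := (h.coordL_perp (P := P) (r := r) Y).self_of_nhds
  simp only at hX2 hY2
  rw [PseudohermitianStructure.indexIntegrand, PseudohermitianStructure.Ω_eq_neg_dθ,
    PseudohermitianStructure.Ω_eq_neg_dθ, hθ, hθ, PseudohermitianStructure.g_chart hy,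
    PseudohermitianStructure.g_chart hy, PseudohermitianStructure.dθ_chart hy,
    PseudohermitianStructure.dθ_chart hy, coordL_curvature hΓ hy,
    coordL_covDerivAlong_perp hD hS h hX rfl, coordL_covDerivAlong_perp hD hS h hY rfl, hX2, hY2,
    hv, perpDensity, indexDensity]
  ring

end GeodesicAt

end CurveInChart

/-! ### The second variation on a short piece of the geodesic -/

section LocalSecondVariation

variable {x₀ : M} {γ : ℝ → M} {t : ℝ}

lemma hasDerivWithinAt_chart_comp {s : Set ℝ} (hy : γ t ∈ (chartAt E x₀).source)
    (hγ : MDifferentiableWithinAt 𝓘(ℝ, ℝ) 𝓘(ℝ, E) γ s t) :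
    HasDerivWithinAt (fun s => extChartAt 𝓘(ℝ, E) x₀ (γ s))
      (coordL x₀ (γ t) (mfderivWithin 𝓘(ℝ, ℝ) 𝓘(ℝ, E) γ s t (1 : ℝ))) s t := by
  have h1 := ((contMDiffAt_chart (E := E) hy).mdifferentiableAt (by simp)).hasMFDerivAt
  have h2 := (h1.comp_hasMFDerivWithinAt t hγ.hasMFDerivWithinAt)
  rw [coordL_eq_mfderiv hy]
  let L : ℝ →L[ℝ] E := (mfderiv 𝓘(ℝ, E) 𝓘(ℝ, E) (extChartAt 𝓘(ℝ, E) x₀) (γ t)).comp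
    (mfderivWithin 𝓘(ℝ, ℝ) 𝓘(ℝ, E) γ s t)
  have h3 : HasFDerivWithinAt (fun s => extChartAt 𝓘(ℝ, E) x₀ (γ s)) L s t :=
    hasMFDerivWithinAt_iff_hasFDerivWithinAt.1 h2
  exact h3.hasDerivWithinAt

lemma coordL_congr_totalSpace (x₀ : M) {y y' : M} {v : TangentSpace 𝓘(ℝ, E) y}
    {v' : TangentSpace 𝓘(ℝ, E) y'}
    (h : (⟨y, v⟩ : TangentBundle 𝓘(ℝ, E) M) = ⟨y', v'⟩) : coordL x₀ y v = coordL x₀ y' v' :=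
  congrArg (fun p : TangentBundle 𝓘(ℝ, E) M => coordL x₀ p.1 p.2) h

/-- The boundary term `g(∇_s ∂_s f, ∂_t f)` at `s = 0` of the second variation of the length. -/
def endTerm (P : PseudohermitianStructure E M)
    (D : CovariantDerivative 𝓘(ℝ, E) E (TangentSpace 𝓘(ℝ, E) : M → Type _)) (a b : ℝ)
    (f : ℝ → ℝ → M) (t : ℝ) : ℝ :=
  P.g (f 0 t) (covDerivAlong D (fun s => f s t) (velocity (fun s => f s t)) 0)
    (mfderivWithin 𝓘(ℝ, ℝ) 𝓘(ℝ, E) (f 0) (Icc a b) t (1 : ℝ))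

/-- The length of the piece `[c, d]` of the curves of a variation is twice differentiable at `0`,
its second derivative being given by the index form and the boundary terms. -/
def HasLengthExpansion (P : PseudohermitianStructure E M)
    (D : CovariantDerivative 𝓘(ℝ, E) E (TangentSpace 𝓘(ℝ, E) : M → Type _)) (a b r : ℝ)
    (f : ℝ → ℝ → M) (γ : ℝ → M) (X : ∀ t, TangentSpace 𝓘(ℝ, E) (γ t)) (c d : ℝ) : Prop :=
  (∀ᶠ s in 𝓝 0, IntervalIntegrable
      (fun t => √(P.g (f s t) (velocity (f s) t) (velocity (f s) t))) volume c d) ∧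
    IntervalIntegrable (P.indexIntegrand D γ (P.perp r γ X) (P.perp r γ X)) volume c d ∧
    ∃ L' : ℝ → ℝ, (∀ᶠ s in 𝓝 0, HasDerivAt (fun s => P.length c d (f s)) (L' s) s) ∧
      HasDerivAt L' (1 / r * ((∫ t in c..d, P.indexIntegrand D γ (P.perp r γ X) (P.perp r γ X) t)
        + endTerm P D a b f d - endTerm P D a b f c)) 0

/-- The boundary terms at `m` cancel. Integrability of the speed for all small `s` is carried along
because additivity of the length integrals depends on it. -/
lemma HasLengthExpansion.trans {P : PseudohermitianStructure E M}
    {D : CovariantDerivative 𝓘(ℝ, E) E (TangentSpace 𝓘(ℝ, E) : M → Type _)} {a b r : ℝ}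
    {f : ℝ → ℝ → M} {X : ∀ t, TangentSpace 𝓘(ℝ, E) (γ t)} {c m d : ℝ}
    (h1 : HasLengthExpansion P D a b r f γ X c m) (h2 : HasLengthExpansion P D a b r f γ X m d) :
    HasLengthExpansion P D a b r f γ X c d := by
  obtain ⟨i1, j1, L1, d1, e1⟩ := h1
  obtain ⟨i2, j2, L2, d2, e2⟩ := h2
  refine ⟨(i1.and i2).mono fun s hs => hs.1.trans hs.2, j1.trans j2, fun s => L1 s + L2 s, ?_, ?_⟩
  · filter_upwards [d1, d2, i1.eventually_nhds, i2.eventually_nhds] with s hs1 hs2 hi1 hi2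
    refine (hs1.add hs2).congr_of_eventuallyEq ?_
    filter_upwards [hi1, hi2] with s' h1' h2'
    exact (intervalIntegral.integral_add_adjacent_intervals h1' h2').symm
  · refine (e1.add e2).congr_deriv ?_
    rw [← intervalIntegral.integral_add_adjacent_intervals j1 j2]
    ring

variable [T2Space M] {P : PseudohermitianStructure E M}
  {D : CovariantDerivative 𝓘(ℝ, E) E (TangentSpace 𝓘(ℝ, E) : M → Type _)}

/-- Translation of `IsLocalModel.hasDerivAt_length` to a piece whose base curve lies in one chart.
The boundary term is identified with `endTerm`, which refers neither to the chart nor to the piece,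
so that neighbouring pieces can be added. -/
lemma hasLengthExpansion_of_chart (hD : P.IsTanakaWebster D) (hS : P.IsSasakian D)
    {a b c d r ε : ℝ} (hac : a ≤ c) (hcd : c < d) (hdb : d ≤ b) (hr : 0 < r) (hε : 0 < ε)
    {f : ℝ → ℝ → M} {X : ∀ t, TangentSpace 𝓘(ℝ, E) (γ t)}
    (hsrc : ∀ t ∈ Icc c d, γ t ∈ (chartAt E x₀).source)
    (hf : ContMDiffOn 𝓘(ℝ, ℝ × ℝ) 𝓘(ℝ, E) ∞ (fun q : ℝ × ℝ => f q.2 q.1) (Icc c d ×ˢ Ioo (-ε) ε))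
    (hbase : ∀ t ∈ Icc c d, f 0 t = γ t)
    (hfield : ∀ t ∈ Icc c d, tangentMap 𝓘(ℝ, ℝ) 𝓘(ℝ, E) (fun s => f s t) ⟨0, (1 : ℝ)⟩
      = (⟨γ t, X t⟩ : TangentBundle 𝓘(ℝ, E) M))
    (hf0 : ∀ t ∈ Icc c d, MDifferentiableWithinAt 𝓘(ℝ, ℝ) 𝓘(ℝ, E) (f 0) (Icc a b) t)
    (hspeed : ∀ t ∈ Ioo c d, P.g (γ t) (velocity γ t) (velocity γ t) = r ^ 2)
    (hlengthy : ∀ t ∈ Ioo c d, P.θ (γ t) (velocity γ t) = 0)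
    (hgeo : ∀ t ∈ Ioo c d, covDerivAlong D γ (velocity γ) t = 0) :
    HasLengthExpansion P D a b r f γ X c d := by
  obtain ⟨δ, hδ, hδε, hmem⟩ := exists_strip_subset hε hf.continuousOn (chartAt E x₀).open_source
    (fun t ht => by simp only; rw [hbase t ht]; exact hsrc t ht)
  set K : Set (ℝ × ℝ) := Icc c d ×ˢ Ioo (-δ) δ with hK
  have hfK : ContMDiffOn 𝓘(ℝ, ℝ × ℝ) 𝓘(ℝ, E) ∞ (fun q : ℝ × ℝ => f q.2 q.1) K :=
    hf.mono (prod_mono_right (Ioo_subset_Ioo (neg_le_neg hδε) hδε))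
  have h0 : (0 : ℝ) ∈ Ioo (-δ) δ := ⟨neg_lt_zero.2 hδ, hδ⟩
  have hm := hD.isLocalModel hS x₀
  set F : ℝ × ℝ → E := fun q => extChartAt 𝓘(ℝ, E) x₀ (f q.2 q.1) with hFdef
  have hF : ContDiffOn ℝ ∞ F K := by
    rw [← contMDiffOn_iff_contDiffOn]
    intro q hq
    exact (contMDiffAt_chart (hmem q hq)).comp_contMDiffWithinAt q (hfK q hq)
  have hFV : MapsTo F K (extChartAt 𝓘(ℝ, E) x₀).target := fun q hq => chart_mem_target (hmem q hq)
  have hKn : ∀ {t s : ℝ}, t ∈ Ioo c d → s ∈ Ioo (-δ) δ → K ∈ 𝓝 (t, s) := fun ht hs =>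
    strip_mem_nhds ht hs
  have hcontAt : ∀ {t s : ℝ}, t ∈ Ioo c d → s ∈ Ioo (-δ) δ → ContinuousAt (f s) t := by
    intro t s ht hs
    have h1 : ContinuousAt (fun q : ℝ × ℝ => f q.2 q.1) (t, s) :=
      hfK.continuousOn.continuousAt (hKn ht hs)
    exact ContinuousAt.comp (g := fun q : ℝ × ℝ => f q.2 q.1) (f := fun t => (t, s)) h1
      (by fun_prop)
  have hFat : ∀ {t s : ℝ}, t ∈ Ioo c d → s ∈ Ioo (-δ) δ → ContDiffAt ℝ ∞ F (t, s) := fun ht hs =>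
    hF.contDiffAt (hKn ht hs)
  have hfdt : ∀ {t s : ℝ}, t ∈ Ioo c d → s ∈ Ioo (-δ) δ →
      HasDerivAt (fun t => extChartAt 𝓘(ℝ, E) x₀ (f s t)) (fderiv ℝ F (t, s) (1, 0)) t := by
    intro t s ht hs
    exact ((hFat ht hs).differentiableAt (by simp)).hasFDerivAt.comp_hasDerivAt (f := fun t => (t, s))
      t ((hasDerivAt_id t).prodMk (hasDerivAt_const t s))
  have hvel : ∀ {t s : ℝ}, t ∈ Ioo c d → s ∈ Ioo (-δ) δ →
      coordL x₀ (f s t) (velocity (f s) t) = fderiv ℝ F (t, s) (1, 0) := fun {t s} ht hs =>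
    coordL_velocity (hmem (t, s) ⟨Ioo_subset_Icc_self ht, hs⟩) (hcontAt ht hs) (hfdt ht hs)
  have hfγ : ∀ {t : ℝ}, t ∈ Ioo c d → f 0 =ᶠ[𝓝 t] γ := by
    intro t ht
    filter_upwards [isOpen_Ioo.mem_nhds ht] with s hs using hbase s (Ioo_subset_Icc_self hs)
  have hdc : ∀ {t : ℝ}, t ∈ Ioo c d → ∀ v : ℝ × ℝ,
      HasDerivAt (fun s : ℝ => fderiv ℝ F (s, 0) v)
        (fderiv ℝ (fun p => fderiv ℝ F p v) (t, 0) (1, 0)) t := by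
    intro t ht v
    exact ((IsLocalModel.contDiffAt_fderiv_apply (hFat ht h0) v).differentiableAt
      (by simp)).hasFDerivAt.comp_hasDerivAt (f := fun t => (t, (0 : ℝ)))
      t ((hasDerivAt_id t).prodMk (hasDerivAt_const t (0 : ℝ)))
  have hG : ∀ t ∈ Ioo c d, GeodesicAt D x₀ γ t (fun s => fderiv ℝ F (s, 0) (1, 0))
      (fderiv ℝ (fun p => fderiv ℝ F p (1, 0)) (t, 0) (1, 0)) := by
    intro t ht
    refine ⟨hsrc t (Ioo_subset_Icc_self ht), ?_, ?_, hdc ht _, hgeo t ht⟩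
    · filter_upwards [isOpen_Ioo.mem_nhds ht] with s hs
      exact (hcontAt hs h0).congr (hfγ hs)
    · filter_upwards [isOpen_Ioo.mem_nhds ht] with s hs
      refine (hfdt hs h0).congr_of_eventuallyEq ?_
      filter_upwards [hfγ hs] with s' hs'
      rw [hs']
  have hFγ : ∀ {t : ℝ}, t ∈ Icc c d → F (t, 0) = extChartAt 𝓘(ℝ, E) x₀ (γ t) := by
    intro t ht
    simp only [hFdef]
    rw [hbase t ht]
  have hv : ∀ t ∈ Ioo c d, coordL x₀ (γ t) (velocity γ t) = fderiv ℝ F (t, 0) (1, 0) := fun t ht =>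
    (hG t ht).coordL_velocity_eventuallyEq.self_of_nhds.2
  have hcontS : ∀ {t s : ℝ}, t ∈ Icc c d → s ∈ Ioo (-δ) δ → ContinuousAt (fun s => f s t) s := by
    intro t s ht hs
    have h1 : ContinuousOn (fun s => f s t) (Ioo (-δ) δ) :=
      ContinuousOn.comp (g := fun q : ℝ × ℝ => f q.2 q.1) (f := fun s => (t, s))
        hfK.continuousOn (by fun_prop) fun s hs => ⟨ht, hs⟩
    exact h1.continuousAt (isOpen_Ioo.mem_nhds hs)
  have hfds : ∀ {t s : ℝ}, t ∈ Icc c d → s ∈ Ioo (-δ) δ →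
      HasDerivAt (fun s => extChartAt 𝓘(ℝ, E) x₀ (f s t)) (fderivWithin ℝ F K (t, s) (0, 1)) s :=
    fun {t s} ht hs => hasDerivAt_slice ((hF.differentiableOn (by simp)) (t, s) ⟨ht, hs⟩) ht hs
  have hvels : ∀ {t s : ℝ}, t ∈ Icc c d → s ∈ Ioo (-δ) δ →
      coordL x₀ (f s t) (velocity (fun s => f s t) s) = fderivWithin ℝ F K (t, s) (0, 1) :=
    fun {t s} ht hs =>
      coordL_velocity (γ := fun s => f s t) (hmem (t, s) ⟨ht, hs⟩) (hcontS ht hs) (hfds ht hs)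
  have hX : ∀ t ∈ Icc c d, coordL x₀ (γ t) (X t) = fderivWithin ℝ F K (t, 0) (0, 1) := by
    intro t ht
    rw [← hvels ht h0]
    exact (coordL_congr_totalSpace x₀ (hfield t ht)).symm
  have hXi : ∀ t ∈ Ioo c d, coordL x₀ (γ t) (X t) = fderiv ℝ F (t, 0) (0, 1) := by
    intro t ht
    rw [hX t (Ioo_subset_Icc_self ht), fderivWithin_of_mem_nhds (hKn ht h0)]
  have hXd : ∀ t ∈ Ioo c d, HasDerivAt (fun s => coordL x₀ (γ s) (X s))
      (fderiv ℝ (fun p => fderiv ℝ F p (0, 1)) (t, 0) (1, 0)) t := by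
    intro t ht
    refine (hdc ht (0, 1)).congr_of_eventuallyEq ?_
    filter_upwards [isOpen_Ioo.mem_nhds ht] with s hs using hXi s hs
  refine hm.hasDerivAt_length (fun z hz => ?_) hcd hδ hF hFV hr ?_ ?_ ?_
    (dens := P.indexIntegrand D γ (P.perp r γ X) (P.perp r γ X)) (H := endTerm P D a b f)
    ?_ ?_ (ℓ := fun s t => √(P.g (f s t) (velocity (f s) t) (velocity (f s) t))) ?_
  · have hy := symm_mem_source (E := E) hz
    have h1 := PseudohermitianStructure.g_T_left (P := P)
      (P.T ((extChartAt 𝓘(ℝ, E) x₀).symm z))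
    rw [PseudohermitianStructure.g_chart hy, ← PseudohermitianStructure.TC_chart hy,
      (extChartAt 𝓘(ℝ, E) x₀).right_inv hz, P.θ_T] at h1
    exact h1
  · intro t ht
    rw [hFγ (Ioo_subset_Icc_self ht), ← hv t ht,
      ← PseudohermitianStructure.g_chart (hG t ht).mem_source, hspeed t ht]
  · intro t ht
    rw [hFγ (Ioo_subset_Icc_self ht), ← hv t ht,
      PseudohermitianStructure.TC_chart (hG t ht).mem_source,
      ← PseudohermitianStructure.g_chart (hG t ht).mem_source,
      PseudohermitianStructure.g_T_left, hlengthy t ht]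
  · intro t ht
    have := (hG t ht).equation
    rw [← hFγ (Ioo_subset_Icc_self ht)] at this
    exact this
  · intro t ht
    have := (hG t ht).indexIntegrand_perp (r := r) hD hS (hXd t ht) (hXd t ht)
    rw [this, ← hFγ (Ioo_subset_Icc_self ht), hXi t ht]
    rfl
  · intro t ht
    have hy : f 0 t ∈ (chartAt E x₀).source := hmem (t, 0) ⟨ht, h0⟩
    have hXs : HasDerivAt (fun s => coordL x₀ (f s t) (velocity (fun s => f s t) s))
        (fderivWithin ℝ (fun p => fderivWithin ℝ F K p (0, 1)) K (t, 0) (0, 1)) 0 := by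
      refine (hasDerivAt_slice (((ContDiffOn.fderivWithin_apply_strip hcd hF
        (0, 1)).differentiableOn (by simp)) (t, 0) ⟨ht, h0⟩) ht h0).congr_of_eventuallyEq ?_
      filter_upwards [isOpen_Ioo.mem_nhds h0] with s hs using hvels ht hs
    have h1 := coordL_covDerivAlong (D := D) (γ := fun s => f s t) hy (hcontS ht h0) (hfds ht h0) hXs
    -- The one-sided `t`-derivative of `F` on `[c, d]` is the derivative of `f 0` within all of `[a,
    -- b]`, restricted. This is where `C^1` regularity of the geodesic prevents a jump of the
    -- boundary term.
    have h2 := ((hasDerivWithinAt_chart_comp hy (hf0 t ht)).mono (Icc_subset_Icc hac hdb))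
    have h3 := hasDerivWithinAt_slice ((hF.differentiableOn (by simp)) (t, 0) ⟨ht, h0⟩) h0
    have h4 := (uniqueDiffOn_Icc hcd t ht).eq_deriv _ h2 h3
    rw [endTerm, PseudohermitianStructure.g_chart hy, h1, h4, hvels ht h0]
    rfl
  · intro t ht s hs
    rw [PseudohermitianStructure.g_chart (hmem (t, s) ⟨Ioo_subset_Icc_self ht, hs⟩), hvel ht hs]

end LocalSecondVariation

/-! ### The second variation along the whole geodesic -/

section GlobalSecondVariation

/-- The intervals considered have `x` as an end point, so they are harmless even when `x` is itself
a break point. -/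
lemma exists_pos_forall_notMem_Ioo (S : Finset ℝ) (x : ℝ) :
    ∃ η > 0, ∀ c d, x - η < c → d < x + η → c = x ∨ d = x → ∀ y ∈ S, y ∉ Ioo c d := by
  have h : ((S.erase x : Finset ℝ) : Set ℝ)ᶜ ∈ 𝓝 x :=
    (S.erase x).finite_toSet.isClosed.isOpen_compl.mem_nhds (by simp)
  obtain ⟨η, hη, hball⟩ := Metric.mem_nhds_iff.1 h
  refine ⟨η, hη, fun c d hc hd hx y hy hycd => ?_⟩
  have hyx : y ≠ x := by
    rintro rfl
    rcases hx with rfl | rfl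
    · exact lt_irrefl _ hycd.1
    · exact lt_irrefl _ hycd.2
  refine hball (?_ : y ∈ Metric.ball x η) (by simp [hyx, hy])
  rw [Real.ball_eq_Ioo]
  exact ⟨hc.trans hycd.1, hycd.2.trans hd⟩

lemma exists_pos_forall_mem {Y : Type*} [TopologicalSpace Y] {γ : ℝ → Y} {a b x : ℝ}
    (hγ : ContinuousOn γ (Icc a b)) (hx : x ∈ Icc a b) {U : Set Y} (hU : U ∈ 𝓝 (γ x)) :
    ∃ η > 0, ∀ c d, a ≤ c → d ≤ b → x - η < c → d < x + η → ∀ t ∈ Icc c d, γ t ∈ U := by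
  obtain ⟨η, hη, hball⟩ := Metric.mem_nhdsWithin_iff.1 ((hγ x hx) hU)
  refine ⟨η, hη, fun c d hac hdb hc hd t ht => hball ⟨?_, hac.trans ht.1, ht.2.trans hdb⟩⟩
  rw [Real.ball_eq_Ioo]
  exact ⟨hc.trans_le ht.1, ht.2.trans_lt hd⟩

/-- Induction along a curve, in steps which stay in a chart and cross no break point. -/
lemma interval_induction_chart {a b : ℝ} (hab : a < b) {γ : ℝ → M} (hγ : ContinuousOn γ (Icc a b))
    (S : Finset ℝ) {Q : ℝ → ℝ → Prop}
    (hadd : ∀ c m d, a ≤ c → c < m → m < d → d ≤ b → Q c m → Q m d → Q c d)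
    (hloc : ∀ (x₀ : M) (c d : ℝ), a ≤ c → c < d → d ≤ b →
      (∀ t ∈ Icc c d, γ t ∈ (chartAt E x₀).source) → (∀ y ∈ S, y ∉ Ioo c d) → Q c d) : Q a b := by
  refine interval_induction hab hadd fun x hx => ?_
  obtain ⟨η₁, hη₁, h1⟩ := exists_pos_forall_mem hγ hx (chart_source_mem_nhds E (γ x))
  obtain ⟨η₂, hη₂, h2⟩ := exists_pos_forall_notMem_Ioo S x
  refine ⟨min η₁ η₂, lt_min hη₁ hη₂, fun c d hac hcd hdb hc hd hxcd => ?_⟩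
  have m1 := min_le_left η₁ η₂
  have m2 := min_le_right η₁ η₂
  exact hloc (γ x) c d hac hcd hdb (h1 c d hac hdb (by linarith) (by linarith))
    (h2 c d (by linarith) (by linarith) hxcd)

variable {P : PseudohermitianStructure E M}
  {D : CovariantDerivative 𝓘(ℝ, E) E (TangentSpace 𝓘(ℝ, E) : M → Type _)}
  {γ : ℝ → M} {a b r : ℝ} {f : ℝ → ℝ → M}

/-- The curve `s ↦ f s t` is constant near `0`, so its velocity vanishes in a neighbourhood and its
covariant acceleration vanishes at `0`. -/
lemma endTerm_eq_zero {t : ℝ} (h : ∀ᶠ s in 𝓝 0, f s t = f 0 t) : endTerm P D a b f t = 0 := by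
  have hy := mem_chart_source E (f 0 t)
  have hev : ∀ᶠ s in 𝓝 (0 : ℝ), (fun s => f s t) =ᶠ[𝓝 s] fun _ => f 0 t := h.eventually_nhds
  have hd : ∀ {s : ℝ}, (fun s => f s t) =ᶠ[𝓝 s] (fun _ => f 0 t) →
      HasDerivAt (fun s => extChartAt 𝓘(ℝ, E) (f 0 t) (f s t)) (0 : E) s := by
    intro s hs
    refine (hasDerivAt_const s (extChartAt 𝓘(ℝ, E) (f 0 t) (f 0 t))).congr_of_eventuallyEq ?_
    filter_upwards [hs] with s' hs'
    rw [hs']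
  have hc : ∀ {s : ℝ}, (fun s => f s t) =ᶠ[𝓝 s] (fun _ => f 0 t) →
      ContinuousAt (fun s => f s t) s := fun hs => continuousAt_const.congr hs.symm
  have hv : (fun s => coordL (f 0 t) (f s t) (velocity (fun s => f s t) s))
      =ᶠ[𝓝 (0 : ℝ)] fun _ => (0 : E) := by
    filter_upwards [hev] with s hs
    have hs0 : f s t = f 0 t := hs.self_of_nhds
    exact coordL_velocity (γ := fun s => f s t) (by simp only [hs0]; exact hy) (hc hs) (hd hs)
  have h0 := hev.self_of_nhds
  have hv0 : HasDerivAt (fun s => coordL (f 0 t) (f s t) (velocity (fun s => f s t) s)) (0 : E)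
      (0 : ℝ) := (hasDerivAt_const (0 : ℝ) (0 : E)).congr_of_eventuallyEq hv
  have h1 := coordL_covDerivAlong (D := D) (γ := fun s => f s t) hy (hc h0) (hd h0) hv0
  rw [map_zero, zero_apply, add_zero] at h1
  rw [endTerm, PseudohermitianStructure.g_chart hy, h1, map_zero, zero_apply]

/-- A lengthy geodesic, parametrized with constant speed `r`. -/
structure IsLengthyGeodesic (P : PseudohermitianStructure E M)
    (D : CovariantDerivative 𝓘(ℝ, E) E (TangentSpace 𝓘(ℝ, E) : M → Type _)) (a b r : ℝ)
    (γ : ℝ → M) : Prop where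
  contMDiffOn : ContMDiffOn 𝓘(ℝ, ℝ) 𝓘(ℝ, E) 1 γ (Icc a b)
  speed : ∀ t ∈ Ioo a b, P.g (γ t) (velocity γ t) (velocity γ t) = r ^ 2
  lengthy : ∀ t ∈ Ioo a b, P.θ (γ t) (velocity γ t) = 0
  geodesic : ∀ t ∈ Ioo a b, covDerivAlong D γ (velocity γ) t = 0

lemma isLengthyGeodesic {y z : M} (hr : 0 < r) (hΓ : P.MemPaths a b y z r γ)
    (hl : P.IsLengthy a b γ) (hgeo : IsGeodesic E D a b γ) : IsLengthyGeodesic P D a b r γ := by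
  have hmd : ∀ t ∈ Ioo a b, MDifferentiableAt 𝓘(ℝ, ℝ) 𝓘(ℝ, E) γ t := fun t ht =>
    (hgeo.contMDiffOn.contMDiffAt (Icc_mem_nhds ht.1 ht.2)).mdifferentiableAt (by simp)
  refine ⟨hgeo.contMDiffOn, fun t ht => ?_, fun t ht => hl t ht (hmd t ht),
    hgeo.eq_zero⟩
  have h := hΓ.speed t ht (hmd t ht)
  -- `Real.sqrt` is zero on nonpositive numbers, so `r > 0` already forces positivity here.
  have hpos : 0 < P.g (γ t) (velocity γ t) (velocity γ t) := by
    by_contra hneg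
    rw [Real.sqrt_eq_zero_of_nonpos (not_lt.1 hneg)] at h
    exact hr.ne h
  rw [← h, Real.sq_sqrt hpos.le]

variable [T2Space M]

lemma IsVariation.hasLengthExpansion (hab : a < b) (hr : 0 < r) (hD : P.IsTanakaWebster D)
    (hS : P.IsSasakian D) (hγ : IsLengthyGeodesic P D a b r γ)
    {X : ∀ t, TangentSpace 𝓘(ℝ, E) (γ t)} {ε : ℝ} (hf : IsVariation a b γ X ε f) :
    HasLengthExpansion P D a b r f γ X a b := by
  obtain ⟨S, hS'⟩ := hf.piecewise
  refine interval_induction_chart (E := E) hab hγ.contMDiffOn.continuousOn S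
    (Q := HasLengthExpansion P D a b r f γ X) (fun c m d _ _ _ _ h1 h2 => h1.trans h2) ?_
  intro x₀ c d hac hcd hdb hsrc hbr
  have hsub : Icc c d ⊆ Icc a b := Icc_subset_Icc hac hdb
  have hsub' : Ioo c d ⊆ Ioo a b := Ioo_subset_Ioo hac hdb
  refine hasLengthExpansion_of_chart hD hS hac hcd hdb hr hf.ε_pos hsrc (hS' c d hac hcd hdb hbr)
    (fun t ht => hf.base t (hsub ht)) (fun t ht => hf.field t (hsub ht)) (fun t ht => ?_)
    (fun t ht => hγ.speed t (hsub' ht)) (fun t ht => hγ.lengthy t (hsub' ht))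
    (fun t ht => hγ.geodesic t (hsub' ht))
  exact ((hγ.contMDiffOn.mdifferentiableOn (by simp)) t (hsub ht)).congr
    (fun s hs => hf.base s hs) (hf.base t (hsub ht))

/-- The second variation formula for the length of a lengthy geodesic. -/
lemma IsVariation.second_variation (hab : a < b) (hr : 0 < r) (hD : P.IsTanakaWebster D)
    (hS : P.IsSasakian D) (hγ : IsLengthyGeodesic P D a b r γ)
    {X : ∀ t, TangentSpace 𝓘(ℝ, E) (γ t)} {ε : ℝ} (hf : IsVariation a b γ X ε f) :
    IntervalIntegrable (P.indexIntegrand D γ (P.perp r γ X) (P.perp r γ X)) volume a b ∧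
    ∃ L' : ℝ → ℝ, (∀ᶠ s in 𝓝 0, HasDerivAt (fun s => P.length a b (f s)) (L' s) s) ∧
      HasDerivAt L'
        (1 / r * ∫ t in a..b, P.indexIntegrand D γ (P.perp r γ X) (P.perp r γ X) t) 0 := by
  obtain ⟨-, hI, L', h1, h2⟩ := hf.hasLengthExpansion hab hr hD hS hγ
  have hε := eventually_mem_Ioo_symm hf.ε_pos
  have h0 := hε.self_of_nhds
  have ha : endTerm P D a b f a = 0 := endTerm_eq_zero (by
    filter_upwards [hε] with s hs
    rw [hf.left s hs, hf.left 0 h0])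
  have hb : endTerm P D a b f b = 0 := endTerm_eq_zero (by
    filter_upwards [hε] with s hs
    rw [hf.right s hs, hf.right 0 h0])
  rw [ha, hb, add_zero, sub_zero] at h2
  exact ⟨hI, L', h1, h2⟩

end GlobalSecondVariation

/-! ### Existence of variations -/

section Existence

variable {γ : ℝ → M} {a b : ℝ}

lemma totalSpace_ext {x₀ y y' : M} {v : TangentSpace 𝓘(ℝ, E) y} {v' : TangentSpace 𝓘(ℝ, E) y'}
    (hy : y' ∈ (chartAt E x₀).source) (h : y = y') (hv : coordL x₀ y v = coordL x₀ y' v') :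
    (⟨y, v⟩ : TangentBundle 𝓘(ℝ, E) M) = ⟨y', v'⟩ := by
  subst h
  rw [coordL_injective hy hv]

/-- The curve through `x` with initial velocity `v` which is a straight line in the chart at `x`. -/
def ray (x : M) (v : TangentSpace 𝓘(ℝ, E) x) (s : ℝ) : M :=
  (extChartAt 𝓘(ℝ, E) x).symm (extChartAt 𝓘(ℝ, E) x x + s • coordL x x v)

/-! ### Curves with prescribed initial velocity -/

section Ray

variable {x x₀ : M} {v : TangentSpace 𝓘(ℝ, E) x}

lemma ray_zero : ray x v 0 = x := by
  rw [ray, zero_smul, add_zero, chart_symm_chart (mem_chart_source E x)]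

lemma ray_zero_vector (s : ℝ) : ray x (0 : TangentSpace 𝓘(ℝ, E) x) s = x := by
  rw [ray, map_zero, smul_zero, add_zero, chart_symm_chart (mem_chart_source E x)]

lemma eventually_ray_mem_target : ∀ᶠ s in 𝓝 (0 : ℝ),
    extChartAt 𝓘(ℝ, E) x x + s • coordL x x v ∈ (extChartAt 𝓘(ℝ, E) x).target := by
  have h : Continuous fun s : ℝ => extChartAt 𝓘(ℝ, E) x x + s • coordL x x v := by fun_prop
  refine h.continuousAt.eventually (isOpen_target.mem_nhds ?_)
  simp only
  rw [zero_smul, add_zero]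
  exact chart_mem_target (mem_chart_source E x)

lemma eventually_contMDiffAt_ray : ∀ᶠ s in 𝓝 (0 : ℝ),
    ContMDiffAt 𝓘(ℝ, ℝ) 𝓘(ℝ, E) ∞ (ray x v) s := by
  filter_upwards [eventually_ray_mem_target (v := v)] with s hs
  have h : ContDiffAt ℝ ∞ (fun s : ℝ => extChartAt 𝓘(ℝ, E) x x + s • coordL x x v) s := by fun_prop
  exact (contMDiffAt_chart_symm hs).comp s h.contMDiffAt

lemma tangent_ray : (⟨ray x v 0, velocity (ray x v) 0⟩ : TangentBundle 𝓘(ℝ, E) M) = ⟨x, v⟩ := by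
  have hx := mem_chart_source E x
  refine totalSpace_ext hx ray_zero ?_
  refine coordL_velocity (by rw [ray_zero]; exact hx)
    eventually_contMDiffAt_ray.self_of_nhds.continuousAt ?_
  have h : HasDerivAt (fun s : ℝ => extChartAt 𝓘(ℝ, E) x x + s • coordL x x v)
      ((1 : ℝ) • coordL x x v) (0 : ℝ) :=
    ((hasDerivAt_id (0 : ℝ)).smul_const (coordL x x v)).const_add _
  rw [one_smul] at h
  refine h.congr_of_eventuallyEq ?_
  filter_upwards [eventually_ray_mem_target (v := v)] with s hs
  exact (extChartAt 𝓘(ℝ, E) x).right_inv hs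

lemma hasDerivAt_chart_ray (hx : x ∈ (chartAt E x₀).source) :
    HasDerivAt (fun s => extChartAt 𝓘(ℝ, E) x₀ (ray x v s)) (coordL x₀ x v) 0 := by
  rw [← coordL_congr_totalSpace x₀ (tangent_ray (v := v))]
  exact hasDerivAt_chart_comp (by rw [ray_zero]; exact hx)
    (eventually_contMDiffAt_ray.self_of_nhds.mdifferentiableAt (by simp))

lemma exists_ray_chart (v : TangentSpace 𝓘(ℝ, E) x) (hx : x ∈ (chartAt E x₀).source) : ∃ ε > 0,
    (∀ s ∈ Ioo (-ε) ε, ray x v s ∈ (chartAt E x₀).source) ∧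
    ContDiffOn ℝ ∞ (fun s => extChartAt 𝓘(ℝ, E) x₀ (ray x v s)) (Ioo (-ε) ε) := by
  have h1 := eventually_contMDiffAt_ray (v := v)
  have h2 := h1.self_of_nhds.continuousAt.eventually
    ((chartAt E x₀).open_source.mem_nhds (by rw [ray_zero]; exact hx))
  obtain ⟨ε, hε, hball⟩ := Metric.mem_nhds_iff.1 (h1.and h2)
  rw [Real.ball_eq_Ioo, zero_sub, zero_add] at hball
  refine ⟨ε, hε, fun s hs => (hball hs).2, fun s hs => ?_⟩
  exact (contMDiffAt_iff_contDiffAt.1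
    ((contMDiffAt_chart (hball hs).2).comp s (hball hs).1)).contDiffWithinAt

end Ray

lemma contMDiffOn_field_iff {x₀ : M} {s : Set ℝ} {X : ∀ t, TangentSpace 𝓘(ℝ, E) (γ t)}
    (hsrc : ∀ t ∈ s, γ t ∈ (chartAt E x₀).source) :
    ContMDiffOn 𝓘(ℝ, ℝ) 𝓘(ℝ, E).tangent ∞ (fun t => (⟨γ t, X t⟩ : TangentBundle 𝓘(ℝ, E) M)) s ↔
      ContMDiffOn 𝓘(ℝ, ℝ) 𝓘(ℝ, E) ∞ γ s ∧
        ContDiffOn ℝ ∞ (fun t => coordL x₀ (γ t) (X t)) s := by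
  have h := (trivializationAt E (TangentSpace 𝓘(ℝ, E) : M → Type _) x₀).contMDiffOn_iff
    (IB := 𝓘(ℝ, E)) (IM := 𝓘(ℝ, ℝ)) (n := ∞)
    (f := fun t => (⟨γ t, X t⟩ : TangentBundle 𝓘(ℝ, E) M)) (s := s)
    (fun t ht => (Trivialization.mem_source _).2 (mem_baseSet_iff.2 (hsrc t ht)))
  refine h.trans (and_congr Iff.rfl ?_)
  rw [← contMDiffOn_iff_contDiffOn]
  exact contMDiffOn_congr fun t ht => coordL_apply (hsrc t ht) _

/-- A variation over `[c, d]` inducing `X`, whose end points move along the curves `ray`. -/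
structure IsRayVariation (c d : ℝ) (γ : ℝ → M) (X : ∀ t, TangentSpace 𝓘(ℝ, E) (γ t))
    (ε : ℝ) (f : ℝ → ℝ → M) : Prop where
  ε_pos : 0 < ε
  left : ∀ s ∈ Ioo (-ε) ε, f s c = ray (γ c) (X c) s
  right : ∀ s ∈ Ioo (-ε) ε, f s d = ray (γ d) (X d) s
  base : ∀ t ∈ Icc c d, f 0 t = γ t
  piecewise : Piecewise c d fun c d =>
    ContMDiffOn 𝓘(ℝ, ℝ × ℝ) 𝓘(ℝ, E) ∞ (fun q : ℝ × ℝ => f q.2 q.1) (Icc c d ×ˢ Ioo (-ε) ε)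
  field : ∀ t ∈ Icc c d,
    tangentMap 𝓘(ℝ, ℝ) 𝓘(ℝ, E) (fun s => f s t) ⟨0, (1 : ℝ)⟩
      = (⟨γ t, X t⟩ : TangentBundle 𝓘(ℝ, E) M)

/-- At the junction both pieces follow the same curve `ray (γ m) (X m)`, so they agree there for
every small `s`; `m` becomes a new break point. -/
lemma IsRayVariation.glue {c m d ε₁ ε₂ : ℝ} {X : ∀ t, TangentSpace 𝓘(ℝ, E) (γ t)}
    {f₁ f₂ : ℝ → ℝ → M} (hcm : c < m) (hmd : m < d) (h₁ : IsRayVariation c m γ X ε₁ f₁)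
    (h₂ : IsRayVariation m d γ X ε₂ f₂) :
    IsRayVariation c d γ X (min ε₁ ε₂) (fun s t => if t ≤ m then f₁ s t else f₂ s t) := by
  have i1 : Ioo (-(min ε₁ ε₂)) (min ε₁ ε₂) ⊆ Ioo (-ε₁) ε₁ :=
    Ioo_subset_Ioo (neg_le_neg (min_le_left _ _)) (min_le_left _ _)
  have i2 : Ioo (-(min ε₁ ε₂)) (min ε₁ ε₂) ⊆ Ioo (-ε₂) ε₂ :=
    Ioo_subset_Ioo (neg_le_neg (min_le_right _ _)) (min_le_right _ _)
  refine ⟨lt_min h₁.ε_pos h₂.ε_pos, fun s hs => ?_, fun s hs => ?_, fun t ht => ?_, ?_,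
    fun t ht => ?_⟩
  · rw [if_pos hcm.le]; exact h₁.left s (i1 hs)
  · rw [if_neg hmd.not_ge]; exact h₂.right s (i2 hs)
  · split_ifs with h
    · exact h₁.base t ⟨ht.1, h⟩
    · exact h₂.base t ⟨(not_le.1 h).le, ht.2⟩
  · classical
    obtain ⟨S₁, hS₁⟩ := h₁.piecewise
    obtain ⟨S₂, hS₂⟩ := h₂.piecewise
    refine ⟨insert m (S₁ ∪ S₂), fun c' d' hc hcd hd hbr => ?_⟩
    have hm := hbr m (by simp)
    rcases le_or_gt d' m with h | h
    · refine ((hS₁ c' d' hc hcd h fun y hy => hbr y (by simp [hy])).mono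
        (prod_mono_right i1)).congr fun q hq => ?_
      rw [if_pos (hq.1.2.trans h)]
    · have hmc : m ≤ c' := by
        by_contra hlt
        exact hm ⟨not_le.1 hlt, h⟩
      refine ((hS₂ c' d' hmc hcd hd fun y hy => hbr y (by simp [hy])).mono
        (prod_mono_right i2)).congr fun q hq => ?_
      -- At the left edge `t = m` the glued family takes its value from the first piece, which
      -- agrees with the second along the common ray.
      split_ifs with hqm
      · have : q.1 = m := le_antisymm hqm (hmc.trans hq.1.1)
        rw [this, h₁.right _ (i1 hq.2), h₂.left _ (i2 hq.2)]
      · rfl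
  · by_cases h : t ≤ m
    · simp only [if_pos h]
      exact h₁.field t ⟨ht.1, h⟩
    · simp only [if_neg h]
      exact h₂.field t ⟨(not_le.1 h).le, ht.2⟩

/-- In the chart use `e(γ t) + s X(t)`, plus an affine interpolation in `t` of the errors at the two
ends. The errors vanish together with their first derivative at `s = 0`, so the induced field is
unchanged. -/
lemma exists_isRayVariation_of_chart {x₀ : M} {c d : ℝ} {X : ∀ t, TangentSpace 𝓘(ℝ, E) (γ t)}
    (hcd : c < d) (hsrc : ∀ t ∈ Icc c d, γ t ∈ (chartAt E x₀).source)
    (hX : ContMDiffOn 𝓘(ℝ, ℝ) 𝓘(ℝ, E).tangent ∞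
      (fun t => (⟨γ t, X t⟩ : TangentBundle 𝓘(ℝ, E) M)) (Icc c d)) :
    ∃ ε f, IsRayVariation c d γ X ε f := by
  obtain ⟨hγ, hX'⟩ := (contMDiffOn_field_iff hsrc).1 hX
  have hγ' : ContDiffOn ℝ ∞ (fun t => extChartAt 𝓘(ℝ, E) x₀ (γ t)) (Icc c d) := by
    rw [← contMDiffOn_iff_contDiffOn]
    intro t ht
    exact (contMDiffAt_chart (hsrc t ht)).comp_contMDiffWithinAt t (hγ t ht)
  have hc := left_mem_Icc.2 hcd.le
  have hd := right_mem_Icc.2 hcd.le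
  obtain ⟨ε₁, hε₁, hr₁, hs₁⟩ := exists_ray_chart (X c) (hsrc c hc)
  obtain ⟨ε₂, hε₂, hr₂, hs₂⟩ := exists_ray_chart (X d) (hsrc d hd)
  set e := extChartAt 𝓘(ℝ, E) x₀ with he
  -- The ray is straight in the chart at its own base point, generally not in the chart at `x₀`;
  -- `w₁` and `w₂` measure its deviation from the straight line there.
  set w₁ : ℝ → E := fun s => e (ray (γ c) (X c) s) - e (γ c) - s • coordL x₀ (γ c) (X c) with hw₁
  set w₂ : ℝ → E := fun s => e (ray (γ d) (X d) s) - e (γ d) - s • coordL x₀ (γ d) (X d) with hw₂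
  set F : ℝ × ℝ → E := fun q => e (γ q.1) + q.2 • coordL x₀ (γ q.1) (X q.1) +
    (((d - q.1) / (d - c)) • w₁ q.2 + ((q.1 - c) / (d - c)) • w₂ q.2) with hF
  set ε := min ε₁ ε₂ with hε
  have hε0 : 0 < ε := lt_min hε₁ hε₂
  have i1 : Ioo (-ε) ε ⊆ Ioo (-ε₁) ε₁ :=
    Ioo_subset_Ioo (neg_le_neg (min_le_left _ _)) (min_le_left _ _)
  have i2 : Ioo (-ε) ε ⊆ Ioo (-ε₂) ε₂ :=
    Ioo_subset_Ioo (neg_le_neg (min_le_right _ _)) (min_le_right _ _)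
  have sw₁ : ContDiffOn ℝ ∞ w₁ (Ioo (-ε) ε) :=
    ((hs₁.mono i1).sub contDiffOn_const).sub (by fun_prop)
  have sw₂ : ContDiffOn ℝ ∞ w₂ (Ioo (-ε) ε) :=
    ((hs₂.mono i2).sub contDiffOn_const).sub (by fun_prop)
  have w₁0 : w₁ 0 = 0 := by simp only [hw₁]; rw [ray_zero, sub_self, zero_smul, sub_zero]
  have w₂0 : w₂ 0 = 0 := by simp only [hw₂]; rw [ray_zero, sub_self, zero_smul, sub_zero]
  have hdw₁ : HasDerivAt w₁ 0 0 := by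
    have h := ((hasDerivAt_chart_ray (v := X c) (hsrc c hc)).sub_const (e (γ c))).sub
      ((hasDerivAt_id (0 : ℝ)).smul_const (coordL x₀ (γ c) (X c)))
    rw [one_smul, sub_self] at h
    exact h
  have hdw₂ : HasDerivAt w₂ 0 0 := by
    have h := ((hasDerivAt_chart_ray (v := X d) (hsrc d hd)).sub_const (e (γ d))).sub
      ((hasDerivAt_id (0 : ℝ)).smul_const (coordL x₀ (γ d) (X d)))
    rw [one_smul, sub_self] at h
    exact h
  have m1 : MapsTo Prod.fst (Icc c d ×ˢ Ioo (-ε) ε) (Icc c d) := fun q hq => hq.1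
  have m2 : MapsTo Prod.snd (Icc c d ×ˢ Ioo (-ε) ε) (Ioo (-ε) ε) := fun q hq => hq.2
  have sF : ContDiffOn ℝ ∞ F (Icc c d ×ˢ Ioo (-ε) ε) := by
    refine ((hγ'.comp contDiffOn_fst m1).add
      (contDiffOn_snd.smul (hX'.comp contDiffOn_fst m1))).add
      (ContDiffOn.add (ContDiffOn.smul ?_ (sw₁.comp contDiffOn_snd m2))
        (ContDiffOn.smul ?_ (sw₂.comp contDiffOn_snd m2)))
    · exact (contDiffOn_const.sub contDiffOn_fst).div_const _
    · exact (contDiffOn_fst.sub contDiffOn_const).div_const _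
  have hF0 : ∀ t, F (t, 0) = e (γ t) := by
    intro t
    simp only [hF, w₁0, w₂0, smul_zero, zero_smul, add_zero]
  obtain ⟨δ, hδ, hδε, hFt⟩ := exists_strip_subset hε0 sF.continuousOn
    (isOpen_target (E := E) (x₀ := x₀))
    (fun t ht => by rw [hF0]; exact chart_mem_target (hsrc t ht))
  have i3 : Ioo (-δ) δ ⊆ Ioo (-ε) ε := Ioo_subset_Ioo (neg_le_neg hδε) hδε
  have hdc : d - c ≠ 0 := (sub_pos.2 hcd).ne'
  refine ⟨δ, fun s t => e.symm (F (t, s)), hδ, fun s hs => ?_, fun s hs => ?_, fun t ht => ?_,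
    ⟨∅, fun c' d' hc' hcd' hd' _ => ?_⟩, fun t ht => ?_⟩
  · have : F (c, s) = e (ray (γ c) (X c) s) := by
      simp only [hF, hw₁, sub_self, zero_div, zero_smul, add_zero, div_self hdc, one_smul]
      abel
    rw [this]
    exact chart_symm_chart (hr₁ s (i1 (i3 hs)))
  · have : F (d, s) = e (ray (γ d) (X d) s) := by
      simp only [hF, hw₂, sub_self, zero_div, zero_smul, zero_add, div_self hdc, one_smul]
      abel
    rw [this]
    exact chart_symm_chart (hr₂ s (i2 (i3 hs)))
  · rw [hF0]
    exact chart_symm_chart (hsrc t ht)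
  · intro q hq
    have hq' : q ∈ Icc c d ×ˢ Ioo (-δ) δ := ⟨Icc_subset_Icc hc' hd' hq.1, hq.2⟩
    exact (contMDiffAt_chart_symm (hFt q hq')).comp_contMDiffWithinAt q
      ((sF.mono (prod_mono (Icc_subset_Icc hc' hd') i3)) q hq).contMDiffWithinAt
  · have h0 : e.symm (F (t, 0)) = γ t := by rw [hF0]; exact chart_symm_chart (hsrc t ht)
    have hFd : HasDerivAt (fun s => F (t, s)) (coordL x₀ (γ t) (X t)) 0 := by
      have h := (((hasDerivAt_id (0 : ℝ)).smul_const (coordL x₀ (γ t) (X t))).const_add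
        (e (γ t))).add ((hdw₁.const_smul ((d - t) / (d - c))).add
          (hdw₂.const_smul ((t - c) / (d - c))))
      rw [smul_zero, smul_zero, add_zero, add_zero, one_smul] at h
      exact h
    have hmem0 : F (t, 0) ∈ e.target := hFt (t, 0) ⟨ht, neg_lt_zero.2 hδ, hδ⟩
    refine totalSpace_ext (hsrc t ht) h0 ?_
    refine coordL_velocity (γ := fun s => e.symm (F (t, s))) (by rw [h0]; exact hsrc t ht) ?_ ?_
    · exact ContinuousAt.comp (g := e.symm) (f := fun s => F (t, s))
        (contMDiffAt_chart_symm hmem0).continuousAt hFd.continuousAt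
    · refine hFd.congr_of_eventuallyEq ?_
      filter_upwards [eventually_mem_Ioo_symm hδ] with s hs
      exact e.right_inv (hFt (t, s) ⟨ht, hs⟩)

/-- Glue chart pieces along `[a, b]`. At the two ends `X` vanishes, so the corresponding rays are
constant and the end points stay fixed. -/
lemma exists_isVariation (hab : a < b) {X : ∀ t, TangentSpace 𝓘(ℝ, E) (γ t)}
    (hγ : ContinuousOn γ (Icc a b)) (hX : MemTangentSpace a b γ X) :
    ∃ ε f, IsVariation a b γ X ε f := by
  obtain ⟨S, hS⟩ := hX.piecewise
  obtain ⟨ε, f, hf⟩ : ∃ ε f, IsRayVariation a b γ X ε f := by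
    refine interval_induction_chart (E := E) hab hγ S
      (Q := fun c d => ∃ ε f, IsRayVariation c d γ X ε f) ?_ ?_
    · rintro c m d - hcm hmd - ⟨ε₁, f₁, h₁⟩ ⟨ε₂, f₂, h₂⟩
      exact ⟨_, _, h₁.glue hcm hmd h₂⟩
    · intro x₀ c d hac hcd hdb hsrc hbr
      exact exists_isRayVariation_of_chart hcd hsrc (hS c d hac hcd hdb hbr)
  refine ⟨ε, f, hf.ε_pos, fun s hs => ?_, fun s hs => ?_, hf.base, hf.piecewise, hf.field⟩
  · rw [hf.left s hs, hX.left, ray_zero_vector]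
  · rw [hf.right s hs, hX.right, ray_zero_vector]

end Existence

/-! ### The index form -/

section IndexForm

-- Projection is linear, so this reduces to `indexDensity` being a symmetric bilinear expression in
-- the pairs `(x, x')` and `(y, y')`; `curv_symm` supplies the symmetry of the curvature term.
set_option synthInstance.maxHeartbeats 200000 in
lemma IsLocalModel.perpDensity_add {V : Set E} {Γ : E → E →L[ℝ] E →L[ℝ] E}
    {G B : E → E →L[ℝ] E →L[ℝ] ℝ} {T : E → E} (h : IsLocalModel V Γ G B T) {z : E} (hz : z ∈ V)
    (r : ℝ) (v x x' y y' : E) :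
    perpDensity Γ G B T r z v (x + y) (x' + y') (x + y) (x' + y') =
      perpDensity Γ G B T r z v x x' x x' + perpDensity Γ G B T r z v y y' y y'
        + 2 * perpDensity Γ G B T r z v x x' y y' := by
  have hadd : ∀ x y : E, x + y - (1 / r ^ 2 * G z (x + y) v) • v =
      (x - (1 / r ^ 2 * G z x v) • v) + (y - (1 / r ^ 2 * G z y v) • v) := by
    intro x y
    simp only [map_add, add_apply, mul_add, add_smul]
    abel
  unfold perpDensity
  rw [hadd, hadd]
  generalize x - (1 / r ^ 2 * G z x v) • v = x
  generalize y - (1 / r ^ 2 * G z y v) • v = y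
  generalize x' - (1 / r ^ 2 * G z x' v) • v = x'
  generalize y' - (1 / r ^ 2 * G z y' v) • v = y'
  have hR : christoffelCurv Γ z (x + y) v v =
      christoffelCurv Γ z x v v + christoffelCurv Γ z y v v := by
    simp only [christoffelCurv, map_add, add_apply]
    abel
  simp only [indexDensity, hR, map_add, add_apply]
  rw [h.curv_symm hz v y x, h.G_symm z hz y' x']
  ring

variable {P : PseudohermitianStructure E M}
  {D : CovariantDerivative 𝓘(ℝ, E) E (TangentSpace 𝓘(ℝ, E) : M → Type _)}
  {γ : ℝ → M} {a b r : ℝ} {X Y : ∀ t, TangentSpace 𝓘(ℝ, E) (γ t)}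

lemma ContMDiffOn.field_add {s : Set ℝ}
    (hX : ContMDiffOn 𝓘(ℝ, ℝ) 𝓘(ℝ, E).tangent ∞
      (fun t => (⟨γ t, X t⟩ : TangentBundle 𝓘(ℝ, E) M)) s)
    (hY : ContMDiffOn 𝓘(ℝ, ℝ) 𝓘(ℝ, E).tangent ∞
      (fun t => (⟨γ t, Y t⟩ : TangentBundle 𝓘(ℝ, E) M)) s) :
    ContMDiffOn 𝓘(ℝ, ℝ) 𝓘(ℝ, E).tangent ∞
      (fun t => (⟨γ t, X t + Y t⟩ : TangentBundle 𝓘(ℝ, E) M)) s := by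
  intro t ht
  obtain ⟨h1, h2⟩ := contMDiffWithinAt_totalSpace.1 (hX t ht)
  obtain ⟨-, h3⟩ := contMDiffWithinAt_totalSpace.1 (hY t ht)
  refine contMDiffWithinAt_totalSpace.2 ⟨h1, (h2.add h3).congr_of_eventuallyEq ?_ ?_⟩
  · filter_upwards [h1.continuousWithinAt.eventually (chart_source_mem_nhds E (γ t))] with s hs
    simp only [Pi.add_apply]
    rw [coordL_apply hs, coordL_apply hs, coordL_apply hs, map_add]
  · have hs := mem_chart_source E (γ t)
    simp only [Pi.add_apply]
    rw [coordL_apply hs, coordL_apply hs, coordL_apply hs, map_add]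

lemma MemTangentSpace.add (hX : MemTangentSpace a b γ X) (hY : MemTangentSpace a b γ Y) :
    MemTangentSpace a b γ fun t => X t + Y t := by
  classical
  obtain ⟨S, hS⟩ := hX.piecewise
  obtain ⟨S', hS'⟩ := hY.piecewise
  refine ⟨⟨S ∪ S', fun c d hac hcd hdb hbr => ?_⟩, ?_, ?_⟩
  · exact ContMDiffOn.field_add
      (hS c d hac hcd hdb fun y hy => hbr y (Finset.mem_union_left _ hy))
      (hS' c d hac hcd hdb fun y hy => hbr y (Finset.mem_union_right _ hy))
  · rw [hX.left, hY.left, add_zero]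
  · rw [hX.right, hY.right, add_zero]

/-- Away from finitely many parameters, a piecewise property holds on a neighbourhood. -/
lemma Piecewise.exists_nhds {p : ℝ → ℝ → Prop} (h : Piecewise a b p) :
    ∃ S : Finset ℝ, ∀ t ∈ Ioo a b, t ∉ S → ∃ c d, t ∈ Ioo c d ∧ p c d := by
  obtain ⟨S, hS⟩ := h
  refine ⟨S, fun t ht htS => ?_⟩
  have hn : (S : Set ℝ)ᶜ ∩ Ioo a b ∈ 𝓝 t :=
    inter_mem (S.finite_toSet.isClosed.isOpen_compl.mem_nhds htS) (isOpen_Ioo.mem_nhds ht)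
  obtain ⟨η, hη, hball⟩ := Metric.nhds_basis_closedBall.mem_iff.1 hn
  rw [Real.closedBall_eq_Icc] at hball
  have hl := (hball (left_mem_Icc.2 (by linarith) : t - η ∈ Icc (t - η) (t + η))).2
  have hr := (hball (right_mem_Icc.2 (by linarith) : t + η ∈ Icc (t - η) (t + η))).2
  exact ⟨t - η, t + η, ⟨by linarith, by linarith⟩, hS _ _ hl.1.le (by linarith) hr.2.le
    fun y hy hyt => (hball (Ioo_subset_Icc_self hyt)).1 hy⟩

lemma ae_Ioo_notMem (S : Finset ℝ) {p : ℝ → Prop} (h : ∀ t ∈ Ioo a b, t ∉ S → p t) (hab : a < b) :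
    ∀ᵐ t ∂(volume.restrict (uIoc a b)), p t := by
  rw [ae_restrict_iff' measurableSet_uIoc, uIoc_of_le hab.le]
  -- The interval of integration is half open, so `b` has to be discarded along with the break
  -- points.
  filter_upwards [(insert b (S : Set ℝ)).toFinite.countable.ae_notMem volume] with t ht hab
  simp only [mem_insert_iff, not_or] at ht
  exact h t ⟨hab.1, lt_of_le_of_ne hab.2 ht.1⟩ ht.2

/-- Smoothness at `t` makes the coordinate velocity differentiable there, and `C^1` regularity
identifies it with the velocity at neighbouring parameters. -/
lemma IsLengthyGeodesic.geodesicAt (hγ : IsLengthyGeodesic P D a b r γ) {t : ℝ} (ht : t ∈ Ioo a b)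
    (hs : ContMDiffAt 𝓘(ℝ, ℝ) 𝓘(ℝ, E) ∞ γ t) : ∃ c c', GeodesicAt D (γ t) γ t c c' := by
  have hy := mem_chart_source E (γ t)
  have hφ : ContDiffAt ℝ ∞ (fun s => extChartAt 𝓘(ℝ, E) (γ t) (γ s)) t :=
    contMDiffAt_iff_contDiffAt.1 ((contMDiffAt_chart hy).comp t hs)
  have hC1 : ∀ᶠ s in 𝓝 t, ContMDiffAt 𝓘(ℝ, ℝ) 𝓘(ℝ, E) 1 γ s := by
    filter_upwards [isOpen_Ioo.mem_nhds ht] with s hs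
    exact hγ.contMDiffOn.contMDiffAt (Icc_mem_nhds hs.1 hs.2)
  refine ⟨fun s => fderiv ℝ (fun s => extChartAt 𝓘(ℝ, E) (γ t) (γ s)) s 1, _, hy,
    hC1.mono fun s hs => hs.continuousAt, ?_,
    ((IsLocalModel.contDiffAt_fderiv_apply hφ 1).differentiableAt (by simp)).hasDerivAt,
    hγ.geodesic t ht⟩
  filter_upwards [hC1, hs.continuousAt.eventually (chart_source_mem_nhds E (γ t))] with s hs hs'
  exact (hasDerivAt_chart_comp hs'
    (hs.mdifferentiableAt (by simp))).differentiableAt.hasFDerivAt.hasDerivAt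

lemma differentiableAt_coordL {t : ℝ}
    (hX : ContMDiffAt 𝓘(ℝ, ℝ) 𝓘(ℝ, E).tangent ∞
      (fun t => (⟨γ t, X t⟩ : TangentBundle 𝓘(ℝ, E) M)) t) :
    DifferentiableAt ℝ (fun s => coordL (γ t) (γ s) (X s)) t := by
  obtain ⟨h1, h2⟩ := contMDiffAt_totalSpace.1 hX
  have h3 := (contMDiffAt_iff_contDiffAt.1 h2).differentiableAt (by simp)
  refine h3.congr_of_eventuallyEq ?_
  filter_upwards [h1.continuousAt.eventually (chart_source_mem_nhds E (γ t))] with s hs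
  exact (coordL_apply hs _).symm

/-- Existence of at least one variation is essential: without it every number would satisfy the
universal clause. Uniqueness is what pins down the value chosen by `Classical.epsilon` in
`secondVariation`. -/
lemma PseudohermitianStructure.HasSecondVariation.unique {h h' : ℝ}
    (H : P.HasSecondVariation a b γ X h) (H' : P.HasSecondVariation a b γ X h') : h = h' := by
  obtain ⟨ε, f, hf⟩ := H.1
  obtain ⟨L, h1, h2⟩ := H.2 ε f hf
  obtain ⟨L', h1', h2'⟩ := H'.2 ε f hf
  refine h2.unique (h2'.congr_of_eventuallyEq ?_)
  filter_upwards [h1, h1'] with s hs hs'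
  exact hs.unique hs'

variable [T2Space M]

/-- Polarization of the integrand of the index form. -/
lemma indexIntegrand_polarization (hab : a < b) (hD : P.IsTanakaWebster D) (hS : P.IsSasakian D)
    (hγ : IsLengthyGeodesic P D a b r γ) (hX : MemTangentSpace a b γ X)
    (hY : MemTangentSpace a b γ Y) :
    ∀ᵐ t ∂(volume.restrict (uIoc a b)),
      P.indexIntegrand D γ (P.perp r γ fun t => X t + Y t) (P.perp r γ fun t => X t + Y t) t =
        P.indexIntegrand D γ (P.perp r γ X) (P.perp r γ X) t
          + P.indexIntegrand D γ (P.perp r γ Y) (P.perp r γ Y) t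
          + 2 * P.indexIntegrand D γ (P.perp r γ X) (P.perp r γ Y) t := by
  classical
  obtain ⟨S₁, h₁⟩ := hX.piecewise.exists_nhds
  obtain ⟨S₂, h₂⟩ := hY.piecewise.exists_nhds
  refine ae_Ioo_notMem (S₁ ∪ S₂) (fun t ht htS => ?_) hab
  simp only [Finset.mem_union, not_or] at htS
  obtain ⟨c₁, d₁, ht₁, hX₁⟩ := h₁ t ht htS.1
  obtain ⟨c₂, d₂, ht₂, hY₂⟩ := h₂ t ht htS.2
  have hXt := hX₁.contMDiffAt (Icc_mem_nhds ht₁.1 ht₁.2)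
  have hYt := hY₂.contMDiffAt (Icc_mem_nhds ht₂.1 ht₂.2)
  obtain ⟨c, c', hG⟩ := hγ.geodesicAt ht (contMDiffAt_totalSpace.1 hXt).1
  have dX := (differentiableAt_coordL hXt).hasDerivAt
  have dY := (differentiableAt_coordL hYt).hasDerivAt
  have dXY := (dX.add dY).congr_of_eventuallyEq (f₁ := fun s => coordL (γ t) (γ s) (X s + Y s))
    (Eventually.of_forall fun s => map_add _ _ _)
  rw [hG.indexIntegrand_perp hD hS dXY dXY, hG.indexIntegrand_perp hD hS dX dX,
    hG.indexIntegrand_perp hD hS dY dY, hG.indexIntegrand_perp hD hS dX dY, map_add, map_add,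
    add_add_add_comm,
    (hD.isLocalModel hS (γ t)).perpDensity_add (chart_mem_target hG.mem_source)]

lemma hasSecondVariation (hab : a < b) (hr : 0 < r) (hD : P.IsTanakaWebster D)
    (hS : P.IsSasakian D) (hγ : IsLengthyGeodesic P D a b r γ) (hX : MemTangentSpace a b γ X) :
    P.HasSecondVariation a b γ X
      (1 / r * ∫ t in a..b, P.indexIntegrand D γ (P.perp r γ X) (P.perp r γ X) t) :=
  ⟨exists_isVariation hab hγ.contMDiffOn.continuousOn hX,
    fun _ _ hf => (hf.second_variation hab hr hD hS hγ).2⟩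

lemma secondVariation_eq (hab : a < b) (hr : 0 < r) (hD : P.IsTanakaWebster D)
    (hS : P.IsSasakian D) (hγ : IsLengthyGeodesic P D a b r γ) (hX : MemTangentSpace a b γ X) :
    P.secondVariation a b γ X =
      1 / r * ∫ t in a..b, P.indexIntegrand D γ (P.perp r γ X) (P.perp r γ X) t :=
  have h := hasSecondVariation hab hr hD hS hγ hX
  (Classical.epsilon_spec (p := P.HasSecondVariation a b γ X) ⟨_, h⟩).unique h

lemma intervalIntegrable_indexIntegrand_self (hab : a < b) (hr : 0 < r) (hD : P.IsTanakaWebster D)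
    (hS : P.IsSasakian D) (hγ : IsLengthyGeodesic P D a b r γ) (hX : MemTangentSpace a b γ X) :
    IntervalIntegrable (P.indexIntegrand D γ (P.perp r γ X) (P.perp r γ X)) volume a b := by
  obtain ⟨ε, f, hf⟩ := exists_isVariation hab hγ.contMDiffOn.continuousOn hX
  exact (hf.second_variation hab hr hD hS hγ).1

/-- The index form of a lengthy geodesic. -/
lemma indexForm_eq (hab : a < b) (hr : 0 < r) (hD : P.IsTanakaWebster D)
    (hS : P.IsSasakian D) (hγ : IsLengthyGeodesic P D a b r γ) (hX : MemTangentSpace a b γ X)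
    (hY : MemTangentSpace a b γ Y) :
    IntervalIntegrable (P.indexIntegrand D γ (P.perp r γ X) (P.perp r γ Y)) volume a b ∧
    P.indexForm a b γ X Y =
      1 / r * ∫ t in a..b, P.indexIntegrand D γ (P.perp r γ X) (P.perp r γ Y) t := by
  have hpol := indexIntegrand_polarization hab hD hS hγ hX hY
  have iX := intervalIntegrable_indexIntegrand_self hab hr hD hS hγ hX
  have iY := intervalIntegrable_indexIntegrand_self hab hr hD hS hγ hY
  have iXY := intervalIntegrable_indexIntegrand_self hab hr hD hS hγ (hX.add hY)
  -- The mixed integrand is half of a combination of three diagonal ones almost everywhere, and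
  -- those are integrable by the second variation formula.
  have i : IntervalIntegrable (P.indexIntegrand D γ (P.perp r γ X) (P.perp r γ Y)) volume a b := by
    refine (((iXY.sub iX).sub iY).const_mul (1 / 2)).congr_ae ?_
    filter_upwards [hpol] with t ht
    simp only [ht]
    ring
  refine ⟨i, ?_⟩
  rw [PseudohermitianStructure.indexForm, secondVariation_eq hab hr hD hS hγ (hX.add hY),
    secondVariation_eq hab hr hD hS hγ hX, secondVariation_eq hab hr hD hS hγ hY,
    intervalIntegral.integral_congr_ae_restrict hpol,
    intervalIntegral.integral_add (iX.add iY) (i.const_mul 2),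
    intervalIntegral.integral_add iX iY, intervalIntegral.integral_const_mul]
  ring

lemma indexForm_self (hab : a < b) (hr : 0 < r) (hD : P.IsTanakaWebster D)
    (hS : P.IsSasakian D) (hγ : IsLengthyGeodesic P D a b r γ) (hX : MemTangentSpace a b γ X) :
    P.HasSecondVariation a b γ X (P.indexForm a b γ X X) := by
  rw [(indexForm_eq hab hr hD hS hγ hX hX).2]
  exact hasSecondVariation hab hr hD hS hγ hX

end IndexForm

end CRGeom

end

theorem theoremt {E : Type*} [NormedAddCommGroup E] [NormedSpace ℝ E] [FiniteDimensional ℝ E]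
    (n : ℕ) (hdim : Module.finrank ℝ E = 2 * n + 1)
    {M : Type*} [TopologicalSpace M] [T2Space M] [SecondCountableTopology M]
    [ChartedSpace E M] [IsManifold 𝓘(ℝ, E) ∞ M]
    (P : CRGeom.PseudohermitianStructure E M)
    (D : CovariantDerivative 𝓘(ℝ, E) E (TangentSpace 𝓘(ℝ, E) : M → Type _))
    (hD : P.IsTanakaWebster D) (hSasakian : P.IsSasakian D)
    {a b : ℝ} (hab : a < b) {y z : M} {r : ℝ} (hr : 0 < r) (γ : ℝ → M)
    (hΓ : P.MemPaths a b y z r γ) (hlengthy : P.IsLengthy a b γ)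
    (hgeo : CRGeom.IsGeodesic E D a b γ) :
    (∀ X : (∀ t, TangentSpace 𝓘(ℝ, E) (γ t)), CRGeom.MemTangentSpace a b γ X →
      P.HasSecondVariation a b γ X (P.indexForm a b γ X X)) ∧
    ∀ X Y : (∀ t, TangentSpace 𝓘(ℝ, E) (γ t)),
      CRGeom.MemTangentSpace a b γ X → CRGeom.MemTangentSpace a b γ Y →
      IntervalIntegrable (P.indexIntegrand D γ (P.perp r γ X) (P.perp r γ Y)) volume a b ∧
      P.indexForm a b γ X Y
        = (1 / r) * ∫ t in a..b,
            P.indexIntegrand D γ (P.perp r γ X) (P.perp r γ Y) t := by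
  have hγ := CRGeom.isLengthyGeodesic hr hΓ hlengthy hgeo
  exact ⟨fun X hX => CRGeom.indexForm_self hab hr hD hSasakian hγ hX,
    fun X Y hX hY => CRGeom.indexForm_eq hab hr hD hSasakian hγ hX hY⟩
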